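/- **Transformation and expansion.** For $t\in\mathbb{R}$ let $\langle t\rangle=\{t\}$ if $t\notin\mathbb{Z}$ and $\langle t\rangle=1$ if $t\in\mathbb{Z}$. For $\beta>1$ let $\overline T_\beta(x)=\langle\beta x\rangle$ for $x\in[0,1]$, and $\overline d_\beta(x)=x_1x_2\cdots$ with $x_i=\lceil\beta\,\overline T_\beta^{\,i-1}(x)\rceil-1$. A set $S\subset[0,1]$ is *invariant* if $\overline T_\beta(S)=S$, and it has *frequency* $\alpha$ if $\lim_n\frac1n\sum_{k=1}^n x_k=\alpha$ for every $x\in S$, where $\overline d_\beta(x)=x_1x_2\cdots$. An *orbit closure* is the closure of $\{\overline T_\beta^n(x):n\ge0\}$ for some $x\in[0,1]$. **$\Xi$.** For $\alpha>0$ and $\beta>1$, $\Xi(\alpha,\beta)$ is the maximum of an invariant orbit closure of $\overline T_\beta$ that has frequency $\alpha$ and is contained in an interval $[t,t+\frac1\beta]\subset[0,1]$. It is *not defined* if there is no such orbit closure, and *well defined* if there is exactly one (and its maximum exists). **Words.** For $\alpha\ge0$ and $0\le\rho\le1$, the lower and upper mechanical words of slope $\alpha$ and intercept $\rho$ are $s_{\alpha,\rho}(n)=\lfloor\alpha(n+1)+\rho\rfloor-\lfloor\alpha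 n+\rho\rfloor$ and $s'_{\alpha,\rho}(n)=\lceil\alpha(n+1)+\rho\rceil-\lceil\alpha n+\rho\rceil$, $n\ge0$. Words are compared lexicographically. For an integer $a$ and $b=a+1$, a finite word $z$ is *central* over $\{a,b\}$ if, for some coprime integers $p$ and $q\ge1$ with $a<p/q<b$, the first $q$ letters of $s_{p/q,0}$ form the word $azb$. Write $|w|_b$ for the number of letters $b$ in $w$. **$\Delta$.** For $\alpha>0$, $\Delta(\alpha)$ is the number $\beta>1$ with $\overline d_\beta(1)=s'_{\alpha,0}$. **$\mathrm{Freq}$.** If $\beta>1$ is an integer, $\mathrm{Freq}(\beta)=\beta-1$. Otherwise let $b=\lfloor\beta\rfloor$ and $a=b-1$, and write $\overline d_\beta(1)=bs$. 1. $\mathrm{Freq}(\beta)=a$ if $s\le a^\omega$; $\mathrm{Freq}(\beta)=b$ if $s\ge b^\omega$; $\mathrm{Freq}(\beta)=\alpha$ if $as=s_{\alpha,0}$ or $bs=s'_{\alpha,0}$ with $\alpha\in[a,b]$. 2. In all other cases let $u$ be the longest prefix of $s$ that is central over $\{a,b\}$. * If $u=a^k$ with $k\ge1$, let $v$ be the block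 of length $k+1$ that follows $u$ in $s$. Then $\mathrm{Freq}(\beta)=a+\frac1{k+2}$ if $a^{k+1}<v<ba^k$, and $\mathrm{Freq}(\beta)=a+\frac1{k+1}$ if $v>ba^k$. * If $u=b^k$ with $k\ge1$, let $v$ be the block of length $k+1$ that follows $u$ in $s$. Then $\mathrm{Freq}(\beta)=b-\frac1{k+2}$ if $ab^k<v<b^{k+1}$, and $\mathrm{Freq}(\beta)=b-\frac1{k+1}$ if $v<ab^k$. * If $u=pabq=qbap$ with $p,q$ central over $\{a,b\}$, let $s=uxyv\cdots$ with letters $x,y$ and a word $v$ of length $|u|+2$, and put $\varphi(w)=a+\frac{|w|_b+1}{|w|+2}$. Then $\mathrm{Freq}(\beta)=\varphi(u)$ if ($xy=ab$ and $v>uab$), or $ab<xy<ba$, or ($xy=ba$ and $v<uba$); $\mathrm{Freq}(\beta)=\varphi(q)$ if ($xy=ab$ and $v<uab$), or $xy\le aa$; $\mathrm{Freq}(\beta)=\varphi(p)$ if ($xy=ba$ and $v>uba$), or $xy\ge bb$. **Theorem.** (a) Let $\beta>1$. These rules determine exactly one number $\mathrm{Freq}(\beta)$. The function $\Xi(\alpha,\beta)$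 is well defined for every $0<\alpha\le\mathrm{Freq}(\beta)$, and it is not defined for any $\alpha>\mathrm{Freq}(\beta)$. (b) Let $\alpha>0$. There is exactly one number $\Delta(\alpha)$ as above. The function $\Xi(\alpha,\beta)$ is well defined for every $\beta\ge\Delta(\alpha)$, and it is not defined for any $1<\beta<\Delta(\alpha)$. (c) Let $\beta>1$. If $\overline d_\beta(1)$ is a (lower or upper) mechanical word of slope $\alpha_0$, then $\Xi(\alpha,\beta)$ is well defined for every $0<\alpha\le\alpha_0$. -/

import Mathlib

namespace BetaOrbit

/-- `⟨t⟩`: the fractional part of `t`, except that it is `1` when `t` is an integer. -/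
noncomputable def angle (t : ℝ) : ℝ :=
  if Int.fract t = 0 then 1 else Int.fract t

/-- The transformation `x ↦ ⟨β x⟩`, considered on `[0,1]`. -/
noncomputable def Tbar (β x : ℝ) : ℝ := angle (β * x)

/-- The expansion of `x` associated with `Tbar β`; the digits are indexed from `0`. -/
noncomputable def dbar (β x : ℝ) : ℕ → ℤ := fun i => ⌈β * (Tbar β)^[i] x⌉ - 1

/-- The point `x` has frequency `α` in base `β`: the digit averages converge to `α`. -/
def HasFreq (β x α : ℝ) : Prop :=
  Filter.Tendsto (fun n : ℕ => (∑ k ∈ Finset.range n, (dbar β x k : ℝ)) / (n : ℝ))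
    Filter.atTop (nhds α)

/-- The closure of the forward orbit of `x` under `Tbar β`. -/
def orbitClosure (β x : ℝ) : Set ℝ := closure (Set.range fun n : ℕ => (Tbar β)^[n] x)

/-- `S` is an invariant orbit closure, contained in an interval `[t, t + 1/β] ⊆ [0,1]`, all of
whose points have frequency `α`. -/
def IsXiSet (α β : ℝ) (S : Set ℝ) : Prop :=
  (∃ x ∈ Set.Icc (0 : ℝ) 1, S = orbitClosure β x) ∧
  Tbar β '' S = S ∧
  (∃ t : ℝ, S ⊆ Set.Icc t (t + 1 / β) ∧ Set.Icc t (t + 1 / β) ⊆ Set.Icc 0 1) ∧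
  ∀ x ∈ S, HasFreq β x α

/-- `ξ` is a value of `Ξ` at `(α, β)`: the maximum of an orbit closure as above. -/
def IsXi (α β ξ : ℝ) : Prop := ∃ S, IsXiSet α β S ∧ IsGreatest S ξ

/-- `Ξ(α, β)` is well defined: there is exactly one orbit closure as above, and it has
a maximum, which is then the unique value of `Ξ`. -/
def XiWellDefined (α β : ℝ) : Prop := (∃! S, IsXiSet α β S) ∧ ∃! ξ, IsXi α β ξ

/-- The lower mechanical word of slope `α` and intercept `ρ`. -/
noncomputable def lowerMech (α ρ : ℝ) : ℕ → ℤ := fun n => ⌊α * (n + 1) + ρ⌋ - ⌊α * n + ρ⌋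

/-- The upper mechanical word of slope `α` and intercept `ρ`. -/
noncomputable def upperMech (α ρ : ℝ) : ℕ → ℤ := fun n => ⌈α * (n + 1) + ρ⌉ - ⌈α * n + ρ⌉

/-- `w` is a (lower or upper) mechanical word of slope `α`. -/
def IsMechanical (w : ℕ → ℤ) (α : ℝ) : Prop :=
  0 ≤ α ∧ ∃ ρ ∈ Set.Icc (0 : ℝ) 1, w = lowerMech α ρ ∨ w = upperMech α ρ

/-- `δ = Δ(α)`: `Δ(0) = 1`, and for `α > 0` it is the base `δ > 1` in which the expansion of `1` is
the upper mechanical word of slope `α` and intercept `0`. -/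
def IsDelta (α δ : ℝ) : Prop :=
  (α = 0 ∧ δ = 1) ∨ (0 < α ∧ 1 < δ ∧ dbar δ 1 = upperMech α 0)

/-- The infinite word `c s`, for a letter `c` and an infinite word `s`. -/
def cons (c : ℤ) (s : ℕ → ℤ) : ℕ → ℤ
  | 0 => c
  | n + 1 => s n

/-- The block of length `n` of the infinite word `s` that starts at position `i`. -/
def block (s : ℕ → ℤ) (i n : ℕ) : List ℤ := (List.range n).map fun j => s (i + j)

/-- `u` is a central word over `{a, a+1}`: `a u (a+1)` is a lower Christoffel word, i.e. the
period of length `q` of the lower mechanical word of slope `p/q`, with `a < p/q < a+1` in lowest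
terms. -/
def IsCentral (a : ℤ) (u : List ℤ) : Prop :=
  ∃ (p : ℤ) (q : ℕ), 0 < q ∧ IsCoprime p (q : ℤ) ∧ a * q < p ∧ p < (a + 1) * q ∧
    a :: (u ++ [a + 1]) = block (lowerMech ((p : ℝ) / (q : ℝ)) 0) 0 q

/-- `u` is the longest prefix of `s` that is a central word over `{a, a+1}`. -/
def IsLongestCentralPrefix (a : ℤ) (s : ℕ → ℤ) (u : List ℤ) : Prop :=
  (IsCentral a u ∧ block s 0 u.length = u) ∧
  ∀ w : List ℤ, IsCentral a w → block s 0 w.length = w → w.length ≤ u.length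

/-- The three special cases. Infinite words are compared lexicographically. -/
inductive MeagerFreq (a : ℤ) (s : ℕ → ℤ) : ℝ → Prop
  | low : toLex s ≤ toLex (fun _ => a) → MeagerFreq a s a
  | high : toLex (fun _ => a + 1) ≤ toLex s → MeagerFreq a s (a + 1)
  | mech (α : ℝ) : α ∈ Set.Icc (a : ℝ) (a + 1) →
      (cons a s = lowerMech α 0 ∨ cons (a + 1) s = upperMech α 0) → MeagerFreq a s α

/-- The generic cases, where `u` is the longest central prefix of `s`. Finite words of the
same length are compared lexicographically. -/
inductive GenericFreq (a : ℤ) (s : ℕ → ℤ) (u : List ℤ) : ℝ → Prop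
  | powA_low (k : ℕ) : 1 ≤ k → u = List.replicate k a →
      List.replicate (k + 1) a < block s k (k + 1) →
      block s k (k + 1) < (a + 1) :: List.replicate k a →
      GenericFreq a s u (a + 1 / (k + 2))
  | powA_high (k : ℕ) : 1 ≤ k → u = List.replicate k a →
      (a + 1) :: List.replicate k a < block s k (k + 1) →
      GenericFreq a s u (a + 1 / (k + 1))
  | powB_high (k : ℕ) : 1 ≤ k → u = List.replicate k (a + 1) →
      a :: List.replicate k (a + 1) < block s k (k + 1) →
      block s k (k + 1) < List.replicate (k + 1) (a + 1) →
      GenericFreq a s u (a + 1 - 1 / (k + 2))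
  | powB_low (k : ℕ) : 1 ≤ k → u = List.replicate k (a + 1) →
      block s k (k + 1) < a :: List.replicate k (a + 1) →
      GenericFreq a s u (a + 1 - 1 / (k + 1))
  | mixed_u (p q xy v : List ℤ) : IsCentral a p → IsCentral a q →
      u = p ++ [a, a + 1] ++ q → u = q ++ [a + 1, a] ++ p →
      xy = block s u.length 2 → v = block s (u.length + 2) (u.length + 2) →
      ((xy = [a, a + 1] ∧ u ++ [a, a + 1] < v) ∨ ([a, a + 1] < xy ∧ xy < [a + 1, a]) ∨
        (xy = [a + 1, a] ∧ v < u ++ [a + 1, a])) →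
      GenericFreq a s u (a + ((u.count (a + 1) : ℝ) + 1) / ((u.length : ℝ) + 2))
  | mixed_q (p q xy v : List ℤ) : IsCentral a p → IsCentral a q →
      u = p ++ [a, a + 1] ++ q → u = q ++ [a + 1, a] ++ p →
      xy = block s u.length 2 → v = block s (u.length + 2) (u.length + 2) →
      ((xy = [a, a + 1] ∧ v < u ++ [a, a + 1]) ∨ xy ≤ [a, a]) →
      GenericFreq a s u (a + ((q.count (a + 1) : ℝ) + 1) / ((q.length : ℝ) + 2))
  | mixed_p (p q xy v : List ℤ) : IsCentral a p → IsCentral a q →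
      u = p ++ [a, a + 1] ++ q → u = q ++ [a + 1, a] ++ p →
      xy = block s u.length 2 → v = block s (u.length + 2) (u.length + 2) →
      ((xy = [a + 1, a] ∧ u ++ [a + 1, a] < v) ∨ [a + 1, a + 1] ≤ xy) →
      GenericFreq a s u (a + ((p.count (a + 1) : ℝ) + 1) / ((p.length : ℝ) + 2))

/-- The frequency `φ` attached to the infinite word `s` and the letters `a`, `b = a + 1`. -/
def WordFreq (a : ℤ) (s : ℕ → ℤ) (φ : ℝ) : Prop :=
  MeagerFreq a s φ ∨
  ((∀ ψ, ¬ MeagerFreq a s ψ) ∧ ∃ u, IsLongestCentralPrefix a s u ∧ GenericFreq a s u φ)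

/-- `φ = Freq(β)`: for an integer `β` it is `β - 1`; otherwise the expansion of `1` is `b s` with
`b = ⌊β⌋`, and `φ` is the frequency attached to `s` and the letters `b - 1`, `b`. -/
def IsFreq (β φ : ℝ) : Prop :=
  ((∃ m : ℤ, β = m) ∧ φ = β - 1) ∨
  ((¬ ∃ m : ℤ, β = m) ∧ ∃ s : ℕ → ℤ, dbar β 1 = cons ⌊β⌋ s ∧ WordFreq (⌊β⌋ - 1) s φ)

end BetaOrbit

open BetaOrbit

/-! Everything follows from one criterion: for `α > 0` and `β > 1`, an invariant orbit closure as
required exists, and is then unique, exactly when `upperMech α 0 ≤ dbar β 1` lexicographically.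

Necessity uses only the mean. All shifts of the expansion of a point are at most `dbar β 1`, and a
word of mean `α` has shifts that are not bounded away from `upperMech α 0` from below
(`upperMech_le_of_mean`). The same lemma gives (c), applied to `dbar β 1` itself. Sufficiency
(`exists_isXiSet`): the upper mechanical word dominates its shifts, so it is the expansion of a
point; balance puts the orbit closure of this point into an interval of length `1 / β`, and
recurrence makes it invariant.

For uniqueness, a set of diameter at most `1 / β` carries a monotone lift of `Tbar β`, as for circle
rotations (`lift_mono`). Its rotation number is `α`, and this determines all digit sums up to one.
The expansion of the maximum is then forced to be `upperMech α 0`, and the set is the orbit closure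
of its maximum: by density of multiples of `α` modulo one if `α` is irrational, by periodicity if
`α` is rational (`IsXiSet.exists_eq_orbitClosure`).

Part (b) follows since `dbar β 1` increases strictly with `β` and attains every upper mechanical
word of positive slope. For (a), the rules must find the largest slope `φ` with `upperMech φ 0 ≤
dbar β 1` (`IsSharpSlope`). With `dbar β 1 = b s` and `a < φ < b`, this slope is `φ` whenever `s`
lies between the tails of `upperMech φ 0` and `lowerMech φ 0` (`isSharpSlope_of_between`). For
rational `φ` with central word `w` these tails are `(w a b)^ω` and `(w b a)^ω`. The generic rules
locate the interval containing `s` from its longest central prefix, using Farey neighbours. Since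
every rule yields a sharp slope, overlapping rules agree. -/

namespace BetaOrbit

/-! ### Partial sums, shifts and the lexicographic order on infinite words. -/

/-- The sum of the first `n` letters of an infinite word. -/
def psum (w : ℕ → ℤ) (n : ℕ) : ℤ := ∑ k ∈ Finset.range n, w k

/-- The infinite word obtained by deleting the first `i` letters. -/
def shift (w : ℕ → ℤ) (i : ℕ) : ℕ → ℤ := fun n => w (n + i)

theorem psum_zero (w : ℕ → ℤ) : psum w 0 = 0 := by simp [psum]

theorem psum_succ (w : ℕ → ℤ) (n : ℕ) : psum w (n + 1) = psum w n + w n :=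
  Finset.sum_range_succ _ _

theorem psum_shift (w : ℕ → ℤ) (i n : ℕ) : psum (shift w i) n = psum w (n + i) - psum w i := by
  induction n with
  | zero => simp [psum_zero]
  | succ n ih => rw [psum_succ, ih, Nat.add_right_comm, psum_succ, shift]; ring

theorem shift_shift (w : ℕ → ℤ) (i j : ℕ) : shift (shift w i) j = shift w (j + i) := by
  funext n; simp [shift, add_assoc]

theorem shift_zero (w : ℕ → ℤ) : shift w 0 = w := rfl

theorem psum_cons_succ (c : ℤ) (s : ℕ → ℤ) (n : ℕ) : psum (cons c s) (n + 1) = c + psum s n := by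
  induction n with
  | zero => simp [psum, cons]
  | succ n ih => rw [psum_succ, ih, psum_succ]; simp [cons]; ring

theorem psum_const (c : ℤ) (n : ℕ) : psum (fun _ => c) n = n * c := by simp [psum]

theorem psum_upperMech (α : ℝ) (n : ℕ) : psum (upperMech α 0) n = ⌈α * n⌉ := by
  induction n with
  | zero => simp [psum_zero]
  | succ n ih => rw [psum_succ, ih, upperMech]; simp

theorem psum_lowerMech (α : ℝ) (n : ℕ) : psum (lowerMech α 0) n = ⌊α * n⌋ := by
  induction n with
  | zero => simp [psum_zero]
  | succ n ih => rw [psum_succ, ih, lowerMech]; simp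

theorem eq_of_psum {w v : ℕ → ℤ} (h : ∀ n, psum w n = psum v n) : w = v := by
  funext n
  have h1 := h (n + 1)
  rw [psum_succ, psum_succ, h n] at h1
  linarith

theorem psum_congr {w v : ℕ → ℤ} {n : ℕ} (h : ∀ k < n, w k = v k) : psum w n = psum v n :=
  Finset.sum_congr rfl fun k hk => h k (Finset.mem_range.1 hk)

theorem lex_lt_iff {w v : ℕ → ℤ} :
    toLex w < toLex v ↔ ∃ i, (∀ j < i, w j = v j) ∧ w i < v i := Iff.rfl

theorem lex_trichotomy (w v : ℕ → ℤ) :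
    w = v ∨ ∃ i, (∀ j < i, w j = v j) ∧ w i ≠ v i := by
  classical
  by_cases h : w = v
  · exact Or.inl h
  · right
    have h' : ∃ i, w i ≠ v i := Function.ne_iff.1 h
    exact ⟨Nat.find h', fun j hj => not_not.1 (Nat.find_min h' hj), Nat.find_spec h'⟩

theorem lex_le_iff {w v : ℕ → ℤ} : toLex w ≤ toLex v ↔ w = v ∨ toLex w < toLex v := by
  rw [le_iff_eq_or_lt, toLex_inj]
  exact Iff.rfl

/-- Up to the first differing letter the partial sums agree, so the next partial sum decides the
order. Comparisons of mechanical words thereby become inequalities between floors and ceilings. -/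
theorem lex_le_of_psum {w v : ℕ → ℤ} (h : ∀ n, psum w n ≤ psum v n) : toLex w ≤ toLex v := by
  rcases lex_trichotomy w v with rfl | ⟨i, hi, hne⟩
  · exact le_rfl
  · refine le_of_lt (lex_lt_iff.2 ⟨i, hi, lt_of_le_of_ne ?_ hne⟩)
    have h1 := h (i + 1)
    rw [psum_succ, psum_succ, psum_congr hi] at h1
    linarith

theorem lex_lt_of_psum {w v : ℕ → ℤ} (h : ∀ n, psum w n ≤ psum v n)
    (h' : ∃ n, psum w n < psum v n) : toLex w < toLex v := by
  rcases lex_le_iff.1 (lex_le_of_psum h) with rfl | h1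
  · exact absurd h'.choose_spec (lt_irrefl _)
  · exact h1

/-! ### Balance, maximality and monotonicity of upper mechanical words. -/

theorem ceil_add_le_ceil_add_ceil (x y : ℝ) : ⌈x⌉ + ⌈y⌉ - 1 ≤ ⌈x + y⌉ := by
  have := Int.ceil_lt_add_one x
  have := Int.ceil_lt_add_one y
  have := Int.le_ceil (x + y)
  have : ((⌈x⌉ + ⌈y⌉ - 1 : ℤ) : ℝ) < ⌈x + y⌉ + 1 := by push_cast; linarith
  exact_mod_cast Int.lt_add_one_iff.1 (by exact_mod_cast this)

theorem psum_shift_upperMech (α : ℝ) (i n : ℕ) :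
    psum (shift (upperMech α 0) i) n = ⌈α * n + α * i⌉ - ⌈α * i⌉ := by
  rw [psum_shift, psum_upperMech, psum_upperMech]; push_cast; ring_nf

theorem psum_shift_upperMech_le (α : ℝ) (i n : ℕ) :
    psum (shift (upperMech α 0) i) n ≤ ⌈α * n⌉ := by
  rw [psum_shift_upperMech]
  have := Int.ceil_add_le (α * n) (α * i)
  linarith

/-- Together with the preceding upper bound this is balance: factors of equal length have sums that
differ by at most one. -/
theorem le_psum_shift_upperMech (α : ℝ) (i n : ℕ) :
    ⌈α * n⌉ - 1 ≤ psum (shift (upperMech α 0) i) n := by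
  rw [psum_shift_upperMech]
  have := ceil_add_le_ceil_add_ceil (α * n) (α * i)
  linarith

theorem shift_upperMech_le (α : ℝ) (i : ℕ) :
    toLex (shift (upperMech α 0) i) ≤ toLex (upperMech α 0) :=
  lex_le_of_psum fun n => by rw [psum_upperMech]; exact psum_shift_upperMech_le α i n

theorem upperMech_nonneg {α : ℝ} (hα : 0 ≤ α) (n : ℕ) : 0 ≤ upperMech α 0 n := by
  rw [upperMech]
  have : ⌈α * n + 0⌉ ≤ ⌈α * (n + 1) + 0⌉ := Int.ceil_le_ceil (by linarith)
  linarith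

theorem upperMech_le (α : ℝ) (n : ℕ) : upperMech α 0 n ≤ ⌈α⌉ := by
  have := psum_shift_upperMech_le α n 1
  simpa [psum, shift] using this

theorem upperMech_mono {α γ : ℝ} (h : α ≤ γ) : toLex (upperMech α 0) ≤ toLex (upperMech γ 0) :=
  lex_le_of_psum fun n => by
    rw [psum_upperMech, psum_upperMech]
    exact Int.ceil_le_ceil (by gcongr)

/-- Supplies the single strict inequality that turns termwise bounds of partial sums into strict
lexicographic order. -/
theorem exists_floor_add_two_le {α γ : ℝ} (h : α < γ) : ∃ n : ℕ, 0 < n ∧ ⌊α * n⌋ + 1 < ⌈γ * n⌉ := by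
  obtain ⟨n, hn⟩ := exists_nat_gt (2 / (γ - α))
  have hd : 0 < γ - α := by linarith
  rw [div_lt_iff₀ hd] at hn
  have hn0 : 0 < n := by
    rcases Nat.eq_zero_or_pos n with rfl | h
    · simp at hn; linarith
    · exact h
  refine ⟨n, hn0, ?_⟩
  have h1 := Int.floor_le (α * n)
  have h2 := Int.le_ceil (γ * n)
  have : ((⌊α * n⌋ + 1 : ℤ) : ℝ) < ⌈γ * n⌉ := by push_cast; nlinarith
  exact_mod_cast this

theorem floor_add_one_le_ceil {α γ : ℝ} (h : α < γ) {n : ℕ} (hn : 0 < n) :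
    ⌊α * n⌋ + 1 ≤ ⌈γ * n⌉ := by
  have hn' : (0 : ℝ) < n := by exact_mod_cast hn
  have h1 := Int.floor_le (α * n)
  have h2 := Int.le_ceil (γ * n)
  have : ((⌊α * n⌋ : ℤ) : ℝ) < ⌈γ * n⌉ := by nlinarith
  exact_mod_cast this

theorem upperMech_strictMono {α γ : ℝ} (h : α < γ) :
    toLex (upperMech α 0) < toLex (upperMech γ 0) := by
  refine lex_lt_of_psum (fun n => ?_) ?_
  · rw [psum_upperMech, psum_upperMech]
    exact Int.ceil_le_ceil (by gcongr)
  · obtain ⟨n, _, hn⟩ := exists_floor_add_two_le h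
    refine ⟨n, ?_⟩
    rw [psum_upperMech, psum_upperMech]
    exact lt_of_le_of_lt (Int.ceil_le_floor_add_one _) hn

/-! ### Words with a prescribed mean. -/

/-- A uniform gap below `α` for the first few numbers `⌈α n⌉ - 1`. -/
theorem exists_slope_lt (α : ℝ) (N : ℕ) :
    ∃ γ < α, ∀ j ≤ N, ((⌈α * (j + 1 : ℕ)⌉ - 1 : ℤ) : ℝ) ≤ γ * (j + 1 : ℕ) := by
  have key : ∀ j : ℕ, ∃ γ < α, ((⌈α * (j + 1 : ℕ)⌉ - 1 : ℤ) : ℝ) ≤ γ * (j + 1 : ℕ) := by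
    intro j
    have hj : (0 : ℝ) < (j + 1 : ℕ) := by positivity
    refine ⟨((⌈α * (j + 1 : ℕ)⌉ - 1 : ℤ) : ℝ) / (j + 1 : ℕ), ?_, ?_⟩
    · rw [div_lt_iff₀ hj]
      have := Int.ceil_lt_add_one (α * (j + 1 : ℕ))
      push_cast at this ⊢; linarith
    · rw [div_mul_cancel₀ _ hj.ne']
  induction N with
  | zero =>
    obtain ⟨γ, h1, h2⟩ := key 0
    exact ⟨γ, h1, fun j hj => by rw [Nat.le_zero.1 hj]; exact h2⟩
  | succ N ih =>
    obtain ⟨γ, h1, h2⟩ := ih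
    obtain ⟨γ', h1', h2'⟩ := key (N + 1)
    refine ⟨max γ γ', max_lt h1 h1', fun j hj => ?_⟩
    rcases Nat.le_succ_iff.1 hj with hj | rfl
    · exact (h2 j hj).trans (by gcongr; exact le_max_left _ _)
    · exact h2'.trans (by gcongr; exact le_max_right _ _)

/-- If a word has mean at least `α`, its shifts are not bounded away from the upper mechanical word
of slope `α` from below. -/
theorem upperMech_le_of_mean {w v : ℕ → ℤ} {α α₀ : ℝ} (hα : α ≤ α₀)
    (hw : Filter.Tendsto (fun n : ℕ => (psum w n : ℝ) / n) Filter.atTop (nhds α₀))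
    (hv : ∀ i, toLex (shift w i) ≤ toLex v) : toLex (upperMech α 0) ≤ toLex v := by
  by_contra hlt
  obtain ⟨N, hN, hN'⟩ := lex_lt_iff.1 (not_le.1 hlt)
  obtain ⟨γ, hγ, hb⟩ := exists_slope_lt α N
  -- Since `v` falls below the mechanical word at position `N`, every shift of `w` does so at some
  -- position `j ≤ N`. Its block of length `j + 1` therefore loses at least one against `⌈α (j +
  -- 1)⌉`, and has mean at most `γ`.
  have step : ∀ i, ∃ j ≤ N, (psum w (i + (j + 1)) : ℝ) ≤ psum w i + γ * (j + 1 : ℕ) := by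
    intro i
    have : ∃ j ≤ N, (∀ k < j, shift w i k = upperMech α 0 k) ∧
        shift w i j < upperMech α 0 j := by
      rcases lex_le_iff.1 (hv i) with h | h
      · exact ⟨N, le_rfl, fun k hk => by rw [h]; exact hN k hk, by rw [h]; exact hN'⟩
      · obtain ⟨k, hk, hk'⟩ := lex_lt_iff.1 h
        rcases lt_trichotomy k N with hkN | rfl | hkN
        · exact ⟨k, hkN.le, fun j hj => by rw [hk j hj, hN j (hj.trans hkN)],
            by rw [← hN k hkN]; exact hk'⟩
        · exact ⟨k, le_rfl, fun j hj => by rw [hk j hj, hN j hj], hk'.trans hN'⟩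
        · exact ⟨N, le_rfl, fun j hj => by rw [hk j (hj.trans hkN), hN j hj],
            by rw [hk N hkN]; exact hN'⟩
    obtain ⟨j, hj, h1, h2⟩ := this
    refine ⟨j, hj, ?_⟩
    have h3 : psum (shift w i) (j + 1) ≤ ⌈α * (j + 1 : ℕ)⌉ - 1 := by
      rw [← psum_upperMech, psum_succ, psum_succ, psum_congr h1]; linarith
    rw [psum_shift, add_comm] at h3
    have h4 := hb j hj
    have h5 : ((psum w (i + (j + 1)) - psum w i : ℤ) : ℝ) ≤ (⌈α * (j + 1 : ℕ)⌉ - 1 : ℤ) := by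
      exact_mod_cast h3
    push_cast at h5 h4 ⊢
    linarith
  -- Concatenating such blocks gives arbitrarily long prefixes of mean at most `γ < α`, against the
  -- limit `α₀ ≥ α`.
  have many : ∀ m : ℕ, ∃ n ≥ m, (psum w n : ℝ) ≤ γ * n := by
    intro m
    induction m with
    | zero => exact ⟨0, le_rfl, by simp [psum_zero]⟩
    | succ m ih =>
      obtain ⟨n, hn, h⟩ := ih
      obtain ⟨j, _, h'⟩ := step n
      refine ⟨n + (j + 1), by omega, h'.trans ?_⟩
      push_cast; linarith
  have hev := hw.eventually (lt_mem_nhds (lt_of_lt_of_le hγ hα))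
  obtain ⟨m, hm⟩ := Filter.eventually_atTop.1 hev
  obtain ⟨n, hn, h⟩ := many (m + 1)
  have h1 := hm n (by omega)
  have hn0 : (0 : ℝ) < n := by exact_mod_cast (by omega : 0 < n)
  rw [lt_div_iff₀ hn0] at h1
  linarith

theorem tendsto_div_of_abs_sub_le {W : ℕ → ℤ} {α C : ℝ} (h : ∀ n : ℕ, |(W n : ℝ) - α * n| ≤ C) :
    Filter.Tendsto (fun n : ℕ => (W n : ℝ) / n) Filter.atTop (nhds α) := by
  rw [tendsto_iff_norm_sub_tendsto_zero]
  have h0 : Filter.Tendsto (fun n : ℕ => C / (n : ℝ)) Filter.atTop (nhds 0) :=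
    tendsto_const_div_atTop_nhds_zero_nat C
  refine squeeze_zero' (Filter.Eventually.of_forall fun _ => norm_nonneg _) ?_ h0
  filter_upwards [Filter.eventually_gt_atTop 0] with n hn
  have hn0 : (0 : ℝ) < n := by exact_mod_cast hn
  rw [Real.norm_eq_abs, div_sub' hn0.ne', abs_div, abs_of_pos hn0]
  gcongr
  rw [mul_comm]; exact h n

theorem mean_of_isMechanical {w : ℕ → ℤ} {α : ℝ} (h : IsMechanical w α) :
    Filter.Tendsto (fun n : ℕ => (psum w n : ℝ) / n) Filter.atTop (nhds α) := by
  obtain ⟨_, ρ, hρ, rfl | rfl⟩ := h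
  · refine tendsto_div_of_abs_sub_le (C := 1) fun n => ?_
    have : psum (lowerMech α ρ) n = ⌊α * n + ρ⌋ - ⌊ρ⌋ := by
      induction n with
      | zero => simp [psum_zero]
      | succ n ih => rw [psum_succ, ih, lowerMech]; push_cast; ring
    rw [this, abs_le]; push_cast
    have := Int.floor_le (α * n + ρ); have := Int.lt_floor_add_one (α * n + ρ)
    have := Int.floor_le ρ; have := Int.lt_floor_add_one ρ
    constructor <;> linarith
  · refine tendsto_div_of_abs_sub_le (C := 1) fun n => ?_
    have : psum (upperMech α ρ) n = ⌈α * n + ρ⌉ - ⌈ρ⌉ := by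
      induction n with
      | zero => simp [psum_zero]
      | succ n ih => rw [psum_succ, ih, upperMech]; push_cast; ring
    rw [this, abs_le]; push_cast
    have := Int.le_ceil (α * n + ρ); have := Int.ceil_lt_add_one (α * n + ρ)
    have := Int.le_ceil ρ; have := Int.ceil_lt_add_one ρ
    constructor <;> linarith

/-! ### The transformation and its expansions. -/

theorem dbar_zero (β x : ℝ) : dbar β x 0 = ⌈β * x⌉ - 1 := rfl

/-- The digit is the greatest integer strictly below `β * x`. So the remainder lies in `(0,1]`, and
an integer leaves remainder one instead of zero. -/
theorem Tbar_eq (β x : ℝ) : Tbar β x = β * x - dbar β x 0 := by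
  rw [Tbar, angle, dbar_zero]
  push_cast
  split_ifs with h
  · obtain ⟨m, hm⟩ := Int.fract_eq_zero_iff.1 h
    rw [← hm, Int.ceil_intCast]; ring
  · have h1 : ⌈β * x⌉ = ⌊β * x⌋ + 1 := by
      refine le_antisymm (Int.ceil_le_floor_add_one _) ?_
      have h1 : Int.fract (β * x) ≠ 0 := h
      have h2 : 0 < Int.fract (β * x) := lt_of_le_of_ne (Int.fract_nonneg _) (Ne.symm h1)
      rw [Int.fract] at h2
      rw [Int.add_one_le_iff, Int.lt_ceil]
      linarith
    rw [h1, Int.fract]; push_cast; ring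

theorem Tbar_pos (β x : ℝ) : 0 < Tbar β x := by
  rw [Tbar_eq, dbar_zero]; push_cast; linarith [Int.ceil_lt_add_one (β * x)]

theorem Tbar_le_one (β x : ℝ) : Tbar β x ≤ 1 := by
  rw [Tbar_eq, dbar_zero]; push_cast; linarith [Int.le_ceil (β * x)]

theorem dbar_shift (β x : ℝ) (i : ℕ) : dbar β ((Tbar β)^[i] x) = shift (dbar β x) i := by
  funext n
  simp only [dbar, shift, Function.iterate_add_apply]

theorem dbar_Tbar (β x : ℝ) : dbar β (Tbar β x) = shift (dbar β x) 1 := dbar_shift β x 1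

theorem dbar_succ (β x : ℝ) (n : ℕ) : dbar β x (n + 1) = dbar β (Tbar β x) n := by
  rw [dbar_Tbar]; rfl

theorem dbar_iterate (β x : ℝ) (n : ℕ) : dbar β x n = dbar β ((Tbar β)^[n] x) 0 := by
  rw [dbar_shift]; simp [shift]

theorem iterate_mem {β x : ℝ} (hx : x ∈ Set.Ioc (0 : ℝ) 1) (i : ℕ) :
    (Tbar β)^[i] x ∈ Set.Ioc (0 : ℝ) 1 := by
  cases i with
  | zero => exact hx
  | succ i => rw [Function.iterate_succ_apply']; exact ⟨Tbar_pos _ _, Tbar_le_one _ _⟩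

theorem dbar_nonneg {β x : ℝ} (hβ : 1 < β) (hx : x ∈ Set.Ioc (0 : ℝ) 1) (n : ℕ) :
    0 ≤ dbar β x n := by
  rw [dbar_iterate, dbar_zero]
  have := (iterate_mem (β := β) hx n).1
  have : 0 < ⌈β * (Tbar β)^[n] x⌉ := Int.ceil_pos.2 (by positivity)
  linarith

theorem dbar_le {β x : ℝ} (hβ : 1 < β) (hx : x ∈ Set.Ioc (0 : ℝ) 1) (n : ℕ) :
    (dbar β x n : ℝ) ≤ β := by
  rw [dbar_iterate, dbar_zero]
  have := (iterate_mem (β := β) hx n).2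
  have := Int.ceil_lt_add_one (β * (Tbar β)^[n] x)
  push_cast
  nlinarith

/-- As long as the digits agree, both points move by the same increasing affine map. Their order
thus survives to the first difference, where the ceilings decide. -/
theorem dbar_mono {β x y : ℝ} (hβ : 1 < β) (h : x ≤ y) :
    toLex (dbar β x) ≤ toLex (dbar β y) := by
  rcases lex_trichotomy (dbar β x) (dbar β y) with h' | ⟨i, hi, hne⟩
  · rw [h']
  · refine le_of_lt (lex_lt_iff.2 ⟨i, hi, lt_of_le_of_ne ?_ hne⟩)
    have key : ∀ j ≤ i, (Tbar β)^[j] x ≤ (Tbar β)^[j] y := by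
      intro j
      induction j with
      | zero => intro _; exact h
      | succ j ih =>
        intro hj
        have h1 := ih (by omega)
        have h2 := hi j (by omega)
        rw [dbar_iterate, dbar_iterate β y] at h2
        rw [Function.iterate_succ_apply', Function.iterate_succ_apply', Tbar_eq, Tbar_eq, h2]
        nlinarith
    rw [dbar_iterate, dbar_iterate β y, dbar_zero, dbar_zero]
    have h1 := key i le_rfl
    have : ⌈β * (Tbar β)^[i] x⌉ ≤ ⌈β * (Tbar β)^[i] y⌉ :=
      Int.ceil_le_ceil (by nlinarith)
    linarith

theorem le_of_dbar_lt {β x y : ℝ} (hβ : 1 < β) (h : toLex (dbar β x) < toLex (dbar β y)) :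
    x ≤ y := by
  by_contra h'
  exact absurd (dbar_mono hβ (not_le.1 h').le) (not_le.2 h)

theorem iterate_sub_of_dbar_eq {β x y : ℝ} {n : ℕ} (h : ∀ k < n, dbar β x k = dbar β y k) :
    (Tbar β)^[n] x - (Tbar β)^[n] y = β ^ n * (x - y) := by
  induction n with
  | zero => simp
  | succ n ih =>
    have h1 := ih fun k hk => h k (by omega)
    have h2 := h n (by omega)
    rw [dbar_iterate, dbar_iterate β y] at h2
    rw [Function.iterate_succ_apply', Function.iterate_succ_apply', Tbar_eq, Tbar_eq, h2, pow_succ]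
    linear_combination β * h1

/-- Each common digit multiplies the distance by `β`, while the iterates stay in the unit interval.
-/
theorem abs_sub_le_of_dbar_eq {β x y : ℝ} (hβ : 1 < β) (hx : x ∈ Set.Ioc (0 : ℝ) 1)
    (hy : y ∈ Set.Ioc (0 : ℝ) 1) {n : ℕ} (h : ∀ k < n, dbar β x k = dbar β y k) :
    |x - y| ≤ (1 / β) ^ n := by
  have h1 := iterate_sub_of_dbar_eq h
  have hb : 0 < β ^ n := by positivity
  have hxn := iterate_mem (β := β) hx n
  have hyn := iterate_mem (β := β) hy n
  have h2 : |β ^ n * (x - y)| ≤ 1 := by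
    rw [← h1, abs_le]; constructor <;> linarith [hxn.1, hxn.2, hyn.1, hyn.2]
  rw [abs_mul, abs_of_pos hb] at h2
  rw [div_pow, one_pow, le_div_iff₀ hb]; linarith

theorem tendsto_inv_pow {β : ℝ} (hβ : 1 < β) :
    Filter.Tendsto (fun n : ℕ => (1 / β) ^ n) Filter.atTop (nhds 0) :=
  tendsto_pow_atTop_nhds_zero_of_lt_one (by positivity) ((div_lt_one (by linarith)).2 hβ)

theorem dbar_injOn {β : ℝ} (hβ : 1 < β) : Set.InjOn (dbar β) (Set.Ioc (0 : ℝ) 1) := by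
  intro x hx y hy h
  have h1 : |x - y| ≤ 0 := ge_of_tendsto' (tendsto_inv_pow hβ) fun n =>
    abs_sub_le_of_dbar_eq hβ hx hy fun k _ => by rw [h]
  exact sub_eq_zero.1 (abs_nonpos_iff.1 h1)

theorem le_of_dbar_le {β x y : ℝ} (hβ : 1 < β) (hx : x ∈ Set.Ioc (0 : ℝ) 1)
    (hy : y ∈ Set.Ioc (0 : ℝ) 1) (h : toLex (dbar β x) ≤ toLex (dbar β y)) : x ≤ y := by
  rcases lex_le_iff.1 h with h | h
  · exact (dbar_injOn hβ hx hy h).le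
  · exact le_of_dbar_lt hβ h

theorem one_mem_Ioc : (1 : ℝ) ∈ Set.Ioc (0 : ℝ) 1 := ⟨one_pos, le_rfl⟩

theorem shift_dbar_le {β x y : ℝ} (hβ : 1 < β) (i : ℕ) (h : (Tbar β)^[i] x ≤ y) :
    toLex (shift (dbar β x) i) ≤ toLex (dbar β y) := by
  rw [← dbar_shift]; exact dbar_mono hβ h

theorem shift_dbar_one_le {β : ℝ} (hβ : 1 < β) (i : ℕ) :
    toLex (shift (dbar β 1) i) ≤ toLex (dbar β 1) :=
  shift_dbar_le hβ i (iterate_mem one_mem_Ioc i).2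

theorem hasFreq_iff {β x α : ℝ} : HasFreq β x α ↔
    Filter.Tendsto (fun n : ℕ => (psum (dbar β x) n : ℝ) / n) Filter.atTop (nhds α) := by
  simp only [HasFreq, psum, Int.cast_sum]

/-! ### Values of words in base `β`, and when a word is an expansion. -/

/-- The value of an infinite word in base `β`. -/
noncomputable def val (β : ℝ) (w : ℕ → ℤ) : ℝ := ∑' i, (w i : ℝ) / β ^ (i + 1)

theorem summable_const_div {β : ℝ} (hβ : 1 < β) (C : ℝ) :
    Summable fun i : ℕ => C / β ^ (i + 1) := by
  have h := (summable_geometric_of_lt_one (r := 1 / β) (by positivity)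
    ((div_lt_one (by linarith)).2 hβ)).mul_left (C / β)
  refine h.congr fun i => ?_
  rw [pow_succ, div_pow, one_pow]; field_simp

theorem summable_val {β C : ℝ} (hβ : 1 < β) {w : ℕ → ℤ} (hw : ∀ i, |(w i : ℝ)| ≤ C) :
    Summable fun i : ℕ => (w i : ℝ) / β ^ (i + 1) := by
  refine Summable.of_norm_bounded (summable_const_div hβ C) fun i => ?_
  have : 0 < β ^ (i + 1) := by positivity
  rw [Real.norm_eq_abs, abs_div, abs_of_pos this]
  gcongr; exact hw i

theorem val_succ {β C : ℝ} (hβ : 1 < β) {w : ℕ → ℤ} (hw : ∀ i, |(w i : ℝ)| ≤ C) :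
    β * val β w = w 0 + val β (shift w 1) := by
  have hb : β ≠ 0 := by positivity
  rw [val, (summable_val hβ hw).tsum_eq_zero_add, mul_add, val, ← tsum_mul_left]
  congr 1
  · field_simp
    simp [mul_comm]
  · refine tsum_congr fun i => ?_
    simp only [shift]
    field_simp
    ring

theorem abs_val_le {β C : ℝ} (hβ : 1 < β) {w : ℕ → ℤ} (hw : ∀ i, |(w i : ℝ)| ≤ C) :
    |val β w| ≤ ∑' i : ℕ, C / β ^ (i + 1) := by
  rw [val, ← Real.norm_eq_abs]
  refine tsum_of_norm_bounded (summable_const_div hβ C).hasSum fun i => ?_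
  have : 0 < β ^ (i + 1) := by positivity
  rw [Real.norm_eq_abs, abs_div, abs_of_pos this]
  gcongr; exact hw i

theorem val_sub_val {β C : ℝ} (hβ : 1 < β) {w v : ℕ → ℤ} (hw : ∀ i, |(w i : ℝ)| ≤ C)
    (hv : ∀ i, |(v i : ℝ)| ≤ C) {n : ℕ} (h : ∀ k < n, w k = v k) :
    β ^ n * (val β w - val β v) = val β (shift w n) - val β (shift v n) := by
  induction n with
  | zero => simp [shift_zero]
  | succ n ih =>
    have h1 := ih fun k hk => h k (by omega)
    have h2 := val_succ hβ (w := shift w n) (C := C) fun i => hw _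
    have h3 := val_succ hβ (w := shift v n) (C := C) fun i => hv _
    rw [shift_shift, add_comm 1 n] at h2 h3
    have h4 : shift w n 0 = shift v n 0 := by simp [shift, h n (by omega)]
    rw [h4] at h2
    rw [pow_succ]
    linear_combination β * h1 + h2 - h3

theorem val_nonneg {β : ℝ} (hβ : 1 < β) {w : ℕ → ℤ} (hw : ∀ i, 0 ≤ w i) : 0 ≤ val β w :=
  tsum_nonneg fun i => div_nonneg (by exact_mod_cast hw i) (by positivity)

/-- If all shifts of `w` are at most `d`, and `d` represents `1`, then all shifts of `w` represent
numbers that are at most `1`. -/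
theorem val_shift_le_one {β C : ℝ} (hβ : 1 < β) {w d : ℕ → ℤ} (hw : ∀ i, |(w i : ℝ)| ≤ C)
    (hd : ∀ i, |(d i : ℝ)| ≤ C) (hd0 : ∀ i, 0 ≤ d i) (hd1 : val β d ≤ 1)
    (h : ∀ i, toLex (shift w i) ≤ toLex d) (i : ℕ) : val β (shift w i) ≤ 1 := by
  set K := ∑' i : ℕ, C / β ^ (i + 1)
  have hK : ∀ i, val β (shift w i) ≤ K := fun i =>
    (le_abs_self _).trans (abs_val_le hβ (C := C) fun j => hw _)
  have hC : 0 ≤ C := (abs_nonneg _).trans (hd 0)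
  have hK0 : 0 ≤ K := tsum_nonneg fun i => by positivity
  -- Start from the crude bound `K` and improve it by a factor `1 / β` per round. At the first
  -- difference with `d`, the digit of the shift is smaller by at least one; this absorbs the `1` in
  -- the bound for the remaining tail, and only the error divided by a power of `β` is left.
  have key : ∀ n : ℕ, ∀ i, val β (shift w i) ≤ 1 + K * (1 / β) ^ n := by
    intro n
    induction n with
    | zero => intro i; simpa using (hK i).trans (by linarith)
    | succ n ih =>
      intro i
      rcases lex_le_iff.1 (h i) with h' | h'
      · rw [h']; have : 0 ≤ K * (1 / β) ^ (n + 1) := by positivity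
        linarith
      · obtain ⟨j, hj, hj'⟩ := lex_lt_iff.1 h'
        have h1 := val_sub_val hβ (C := C) (w := shift w i) (fun k => hw _) hd hj
        have h2 := val_succ hβ (w := shift (shift w i) j) (C := C) fun k => hw _
        have h3 := val_succ hβ (w := shift d j) (C := C) fun k => hd _
        rw [shift_shift, shift_shift] at h2
        rw [shift_shift] at h3 h1
        have h4 := ih (1 + (j + i))
        have h5 : 0 ≤ val β (shift d (1 + j)) := val_nonneg hβ fun k => hd0 _
        have h6 : ((shift w (j + i) 0 : ℤ) : ℝ) + 1 ≤ shift d j 0 := by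
          have : shift w (j + i) 0 + 1 ≤ shift d j 0 := by
            have : shift w (j + i) 0 = shift w i j := by simp [shift]
            rw [this]; simpa [shift] using hj'
          exact_mod_cast this
        have h7 : β ^ (j + 1) * (val β (shift w i) - val β d) ≤ K * (1 / β) ^ n := by
          rw [pow_succ]
          calc _ = β * (β ^ j * (val β (shift w i) - val β d)) := by ring
            _ = _ := by rw [h1, mul_sub, h2, h3]
            _ ≤ _ := by linarith
        have hb : 1 ≤ β ^ j := one_le_pow₀ hβ.le
        have h8 : 0 ≤ K * (1 / β) ^ n := by positivity
        have h9 : β * (val β (shift w i) - val β d) ≤ K * (1 / β) ^ n := by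
          by_contra h9
          rw [not_le] at h9
          rw [pow_succ] at h7
          nlinarith
        have h10 : val β (shift w i) - val β d ≤ K * (1 / β) ^ (n + 1) := by
          rw [pow_succ, ← mul_assoc, mul_one_div, le_div_iff₀ (by linarith)]
          linarith
        linarith
  have hlim : Filter.Tendsto (fun n : ℕ => 1 + K * (1 / β) ^ n) Filter.atTop (nhds 1) := by
    simpa using ((tendsto_inv_pow hβ).const_mul K).const_add 1
  exact ge_of_tendsto' hlim fun n => key n i

/-- A word is the expansion of the number it represents, if all its shifts represent numbers
in `(0,1]`. -/
theorem iterate_val {β C : ℝ} (hβ : 1 < β) {w : ℕ → ℤ} (hw : ∀ i, |(w i : ℝ)| ≤ C)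
    (h : ∀ i, val β (shift w i) ∈ Set.Ioc (0 : ℝ) 1) (i : ℕ) :
    (Tbar β)^[i] (val β w) = val β (shift w i) ∧ dbar β (val β w) i = w i := by
  have step : ∀ j, Tbar β (val β (shift w j)) = val β (shift w (j + 1)) ∧
      dbar β (val β (shift w j)) 0 = w j := by
    intro j
    have h1 := val_succ hβ (w := shift w j) (C := C) fun k => hw _
    rw [shift_shift, add_comm 1 j] at h1
    have h2 := h (j + 1)
    have h3 : dbar β (val β (shift w j)) 0 = w j := by
      rw [dbar_zero, sub_eq_iff_eq_add, Int.ceil_eq_iff, h1]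
      simp only [shift, zero_add] at h2 ⊢
      push_cast
      constructor <;> linarith [h2.1, h2.2]
    refine ⟨?_, h3⟩
    rw [Tbar_eq, h3, h1]; simp [shift]
  have key : ∀ i, (Tbar β)^[i] (val β w) = val β (shift w i) := by
    intro i
    induction i with
    | zero => rfl
    | succ i ih => rw [Function.iterate_succ_apply', ih, (step i).1]
  refine ⟨key i, ?_⟩
  rw [dbar_iterate, key, (step i).2]

theorem dbar_val {β C : ℝ} (hβ : 1 < β) {w : ℕ → ℤ} (hw : ∀ i, |(w i : ℝ)| ≤ C)
    (h : ∀ i, val β (shift w i) ∈ Set.Ioc (0 : ℝ) 1) : dbar β (val β w) = w :=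
  funext fun i => (iterate_val hβ hw h i).2

theorem abs_dbar_le {β x : ℝ} (hβ : 1 < β) (hx : x ∈ Set.Ioc (0 : ℝ) 1) (n : ℕ) :
    |(dbar β x n : ℝ)| ≤ β := by
  rw [abs_of_nonneg (by exact_mod_cast dbar_nonneg hβ hx n)]
  exact dbar_le hβ hx n

theorem val_dbar {β x : ℝ} (hβ : 1 < β) (hx : x ∈ Set.Ioc (0 : ℝ) 1) :
    val β (dbar β x) = x := by
  set K := ∑' i : ℕ, β / β ^ (i + 1)
  have hK : ∀ n : ℕ, |val β (dbar β x) - x| ≤ (K + 1) * (1 / β) ^ n := by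
    intro n
    have key : ∀ n, β ^ n * (val β (dbar β x) - x) =
        val β (shift (dbar β x) n) - (Tbar β)^[n] x := by
      intro n
      induction n with
      | zero => simp [shift_zero]
      | succ n ih =>
        have h2 := val_succ hβ (w := shift (dbar β x) n) fun i => abs_dbar_le hβ hx _
        rw [shift_shift, add_comm 1 n] at h2
        rw [Function.iterate_succ_apply', Tbar_eq, dbar_shift, pow_succ]
        linear_combination β * ih + h2
    have h1 := abs_val_le hβ (w := shift (dbar β x) n) fun i => abs_dbar_le hβ hx _
    have h2 := iterate_mem (β := β) hx n
    have hb : 0 < β ^ n := by positivity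
    have h3 : |β ^ n * (val β (dbar β x) - x)| ≤ K + 1 := by
      rw [key]
      refine (abs_sub _ _).trans ?_
      rw [abs_of_pos h2.1]
      exact add_le_add h1 h2.2
    rw [abs_mul, abs_of_pos hb] at h3
    rw [div_pow, one_pow, mul_one_div, le_div_iff₀ hb]; linarith
  have h0 : |val β (dbar β x) - x| ≤ 0 := by
    have h1 : Filter.Tendsto (fun n : ℕ => (K + 1) * (1 / β) ^ n) Filter.atTop (nhds 0) := by
      simpa using (tendsto_inv_pow hβ).const_mul (K + 1)
    exact ge_of_tendsto' h1 hK
  exact sub_eq_zero.1 (abs_nonpos_iff.1 h0)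

/-! ### Mechanical words as expansions, and the dependence on the base. -/

theorem abs_upperMech_le {α : ℝ} (hα : 0 ≤ α) (n : ℕ) :
    |(upperMech α 0 n : ℝ)| ≤ ⌈α⌉ := by
  rw [abs_of_nonneg (by exact_mod_cast upperMech_nonneg hα n)]
  exact_mod_cast upperMech_le α n

/-- The shifts of an upper mechanical word of positive slope represent numbers that are bounded away
from `0`. -/
theorem exists_le_val_upperMech {α β : ℝ} (hα : 0 < α) (hβ : 1 < β) :
    ∃ δ > 0, ∀ i, δ ≤ val β (shift (upperMech α 0) i) := by
  obtain ⟨N, hN⟩ := exists_nat_gt (1 / α)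
  rw [div_lt_iff₀ hα] at hN
  refine ⟨1 / β ^ N, by positivity, fun i => ?_⟩
  -- By balance and `α N > 1`, every factor of length `N` contains a nonzero letter, which
  -- contributes at least `1 / β ^ N`.
  have h1 : (1 : ℤ) ≤ psum (shift (upperMech α 0) i) N := by
    have h := le_psum_shift_upperMech α i N
    have : (1 : ℤ) < ⌈α * N⌉ := Int.lt_ceil.2 (by push_cast; linarith)
    linarith
  have h2 : ∀ k, (0 : ℝ) ≤ shift (upperMech α 0) i k := fun k => by
    exact_mod_cast upperMech_nonneg hα.le _
  have h3 := (summable_val hβ (w := shift (upperMech α 0) i) (C := ⌈α⌉)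
    fun k => abs_upperMech_le hα.le _).sum_le_tsum (Finset.range N)
    fun k _ => div_nonneg (h2 k) (by positivity)
  refine le_trans ?_ h3
  calc 1 / β ^ N ≤ (psum (shift (upperMech α 0) i) N : ℝ) / β ^ N := by
        gcongr; exact_mod_cast h1
    _ = ∑ k ∈ Finset.range N, (shift (upperMech α 0) i k : ℝ) / β ^ N := by
        rw [psum, Int.cast_sum, Finset.sum_div]
    _ ≤ _ := by
        refine Finset.sum_le_sum fun k hk => ?_
        have := h2 k
        gcongr
        · exact hβ.le
        · have := Finset.mem_range.1 hk; omega

theorem val_shift_upperMech_mem {α β : ℝ} (hα : 0 < α) (hβ : 1 < β) {d : ℕ → ℤ} {C : ℝ}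
    (hd : ∀ i, |(d i : ℝ)| ≤ C) (hd0 : ∀ i, 0 ≤ d i) (hd1 : val β d ≤ 1)
    (h : toLex (upperMech α 0) ≤ toLex d) (i : ℕ) :
    val β (shift (upperMech α 0) i) ∈ Set.Ioc (0 : ℝ) 1 := by
  obtain ⟨δ, hδ, h1⟩ := exists_le_val_upperMech hα hβ
  refine ⟨hδ.trans_le (h1 i), ?_⟩
  exact val_shift_le_one hβ (C := max C ⌈α⌉)
    (fun j => (abs_upperMech_le hα.le j).trans (le_max_right _ _))
    (fun j => (hd j).trans (le_max_left _ _)) hd0 hd1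
    (fun j => (shift_upperMech_le α j).trans h) i

/-- Necessity in the criterion: no iterate exceeds `1`, so no shift of the expansion of `x` exceeds
that of `1`. -/
theorem upperMech_le_dbar_one_of_hasFreq {α β x : ℝ} (hβ : 1 < β) (hx : x ∈ Set.Icc (0 : ℝ) 1)
    (h : HasFreq β x α) : toLex (upperMech α 0) ≤ toLex (dbar β 1) := by
  refine upperMech_le_of_mean le_rfl (hasFreq_iff.1 h) fun i => shift_dbar_le hβ i ?_
  cases i with
  | zero => exact hx.2
  | succ i => rw [Function.iterate_succ_apply']; exact Tbar_le_one _ _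

/-- A larger base gives a larger expansion of `1`. -/
theorem dbar_one_strictMono {β γ : ℝ} (hβ : 1 < β) (h : β < γ) :
    toLex (dbar β 1) < toLex (dbar γ 1) := by
  have hγ := hβ.trans h
  by_contra h'
  replace h' := not_lt.1 h'
  have hb := fun i => (abs_dbar_le hγ one_mem_Ioc i)
  -- If the expansion in base `γ` were the smaller one, its value in base `β` would be at most `1`.
  -- But a nonnegative word with nonzero first letter has a strictly smaller value in the larger
  -- base `γ`, where the value is `1`.
  have h1 : val β (dbar γ 1) ≤ 1 :=
    val_shift_le_one hβ (w := dbar γ 1) (d := dbar β 1) (C := γ) hb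
      (fun i => (abs_dbar_le hβ one_mem_Ioc i).trans h.le) (dbar_nonneg hβ one_mem_Ioc)
      (val_dbar hβ one_mem_Ioc).le (fun i => (shift_dbar_one_le hγ i).trans h') 0
  have h2 : val γ (dbar γ 1) < val β (dbar γ 1) := by
    have hn : ∀ i, (0 : ℝ) ≤ dbar γ 1 i := fun i => by
      exact_mod_cast dbar_nonneg hγ one_mem_Ioc i
    refine Summable.tsum_lt_tsum (i := 0) (fun i => ?_) ?_ (summable_val hγ hb)
      (summable_val hβ hb)
    · have := hn i
      gcongr
    · have h3 : (1 : ℝ) ≤ dbar γ 1 0 := by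
        rw [dbar_zero]
        have : 1 < ⌈γ * 1⌉ := Int.lt_ceil.2 (by push_cast; linarith)
        exact_mod_cast (by linarith : 1 ≤ ⌈γ * 1⌉ - 1)
      simp only [zero_add, pow_one]
      gcongr
  rw [val_dbar hγ one_mem_Ioc] at h2
  linarith

/-- The base in which the expansion of `1` is a given upper mechanical word. -/
theorem exists_dbar_one_eq {α : ℝ} (hα : 0 < α) : ∃ δ, 1 < δ ∧ dbar δ 1 = upperMech α 0 := by
  -- The value as a power series in `x = 1 / β`. It vanishes at `0`, and exceeds `1` near `x = 1`
  -- because the first `N` coefficients have sum `⌈α N⌉ > 1`; an intermediate value yields the base.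
  set g : ℝ → ℝ := fun x => ∑' i : ℕ, (upperMech α 0 i : ℝ) * x ^ (i + 1)
  have h0 : ∀ i, (0 : ℝ) ≤ upperMech α 0 i := fun i => by exact_mod_cast upperMech_nonneg hα.le i
  have hC : ∀ i, (upperMech α 0 i : ℝ) ≤ ⌈α⌉ := fun i => by exact_mod_cast upperMech_le α i
  obtain ⟨N, hN⟩ := exists_nat_gt (1 / α)
  rw [div_lt_iff₀ hα] at hN
  have hpoly : Filter.Tendsto
      (fun x : ℝ => ∑ i ∈ Finset.range N, (upperMech α 0 i : ℝ) * x ^ (i + 1)) (nhdsWithin 1 (Set.Iio 1))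
      (nhds (⌈α * N⌉ : ℝ)) := by
    have hc : Continuous
        (fun x : ℝ => ∑ i ∈ Finset.range N, (upperMech α 0 i : ℝ) * x ^ (i + 1)) := by fun_prop
    have := (hc.tendsto 1).mono_left (nhdsWithin_le_nhds (s := Set.Iio 1))
    convert this using 2
    rw [← psum_upperMech, psum]; simp
  have hlt : (1 : ℝ) < (⌈α * N⌉ : ℝ) := lt_of_lt_of_le (by linarith) (Int.le_ceil _)
  obtain ⟨r, ⟨hr0, hr1⟩, hr⟩ :=
    (Filter.Eventually.and (Ioo_mem_nhdsLT (show (0 : ℝ) < 1 by norm_num))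
      (hpoly.eventually (lt_mem_nhds hlt))).exists
  have hsum : Summable fun i : ℕ => (⌈α⌉ : ℝ) * r ^ (i + 1) := by
    have := (summable_geometric_of_lt_one hr0.le hr1).mul_left ((⌈α⌉ : ℝ) * r)
    exact this.congr fun i => by rw [pow_succ]; ring
  have hbd : ∀ (i : ℕ), ∀ x ∈ Set.Icc (0 : ℝ) r,
      ‖(upperMech α 0 i : ℝ) * x ^ (i + 1)‖ ≤ (⌈α⌉ : ℝ) * r ^ (i + 1) := by
    intro i x hx
    have hx0 := hx.1
    have hi := h0 i
    rw [Real.norm_of_nonneg (by positivity)]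
    exact mul_le_mul (hC i) (pow_le_pow_left₀ hx0 hx.2 _) (by positivity) (hi.trans (hC i))
  have hcont : ContinuousOn g (Set.Icc 0 r) :=
    continuousOn_tsum (fun i => by fun_prop) hsum hbd
  have hg0 : g 0 = 0 := by simp [g]
  have hgr : 1 ≤ g r := by
    have := (Summable.of_norm_bounded hsum fun i => hbd i r ⟨hr0.le, le_rfl⟩).sum_le_tsum
      (Finset.range N) fun i _ => mul_nonneg (h0 i) (by positivity)
    exact hr.le.trans this
  obtain ⟨x, hx, hgx⟩ := intermediate_value_Icc hr0.le hcont
    (show (1 : ℝ) ∈ Set.Icc (g 0) (g r) from ⟨by rw [hg0]; norm_num, hgr⟩)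
  have hx0 : 0 < x := lt_of_le_of_ne hx.1 fun h => by rw [← h, hg0] at hgx; norm_num at hgx
  have hδ : 1 < 1 / x := (one_lt_div hx0).2 (lt_of_le_of_lt hx.2 hr1)
  have hval : val (1 / x) (upperMech α 0) = 1 := by
    refine (tsum_congr fun i => ?_ : val (1 / x) (upperMech α 0) = g x).trans hgx
    rw [one_div, inv_pow, div_inv_eq_mul]
  refine ⟨1 / x, hδ, ?_⟩
  have h1 := dbar_val hδ (abs_upperMech_le hα.le) fun i =>
    val_shift_upperMech_mem hα hδ (abs_upperMech_le hα.le) (upperMech_nonneg hα.le) hval.le le_rfl i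
  rwa [hval] at h1

/-! ### Diophantine approximation and recurrence. -/

theorem exists_pos_le_of_pos (f : ℕ → ℝ) (hf : ∀ n, 0 < f n) (N : ℕ) :
    ∃ ε > 0, ∀ n ≤ N, ε ≤ f n := by
  obtain ⟨m, _, h⟩ := Finset.exists_min_image (Finset.range (N + 1)) f ⟨0, by simp⟩
  exact ⟨f m, hf m, fun n hn => h n (by simp; omega)⟩

/-- Multiples of `α` come arbitrarily close to integers from below. -/
theorem exists_int_sub_mul_lt (α : ℝ) {ε : ℝ} (hε : 0 < ε) :
    ∃ i : ℕ, 0 < i ∧ ∃ j : ℤ, 0 ≤ j - α * i ∧ j - α * i < ε := by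
  obtain ⟨n, hn⟩ := exists_nat_gt (1 / ε)
  have hn0 : 0 < n := by
    have : (0 : ℝ) < n := lt_trans (by positivity) hn
    exact_mod_cast this
  obtain ⟨k, hk, _, h⟩ := Real.exists_nat_abs_mul_sub_round_le α hn0
  have hlt : 1 / ((n : ℝ) + 1) < ε := by
    rw [div_lt_iff₀ hε] at hn
    rw [div_lt_iff₀ (by positivity)]; nlinarith
  set j := round (k * α)
  rw [abs_le] at h
  rcases le_or_gt (k * α - j) 0 with he | he
  · exact ⟨k, hk, j, by linarith, by linarith [h.1]⟩
  -- An approximation from above by `e` becomes one from below after multiplication by `m = ⌊1 /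
  -- e⌋`, since `0 ≤ 1 - m e < e`.
  · set e := k * α - (j : ℝ) with he_def
    have he1 : e ≤ 1 := by
      refine h.2.trans ?_
      rw [div_le_one (by positivity)]; linarith [Nat.cast_nonneg (α := ℝ) n]
    have h1 := Nat.floor_le (show 0 ≤ 1 / e by positivity)
    have h2 := Nat.lt_floor_add_one (1 / e)
    set m := ⌊1 / e⌋₊
    have hm : 0 < m := Nat.floor_pos.2 ((one_le_div he).2 he1)
    rw [le_div_iff₀ he] at h1
    rw [div_lt_iff₀ he] at h2
    refine ⟨m * k, Nat.mul_pos hm hk, m * j + 1, ?_, ?_⟩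
    · push_cast; nlinarith
    · push_cast; nlinarith [h.2]

/-- By irrationality the step `η = j - α i` is positive. Descending from `⌈r⌉` in steps shorter than
`r - l` cannot jump over the interval. -/
theorem exists_mul_sub_mem_Ioo {α : ℝ} (hα : Irrational α) {l r : ℝ} (hlr : l < r) :
    ∃ i : ℕ, ∃ j : ℤ, α * i - j ∈ Set.Ioo l r := by
  obtain ⟨i, hi, j, h1, h2⟩ := exists_int_sub_mul_lt α (sub_pos.2 hlr)
  have h3 : 0 < j - α * i := by
    refine lt_of_le_of_ne h1 fun h => ?_
    have := (hα.mul_natCast hi.ne').ne_int j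
    exact this (by linarith)
  set η := j - α * (i : ℝ)
  have hc := Int.le_ceil r
  set m := ⌊(⌈r⌉ - r) / η⌋₊
  have h4 := Nat.floor_le (show 0 ≤ (⌈r⌉ - r) / η from div_nonneg (by linarith) h3.le)
  have h5 := Nat.lt_floor_add_one ((⌈r⌉ - r) / η)
  rw [le_div_iff₀ h3] at h4
  rw [div_lt_iff₀ h3] at h5
  refine ⟨(m + 1) * i, (m + 1) * j - ⌈r⌉, ?_, ?_⟩
  · push_cast; nlinarith
  · push_cast; nlinarith

theorem letters_eq_of_psum_eq {w v : ℕ → ℤ} {N : ℕ} (h : ∀ n ≤ N, psum w n = psum v n) :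
    ∀ k < N, w k = v k := by
  intro k hk
  have h1 := h k hk.le
  have h2 := h (k + 1) hk
  rw [psum_succ, psum_succ] at h2
  linarith

/-- If `α i` is sufficiently little below an integer `j`, or equal to it, adding it to `α n` with `n
≤ N` raises the ceiling by exactly `j`. -/
theorem upperMech_recurrent (α : ℝ) (N : ℕ) :
    ∃ i : ℕ, 0 < i ∧ ∀ k < N, shift (upperMech α 0) i k = upperMech α 0 k := by
  obtain ⟨ε, hε, hN⟩ := exists_pos_le_of_pos (fun n => α * n - (⌈α * n⌉ - 1))
    (fun n => by linarith [Int.ceil_lt_add_one (α * n)]) N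
  obtain ⟨i, hi, j, h1, h2⟩ := exists_int_sub_mul_lt α hε
  have key : ∀ n ≤ N, ⌈α * n + α * i⌉ = ⌈α * n⌉ + j := by
    intro n hn
    have h3 := hN n hn
    have h4 := Int.le_ceil (α * n)
    rw [Int.ceil_eq_iff]; push_cast
    constructor <;> linarith
  refine ⟨i, hi, letters_eq_of_psum_eq fun n hn => ?_⟩
  have h0 := key 0 (Nat.zero_le _)
  simp only [Nat.cast_zero, mul_zero, zero_add, Int.ceil_zero] at h0
  rw [psum_shift_upperMech, psum_upperMech, key n hn, h0]; ring

/-! ### Continuity away from the jumps, and existence of the orbit closure. -/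

/-- The map jumps from `1` to values near `0` immediately to the right of a point where `β z` is an
integer. Requiring values at least `δ` removes open intervals to the right of these points, and on
what remains the map is continuous. -/
theorem isClosed_le_Tbar {β δ : ℝ} (hδ : δ ≤ 1) : IsClosed {z | δ ≤ Tbar β z} := by
  have : {z | δ ≤ Tbar β z} = (⋃ d : ℤ, {z | d < β * z ∧ β * z < d + δ})ᶜ := by
    ext z
    simp only [Set.mem_ofPred_eq, Set.mem_compl_iff, Set.mem_iUnion, not_exists]
    constructor
    · intro h d ⟨h1, h2⟩
      have h3 : ⌈β * z⌉ = d + 1 := by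
        rw [Int.ceil_eq_iff]; push_cast; constructor <;> linarith
      rw [Tbar_eq, dbar_zero, h3] at h
      push_cast at h; linarith
    · intro h
      by_contra h'
      have h1 := Tbar_eq β z
      have h2 := Tbar_pos β z
      exact h (dbar β z 0) ⟨by linarith, by linarith⟩
  rw [this, isClosed_compl_iff]
  refine isOpen_iUnion fun d => ?_
  have hc : Continuous fun z : ℝ => β * z := by fun_prop
  exact (isOpen_lt continuous_const hc).inter (isOpen_lt hc continuous_const)

theorem dbar_zero_eq_of_close {β δ x y : ℝ} (hx : δ ≤ Tbar β x) (hy : δ ≤ Tbar β y)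
    (h : |β * x - β * y| < δ) : dbar β x 0 = dbar β y 0 := by
  have h1 := Tbar_eq β x
  have h2 := Tbar_eq β y
  have h3 := Tbar_le_one β x
  have h4 := Tbar_le_one β y
  rw [abs_lt] at h
  rcases lt_trichotomy (dbar β x 0) (dbar β y 0) with h5 | h5 | h5
  · have : (dbar β x 0 : ℝ) + 1 ≤ dbar β y 0 := by exact_mod_cast h5
    linarith
  · exact h5
  · have : (dbar β y 0 : ℝ) + 1 ≤ dbar β x 0 := by exact_mod_cast h5
    linarith

theorem continuousOn_Tbar {β δ : ℝ} (hβ : 1 < β) (hδ : 0 < δ) :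
    ContinuousOn (Tbar β) {z | δ ≤ Tbar β z} := by
  rw [Metric.continuousOn_iff]
  intro y hy ε hε
  refine ⟨min δ ε / β, div_pos (lt_min hδ hε) (by linarith), fun x hx h => ?_⟩
  rw [Real.dist_eq, lt_div_iff₀ (by linarith)] at h
  have h1 : |β * x - β * y| < min δ ε := by
    rw [← mul_sub, abs_mul, abs_of_pos (by linarith)]; linarith
  have h2 := dbar_zero_eq_of_close hx hy (h1.trans_le (min_le_left _ _))
  rw [Real.dist_eq, Tbar_eq, Tbar_eq, h2, sub_sub_sub_cancel_right]
  exact h1.trans_le (min_le_right _ _)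

/-- Lets digit statistics pass from an orbit to its closure: in a forward invariant set bounded
below by `δ`, sufficiently close points share their first `N` digits. -/
theorem dbar_eq_of_close {β δ : ℝ} (hβ : 1 < β) {S : Set ℝ}
    (hT : ∀ z ∈ S, Tbar β z ∈ S) (hS : ∀ z ∈ S, δ ≤ z) (N : ℕ) :
    ∀ x ∈ S, ∀ y ∈ S, β ^ N * |x - y| < δ → ∀ k < N, dbar β x k = dbar β y k := by
  induction N with
  | zero => intro x _ y _ _ k hk; omega
  | succ N ih =>
    intro x hx y hy h k hk
    have hb : 1 ≤ β ^ N := one_le_pow₀ hβ.le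
    rw [pow_succ, mul_assoc] at h
    have h1 : |β * x - β * y| = β * |x - y| := by
      rw [← mul_sub, abs_mul, abs_of_pos (by linarith)]
    have h2 : 0 ≤ β * |x - y| := by positivity
    have h3 := dbar_zero_eq_of_close (hS _ (hT x hx)) (hS _ (hT y hy))
      (by rw [h1]; nlinarith)
    cases k with
    | zero => exact h3
    | succ k =>
      rw [dbar_succ, dbar_succ]
      refine ih _ (hT x hx) _ (hT y hy) ?_ k (by omega)
      rw [Tbar_eq, Tbar_eq, h3, sub_sub_sub_cancel_right, h1]; exact h

theorem mem_orbitClosure (β x : ℝ) (n : ℕ) : (Tbar β)^[n] x ∈ orbitClosure β x :=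
  subset_closure ⟨n, rfl⟩

theorem mem_orbitClosure_of_dbar {β x y : ℝ} (hβ : 1 < β) (hx : x ∈ Set.Ioc (0 : ℝ) 1)
    (hy : y ∈ Set.Ioc (0 : ℝ) 1) (h : ∀ N, ∃ i, ∀ k < N, shift (dbar β x) i k = dbar β y k) :
    y ∈ orbitClosure β x := by
  rw [orbitClosure, Metric.mem_closure_iff]
  intro ε hε
  obtain ⟨N, hN⟩ := ((tendsto_inv_pow hβ).eventually (gt_mem_nhds hε)).exists
  obtain ⟨i, hi⟩ := h N
  refine ⟨(Tbar β)^[i] x, ⟨i, rfl⟩, ?_⟩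
  rw [Real.dist_eq]
  refine lt_of_le_of_lt (abs_sub_le_of_dbar_eq hβ hy (iterate_mem hx i) fun k hk => ?_) hN
  rw [dbar_shift, hi k hk]

/-- The orbit closure of the point whose expansion is the upper mechanical word of slope `α`. -/
theorem exists_isXiSet {α β : ℝ} (hα : 0 < α) (hβ : 1 < β)
    (hle : toLex (upperMech α 0) ≤ toLex (dbar β 1)) : ∃ S, IsXiSet α β S := by
  have hmem := val_shift_upperMech_mem hα hβ (abs_dbar_le hβ one_mem_Ioc)
    (dbar_nonneg hβ one_mem_Ioc) (val_dbar hβ one_mem_Ioc).le hle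
  have hM0 := hmem 0
  rw [shift_zero] at hM0
  have hit := fun i => (iterate_val hβ (abs_upperMech_le hα.le) hmem i).1
  have hdM := dbar_val hβ (abs_upperMech_le hα.le) hmem
  obtain ⟨δ, hδ, hlow⟩ := exists_le_val_upperMech hα hβ
  set M := val β (upperMech α 0)
  have hδ1 : δ ≤ 1 := (hlow 0).trans (hmem 0).2
  set S := orbitClosure β M with hS_def
  have hSI : S ⊆ Set.Icc δ 1 := by
    refine closure_minimal ?_ isClosed_Icc
    rintro _ ⟨i, rfl⟩
    simp only [hit i]
    exact ⟨hlow i, (hmem i).2⟩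
  have hSE : S ⊆ {z | δ ≤ Tbar β z} := by
    refine closure_minimal ?_ (isClosed_le_Tbar hδ1)
    rintro _ ⟨i, rfl⟩
    change δ ≤ Tbar β ((Tbar β)^[i] M)
    rw [← Function.iterate_succ_apply' (Tbar β) i M, hit]; exact hlow _
  have hcont : ContinuousOn (Tbar β) S := (continuousOn_Tbar hβ hδ).mono hSE
  have hTS : Tbar β '' S ⊆ S := by
    refine (hcont.image_closure).trans (closure_mono ?_)
    rintro _ ⟨_, ⟨i, rfl⟩, rfl⟩
    exact ⟨i + 1, Function.iterate_succ_apply' _ _ _⟩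
  have hmaps : ∀ z ∈ S, Tbar β z ∈ S := fun z hz => hTS ⟨z, hz, rfl⟩
  have hScomp : IsCompact S := isCompact_Icc.of_isClosed_subset isClosed_closure hSI
  have hclosed : IsClosed (Tbar β '' S) := (hScomp.image_of_continuousOn hcont).isClosed
  -- Later points of the orbit are images by construction, so only its first point needs an
  -- argument: by recurrence it is a limit of images, and the image of a compact set is closed.
  have hMT : M ∈ Tbar β '' S := by
    rw [← hclosed.closure_eq, Metric.mem_closure_iff]
    intro ε hε
    obtain ⟨N, hN⟩ := ((tendsto_inv_pow hβ).eventually (gt_mem_nhds hε)).exists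
    obtain ⟨i, hi, h⟩ := upperMech_recurrent α N
    obtain ⟨i, rfl⟩ := Nat.exists_eq_succ_of_ne_zero hi.ne'
    refine ⟨(Tbar β)^[i + 1] M, ⟨(Tbar β)^[i] M, mem_orbitClosure _ _ _,
      (Function.iterate_succ_apply' _ _ _).symm⟩, ?_⟩
    rw [Real.dist_eq]
    refine lt_of_le_of_lt (abs_sub_le_of_dbar_eq hβ hM0 (iterate_mem hM0 _) fun k hk => ?_) hN
    rw [dbar_shift, hdM]; exact (h k hk).symm
  have hsurj : S ⊆ Tbar β '' S := by
    refine closure_minimal ?_ hclosed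
    rintro _ ⟨i, rfl⟩
    cases i with
    | zero => exact hMT
    | succ i => exact ⟨(Tbar β)^[i] M, mem_orbitClosure _ _ _,
        (Function.iterate_succ_apply' _ _ _).symm⟩
  -- Maximality among shifts bounds the orbit by `M`. For the lower bound, if the first digit of `y`
  -- is one less than that of `M`, balance forces the tail of `y` to be at least the tail of `M`,
  -- hence `β M - β y ≤ 1`.
  have hSM : S ⊆ Set.Icc (M - 1 / β) M := by
    refine closure_minimal ?_ isClosed_Icc
    rintro _ ⟨i, rfl⟩
    change (Tbar β)^[i] M ∈ _
    have hy := iterate_mem (β := β) hM0 i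
    have hdy : dbar β ((Tbar β)^[i] M) = shift (upperMech α 0) i := by rw [dbar_shift, hdM]
    set y := (Tbar β)^[i] M
    have hyM : y ≤ M := le_of_dbar_le hβ hy hM0 (by rw [hdy, hdM]; exact shift_upperMech_le α i)
    refine ⟨?_, hyM⟩
    have e1 := Tbar_eq β M
    have e2 := Tbar_eq β y
    suffices β * M - β * y ≤ 1 by
      rw [sub_le_comm, le_div_iff₀ (by linarith)]; linarith
    have h1 : dbar β M 0 - 1 ≤ dbar β y 0 := by
      have h := le_psum_shift_upperMech α i 1
      rw [← psum_upperMech, ← hdy, ← hdM] at h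
      simpa [psum] using h
    rcases h1.lt_or_eq with h2 | h2
    · have h3 : (dbar β M 0 : ℝ) ≤ dbar β y 0 := by exact_mod_cast (by linarith : dbar β M 0 ≤ _)
      linarith [Tbar_le_one β M, Tbar_pos β y]
    · have h3 : (dbar β y 0 : ℝ) = dbar β M 0 - 1 := by exact_mod_cast h2.symm
      have h4 : Tbar β M ≤ Tbar β y := by
        refine le_of_dbar_le hβ (iterate_mem hM0 1) (iterate_mem hy 1) ?_
        rw [dbar_Tbar, dbar_Tbar]
        refine lex_le_of_psum fun n => ?_
        rw [psum_shift, psum_shift]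
        have h5 := le_psum_shift_upperMech α i (n + 1)
        rw [← psum_upperMech, ← hdy, ← hdM] at h5
        have h6 : psum (dbar β M) 1 = dbar β M 0 := by simp [psum]
        have h7 : psum (dbar β y) 1 = dbar β y 0 := by simp [psum]
        linarith
      linarith
  -- The maximum with `0` keeps the interval of length `1 / β` inside `[0,1]` when `M < 1 / β`.
  refine ⟨S, ⟨M, ⟨hM0.1.le, hM0.2⟩, rfl⟩, hTS.antisymm hsurj, ⟨max 0 (M - 1 / β), ?_, ?_⟩, ?_⟩
  · intro z hz
    have h1 := hSI hz
    have h2 := hSM hz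
    refine ⟨max_le (hδ.le.trans h1.1) h2.1, ?_⟩
    linarith [h2.2, le_max_right 0 (M - 1 / β)]
  · refine Set.Icc_subset_Icc (le_max_left _ _) ?_
    have : 1 / β ≤ 1 := (div_le_one (by linarith)).2 hβ.le
    rcases max_cases 0 (M - 1 / β) with h | h <;> rw [h.1] <;> linarith [hM0.2]
  · intro z hz
    rw [hasFreq_iff]
    refine tendsto_div_of_abs_sub_le (C := 1) fun n => ?_
    have hb : 0 < β ^ n := by positivity
    obtain ⟨_, ⟨i, rfl⟩, hi⟩ := Metric.mem_closure_iff.1 hz (δ / β ^ n) (by positivity)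
    rw [Real.dist_eq, lt_div_iff₀ hb, mul_comm] at hi
    have h1 := dbar_eq_of_close hβ hmaps (fun z hz => (hSI hz).1) n z hz _
      (mem_orbitClosure β M i) hi
    rw [psum_congr h1, dbar_shift, hdM]
    have h2 := psum_shift_upperMech_le α i n
    have h3 := le_psum_shift_upperMech α i n
    have h2' : (psum (shift (upperMech α 0) i) n : ℝ) ≤ ⌈α * n⌉ := by exact_mod_cast h2
    have h3' : (⌈α * n⌉ : ℝ) - 1 ≤ psum (shift (upperMech α 0) i) n := by exact_mod_cast h3
    have := Int.le_ceil (α * n)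
    have := Int.ceil_lt_add_one (α * n)
    rw [abs_le]; constructor <;> linarith

/-! ### Rotation sets: the monotone lift and its rotation number. -/

/-- The lift of `Tbar β` to the line is monotone on the integer translates of a forward invariant
set of diameter at most `1 / β`. -/
theorem lift_mono {β : ℝ} (hβ : 1 < β) {S : Set ℝ} (hT : ∀ z ∈ S, Tbar β z ∈ S)
    (hS : S ⊆ Set.Ioc 0 1) (hd : ∀ x ∈ S, ∀ y ∈ S, x - y ≤ 1 / β) (n : ℕ) :
    ∀ x ∈ S, ∀ y ∈ S, ∀ k : ℤ, x + k ≤ y →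
      psum (dbar β x) n + (Tbar β)^[n] x + k ≤ psum (dbar β y) n + (Tbar β)^[n] y := by
  induction n with
  | zero => intro x _ y _ k h; simpa [psum_zero] using h
  | succ n ih =>
    intro x hx y hy k h
    -- The lift sends `x + k` to `β * x + k`. For `k ≤ -1` the bound `1 / β` on the diameter is
    -- exactly what is needed; `k ≥ 1` cannot occur in `(0,1]`.
    have hstep : β * x + k ≤ β * y := by
      have h1 := hS hx
      have h2 := hS hy
      rcases lt_trichotomy k 0 with hk | rfl | hk
      · have hk' : (k : ℝ) ≤ -1 := by exact_mod_cast (by omega : k ≤ -1)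
        have h3 := hd x hx y hy
        rw [le_div_iff₀ (by linarith)] at h3
        linarith
      · simp only [Int.cast_zero, add_zero] at h ⊢
        nlinarith
      · have hk' : (1 : ℝ) ≤ k := by exact_mod_cast hk
        linarith [h1.1, h2.2]
    have e1 := Tbar_eq β x
    have e2 := Tbar_eq β y
    have h1 := ih _ (hT x hx) _ (hT y hy) (k + dbar β x 0 - dbar β y 0)
      (by push_cast; linarith)
    have h2 : ∀ z, (psum (dbar β (Tbar β z)) n : ℝ) = psum (dbar β z) (n + 1) - dbar β z 0 := by
      intro z
      rw [dbar_Tbar, psum_shift]; simp [psum]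
    rw [h2, h2] at h1
    push_cast at h1
    rw [Function.iterate_succ_apply, Function.iterate_succ_apply]
    linarith

/-- The consequences of `IsXiSet` that do not refer to the generating point. -/
structure IsRotationSet (α β : ℝ) (S : Set ℝ) : Prop where
  maps : ∀ z ∈ S, Tbar β z ∈ S
  subset : S ⊆ Set.Ioc 0 1
  diam : ∀ x ∈ S, ∀ y ∈ S, x - y ≤ 1 / β
  freq : ∀ x ∈ S, HasFreq β x α

theorem IsXiSet.isRotationSet {α β : ℝ} {S : Set ℝ} (h : IsXiSet α β S) : IsRotationSet α β S := by
  obtain ⟨_, hT, ⟨t, ht, _⟩, hf⟩ := h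
  refine ⟨fun z hz => by rw [← hT]; exact ⟨z, hz, rfl⟩, fun z hz => ?_, fun x hx y hy => ?_, hf⟩
  · rw [← hT] at hz
    obtain ⟨y, _, rfl⟩ := hz
    exact ⟨Tbar_pos _ _, Tbar_le_one _ _⟩
  · linarith [(ht hx).2, (ht hy).1]

namespace IsRotationSet

variable {α β : ℝ} {S : Set ℝ}

theorem iterate (h : IsRotationSet α β S) {x : ℝ} (hx : x ∈ S) (n : ℕ) :
    (Tbar β)^[n] x ∈ S := by
  induction n with
  | zero => exact hx
  | succ n ih => rw [Function.iterate_succ_apply']; exact h.maps _ ih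

theorem mono (h : IsRotationSet α β S) (hβ : 1 < β) {x y : ℝ} (hx : x ∈ S) (hy : y ∈ S) {k : ℤ}
    (hk : x + k ≤ y) (n : ℕ) :
    psum (dbar β x) n + (Tbar β)^[n] x + k ≤ psum (dbar β y) n + (Tbar β)^[n] y :=
  lift_mono hβ h.maps h.subset h.diam n x hx y hy k hk

theorem psum_add (β x : ℝ) (m n : ℕ) :
    psum (dbar β x) (m + n) = psum (dbar β x) n + psum (dbar β ((Tbar β)^[n] x)) m := by
  rw [dbar_shift, psum_shift]; ring

/-- The usual argument for rotation numbers: if `n` steps of the lift advance `x` by at least `k`,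
monotonicity makes `j n` steps advance it by at least `j k`. Dividing by `j` and letting it grow
compares `k` with `α n`. -/
theorem le_mul_of_le (h : IsRotationSet α β S) (hβ : 1 < β) {x : ℝ} (hx : x ∈ S) {n : ℕ} {k : ℤ}
    (hk : x + k ≤ psum (dbar β x) n + (Tbar β)^[n] x) : (k : ℝ) ≤ α * n := by
  have iter : ∀ j : ℕ, x + j * k ≤ psum (dbar β x) (j * n) + (Tbar β)^[j * n] x := by
    intro j
    induction j with
    | zero => simp [psum_zero]
    | succ j ih =>
      have h1 := h.mono hβ hx (h.iterate hx n) (k := k - psum (dbar β x) n)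
        (by push_cast; linarith) (j * n)
      rw [← Function.iterate_add_apply] at h1
      have h2 := psum_add β x (j * n) n
      rw [Nat.succ_mul, h2]
      push_cast at h1 ⊢; linarith
  rcases Nat.eq_zero_or_pos n with rfl | hn
  · have : (k : ℝ) ≤ 0 := by simpa [psum_zero] using hk
    simpa using this
  have hn' : (0 : ℝ) < n := by exact_mod_cast hn
  have h1 : Filter.Tendsto (fun j : ℕ => (psum (dbar β x) (j * n) : ℝ) / (j * n : ℕ))
      Filter.atTop (nhds α) :=
    (hasFreq_iff.1 (h.freq x hx)).comp (Filter.tendsto_id.atTop_mul_const' hn)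
  have h2 : Filter.Tendsto (fun j : ℕ => (k : ℝ) / n - (1 / n) / (j : ℝ))
      Filter.atTop (nhds (k / n - 0)) :=
    (tendsto_const_div_atTop_nhds_zero_nat _).const_sub _
  have h3 := le_of_tendsto_of_tendsto h2 h1 (by
    filter_upwards [Filter.eventually_gt_atTop 0] with j hj
    have hj' : (0 : ℝ) < j := by exact_mod_cast hj
    have h4 := iter j
    have h5 := (iterate_mem (β := β) (h.subset hx) (j * n)).2
    have h6 := (h.subset hx).1
    have h7 : (k : ℝ) / n - (1 / n) / j = (j * k - 1) / (j * n : ℕ) := by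
      push_cast; field_simp
    rw [h7]
    gcongr
    linarith)
  rw [sub_zero, div_le_iff₀ hn'] at h3
  exact h3

theorem mul_le_of_le (h : IsRotationSet α β S) (hβ : 1 < β) {x : ℝ} (hx : x ∈ S) {n : ℕ} {k : ℤ}
    (hk : psum (dbar β x) n + (Tbar β)^[n] x ≤ x + k) : α * n ≤ (k : ℝ) := by
  have iter : ∀ j : ℕ, psum (dbar β x) (j * n) + (Tbar β)^[j * n] x ≤ x + j * k := by
    intro j
    induction j with
    | zero => simp [psum_zero]
    | succ j ih =>
      have h1 := h.mono hβ (h.iterate hx n) hx (k := psum (dbar β x) n - k)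
        (by push_cast; linarith) (j * n)
      rw [← Function.iterate_add_apply] at h1
      have h2 := psum_add β x (j * n) n
      rw [Nat.succ_mul, h2]
      push_cast at h1 ⊢; linarith
  rcases Nat.eq_zero_or_pos n with rfl | hn
  · have : (0 : ℝ) ≤ k := by simpa [psum_zero] using hk
    simpa using this
  have hn' : (0 : ℝ) < n := by exact_mod_cast hn
  have h1 : Filter.Tendsto (fun j : ℕ => (psum (dbar β x) (j * n) : ℝ) / (j * n : ℕ))
      Filter.atTop (nhds α) :=
    (hasFreq_iff.1 (h.freq x hx)).comp (Filter.tendsto_id.atTop_mul_const' hn)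
  have h2 : Filter.Tendsto (fun j : ℕ => (k : ℝ) / n + (1 / n) / (j : ℝ))
      Filter.atTop (nhds (k / n + 0)) :=
    (tendsto_const_div_atTop_nhds_zero_nat _).const_add _
  have h3 := le_of_tendsto_of_tendsto h1 h2 (by
    filter_upwards [Filter.eventually_gt_atTop 0] with j hj
    have hj' : (0 : ℝ) < j := by exact_mod_cast hj
    have h4 := iter j
    have h5 := (iterate_mem (β := β) (h.subset hx) (j * n)).1
    have h6 := (h.subset hx).2
    have h7 : (k : ℝ) / n + (1 / n) / j = (j * k + 1) / (j * n : ℕ) := by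
      push_cast; field_simp
    rw [h7]
    gcongr
    linarith)
  rw [add_zero, le_div_iff₀ hn'] at h3
  exact h3

theorem displacement_lt (h : IsRotationSet α β S) (hβ : 1 < β) {x : ℝ} (hx : x ∈ S) (n : ℕ) :
    psum (dbar β x) n + (Tbar β)^[n] x - x < ⌊α * n⌋ + 1 := by
  by_contra h'
  have := h.le_mul_of_le hβ hx (n := n) (k := ⌊α * n⌋ + 1) (by push_cast; linarith)
  push_cast at this
  linarith [Int.lt_floor_add_one (α * n)]

theorem lt_displacement (h : IsRotationSet α β S) (hβ : 1 < β) {x : ℝ} (hx : x ∈ S) (n : ℕ) :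
    ⌈α * n⌉ - 1 < psum (dbar β x) n + (Tbar β)^[n] x - x := by
  by_contra h'
  have := h.mul_le_of_le hβ hx (n := n) (k := ⌈α * n⌉ - 1) (by push_cast; linarith)
  push_cast at this
  linarith [Int.ceil_lt_add_one (α * n)]

theorem psum_le (h : IsRotationSet α β S) (hβ : 1 < β) {x : ℝ} (hx : x ∈ S) (n : ℕ) :
    psum (dbar β x) n ≤ ⌊α * n⌋ + 1 := by
  have h1 := h.displacement_lt hβ hx n
  have h2 := h.subset hx
  have h3 := h.subset (h.iterate hx n)
  have : (psum (dbar β x) n : ℝ) < ((⌊α * n⌋ + 1 + 1 : ℤ) : ℝ) := by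
    push_cast; linarith [h2.2, h3.1]
  exact Int.lt_add_one_iff.1 (by exact_mod_cast this)

theorem le_psum (h : IsRotationSet α β S) (hβ : 1 < β) {x : ℝ} (hx : x ∈ S) (n : ℕ) :
    ⌈α * n⌉ - 1 ≤ psum (dbar β x) n := by
  have h1 := h.lt_displacement hβ hx n
  have h2 := h.subset hx
  have h3 := h.subset (h.iterate hx n)
  have : ((⌈α * n⌉ - 1 - 1 : ℤ) : ℝ) < psum (dbar β x) n := by
    push_cast; linarith [h2.1, h3.2]
  have : ⌈α * n⌉ - 1 - 1 < psum (dbar β x) n := by exact_mod_cast this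
  omega

/-- Iterates of the maximum cannot lie above it, so the loss of one in `le_psum` disappears. The
bound now meets the one in `psum_le` unless `α n` is an integer. -/
theorem le_psum_max (h : IsRotationSet α β S) (hβ : 1 < β) {M : ℝ} (hM : IsGreatest S M) (n : ℕ) :
    ⌈α * n⌉ ≤ psum (dbar β M) n := by
  have h1 := h.lt_displacement hβ hM.1 n
  have h3 := hM.2 (h.iterate hM.1 n)
  have : ((⌈α * n⌉ - 1 : ℤ) : ℝ) < psum (dbar β M) n := by
    push_cast; linarith
  have : ⌈α * n⌉ - 1 < psum (dbar β M) n := by exact_mod_cast this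
  omega

theorem psum_max_eq (h : IsRotationSet α β S) (hβ : 1 < β) {M : ℝ} (hM : IsGreatest S M) {n : ℕ}
    (hn : ∀ k : ℤ, α * n ≠ k) : psum (dbar β M) n = ⌈α * n⌉ := by
  refine le_antisymm ((h.psum_le hβ hM.1 n).trans ?_) (h.le_psum_max hβ hM n)
  rw [Int.add_one_le_iff, Int.lt_ceil]
  exact lt_of_le_of_ne (Int.floor_le _) (hn _).symm

theorem dbar_max_of_irrational (h : IsRotationSet α β S) (hβ : 1 < β) (hα : Irrational α) {M : ℝ}
    (hM : IsGreatest S M) : dbar β M = upperMech α 0 := by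
  refine eq_of_psum fun n => ?_
  rw [psum_upperMech]
  rcases Nat.eq_zero_or_pos n with rfl | hn
  · simp [psum_zero]
  · exact h.psum_max_eq hβ hM fun k => (hα.mul_natCast hn.ne').ne_int k

theorem abs_psum_sub_lt (h : IsRotationSet α β S) (hβ : 1 < β) (hα : Irrational α) {x : ℝ}
    (hx : x ∈ S) (n : ℕ) : |(psum (dbar β x) n : ℝ) - α * n| < 1 := by
  rcases Nat.eq_zero_or_pos n with rfl | hn
  · simp [psum_zero]
  have hne : ∀ k : ℤ, α * n ≠ k := fun k => (hα.mul_natCast hn.ne').ne_int k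
  have h1 : (psum (dbar β x) n : ℝ) ≤ ⌊α * n⌋ + 1 := by exact_mod_cast h.psum_le hβ hx n
  have h2 : (⌈α * n⌉ : ℝ) - 1 ≤ psum (dbar β x) n := by exact_mod_cast h.le_psum hβ hx n
  have h3 := lt_of_le_of_ne (Int.floor_le (α * n)) (hne _).symm
  have h4 := lt_of_le_of_ne (Int.le_ceil (α * n)) (hne _)
  rw [abs_lt]; constructor <;> linarith

/-- The deviations of the digit sums of `y` from `α n` differ from one another by less than one. So
an open interval of intercepts reproduces any given prefix of `dbar β y`, and it contains some `α i`
modulo one. -/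
theorem mem_orbitClosure_max (h : IsRotationSet α β S) (hβ : 1 < β) (hα : Irrational α) {M : ℝ}
    (hM : IsGreatest S M) {y : ℝ} (hy : y ∈ S) : y ∈ orbitClosure β M := by
  refine mem_orbitClosure_of_dbar hβ (h.subset hM.1) (h.subset hy) fun N => ?_
  rw [h.dbar_max_of_irrational hβ hα hM]
  set D : ℕ → ℝ := fun n => psum (dbar β y) n - α * n
  obtain ⟨a, -, ha'⟩ := Finset.exists_max_image (Finset.range (N + 1)) D ⟨0, by simp⟩
  obtain ⟨b, -, hb'⟩ := Finset.exists_min_image (Finset.range (N + 1)) D ⟨0, by simp⟩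
  have ha : ∀ n ≤ N, D n ≤ D a := fun n hn => ha' n (by simp; omega)
  have hb : ∀ n ≤ N, D b ≤ D n := fun n hn => hb' n (by simp; omega)
  have hDD : ∀ m n, |D (m + n) - D n| < 1 := by
    intro m n
    have h1 := h.abs_psum_sub_lt hβ hα (h.iterate hy n) m
    have h2 := psum_add β y m n
    have h3 : D (m + n) - D n = psum (dbar β ((Tbar β)^[n] y)) m - α * m := by
      simp only [D, h2]; push_cast; ring
    rw [h3]; exact h1
  have hab : D a < 1 + D b := by
    rcases le_total a b with hle | hle
    · obtain ⟨c, rfl⟩ := Nat.exists_eq_add_of_le' hle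
      linarith [(abs_lt.1 (hDD c a)).1]
    · obtain ⟨c, rfl⟩ := Nat.exists_eq_add_of_le' hle
      linarith [(abs_lt.1 (hDD c b)).2]
  -- The ceiling of `α n + α i` is the digit sum plus `1 + j` as soon as `α i - j` lies above `D n`
  -- and at most at `D n + 1`; the chosen interval ensures this for all `n ≤ N` at once.
  obtain ⟨i, j, hl, hr⟩ := exists_mul_sub_mem_Ioo hα hab
  have key : ∀ n ≤ N, ⌈α * n + α * i⌉ = psum (dbar β y) n + 1 + j := by
    intro n hn
    have h1 := ha n hn
    have h2 := hb n hn
    simp only [D] at h1 h2 hl hr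
    rw [Int.ceil_eq_iff]; push_cast
    constructor <;> linarith
  refine ⟨i, letters_eq_of_psum_eq fun n hn => ?_⟩
  have h0 := key 0 (Nat.zero_le _)
  simp only [Nat.cast_zero, mul_zero, zero_add, psum_zero] at h0
  rw [psum_shift_upperMech, key n hn, h0]; ring

end IsRotationSet

/-! ### Rational frequency: periodicity. -/

theorem exists_forall_ge_eq_of_monotone {Z : ℕ → ℤ} (hZ : Monotone Z) {B : ℤ} (hB : ∀ n, Z n ≤ B) :
    ∃ N, ∀ n ≥ N, Z n = Z N := by
  obtain ⟨m, ⟨N, rfl⟩, h⟩ := Int.exists_greatest_of_bdd (P := fun z => ∃ n, Z n = z)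
    ⟨B, fun z ⟨n, hn⟩ => hn ▸ hB n⟩ ⟨_, 0, rfl⟩
  exact ⟨N, fun n hn => le_antisymm (h _ ⟨n, rfl⟩) (hZ hn)⟩

namespace IsRotationSet

variable {α β : ℝ} {S : Set ℝ}

/-- For a rational frequency every point of a rotation set is eventually periodic. -/
theorem eventually_periodic (h : IsRotationSet α β S) (hβ : 1 < β) {p : ℤ} {q : ℕ}
    (hpq : α * q = p) {x : ℝ} (hx : x ∈ S) :
    ∃ N, (Tbar β)^[q] ((Tbar β)^[N] x) = (Tbar β)^[N] x := by
  set W := psum (dbar β x)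
  -- The increment of `Z` at `n` is the sum of the `q` digits from `n` on, minus `p`. So `Z` is
  -- eventually constant exactly when these sums are eventually `p`.
  set Z : ℕ → ℤ := fun n => ∑ i ∈ Finset.range q, W (n + i) - n * p
  have hZ : ∀ n, Z (n + 1) = Z n + (W (n + q) - W n - p) := by
    intro n
    have h1 := Finset.sum_range_succ (fun i => W (n + i)) q
    rw [Finset.sum_range_succ'] at h1
    simp only [Z]
    have h2 : ∀ i, W (n + 1 + i) = W (n + (i + 1)) := fun i => by congr 1; omega
    simp only [h2]
    push_cast
    simp only [add_zero] at h1
    linarith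
  have hW : ∀ n i, W (n + i) = W i + psum (dbar β ((Tbar β)^[i] x)) n := fun n i =>
    psum_add β x n i
  have hq : ∀ c : ℤ, c * q + ∑ i ∈ Finset.range q, W i =
      ∑ i ∈ Finset.range q, (W i + c) := by
    intro c
    rw [Finset.sum_add_distrib]; simp; ring
  have hup : ∀ n, Z n ≤ q + ∑ i ∈ Finset.range q, W i := by
    intro n
    have h1 : ∑ i ∈ Finset.range q, W (n + i) ≤ ∑ i ∈ Finset.range q, (W i + (⌊α * n⌋ + 1)) := by
      refine Finset.sum_le_sum fun i _ => ?_
      rw [hW]; linarith [h.psum_le hβ (h.iterate hx i) n]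
    rw [← hq] at h1
    have h2 : ⌊α * n⌋ * q ≤ n * p := by
      have h3 := Int.floor_le (α * n)
      have : ((⌊α * n⌋ * q : ℤ) : ℝ) ≤ ((n * p : ℤ) : ℝ) := by
        push_cast; rw [← hpq]; nlinarith [Nat.cast_nonneg (α := ℝ) q]
      exact_mod_cast this
    simp only [Z]; linarith
  have hlow : ∀ n, -q + ∑ i ∈ Finset.range q, W i ≤ Z n := by
    intro n
    have h1 : ∑ i ∈ Finset.range q, (W i + (⌈α * n⌉ - 1)) ≤ ∑ i ∈ Finset.range q, W (n + i) := by
      refine Finset.sum_le_sum fun i _ => ?_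
      rw [hW]; linarith [h.le_psum hβ (h.iterate hx i) n]
    rw [← hq] at h1
    have h2 : n * p ≤ ⌈α * n⌉ * q := by
      have h3 := Int.le_ceil (α * n)
      have : ((n * p : ℤ) : ℝ) ≤ ((⌈α * n⌉ * q : ℤ) : ℝ) := by
        push_cast; rw [← hpq]; nlinarith [Nat.cast_nonneg (α := ℝ) q]
      exact_mod_cast this
    simp only [Z]; linarith
  -- Whether `q` steps of the lift carry `x` to at least or at most `x + p` is preserved along the
  -- orbit. All increments of `Z` therefore have one sign; being bounded and integral, `Z`
  -- stabilises.
  have hconst : ∃ N, ∀ n ≥ N, Z n = Z N := by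
    rcases le_total (x + p) (W q + (Tbar β)^[q] x) with hc | hc
    · refine exists_forall_ge_eq_of_monotone (monotone_nat_of_le_succ fun n => ?_) hup
      have h1 := h.mono hβ hx (h.iterate hx q) (k := p - W q) (by push_cast; linarith) n
      rw [← Function.iterate_add_apply] at h1
      have h2 := h.subset (h.iterate hx n)
      have h3 := h.subset (h.iterate hx (n + q))
      have h4 : ((-1 : ℤ) : ℝ) < ((W (n + q) - W n - p : ℤ) : ℝ) := by
        rw [hW]; push_cast at h1 ⊢; linarith [h2.1, h3.2]
      have h5 : -1 < W (n + q) - W n - p := by exact_mod_cast h4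
      rw [hZ]; linarith
    · suffices hm : Monotone fun n => -Z n by
        obtain ⟨N, hN⟩ := exists_forall_ge_eq_of_monotone hm fun n => neg_le_neg (hlow n)
        exact ⟨N, fun n hn => neg_injective (hN n hn)⟩
      refine monotone_nat_of_le_succ fun n => ?_
      have h1 := h.mono hβ (h.iterate hx q) hx (k := W q - p) (by push_cast; linarith) n
      rw [← Function.iterate_add_apply] at h1
      have h2 := h.subset (h.iterate hx n)
      have h3 := h.subset (h.iterate hx (n + q))
      have h4 : ((W (n + q) - W n - p : ℤ) : ℝ) < ((1 : ℤ) : ℝ) := by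
        rw [hW]; push_cast at h1 ⊢; linarith [h2.2, h3.1]
      have h5 : W (n + q) - W n - p < 1 := by exact_mod_cast h4
      rw [hZ]; linarith
  obtain ⟨N, hN⟩ := hconst
  have hper : ∀ n ≥ N, W (n + q) = W n + p := by
    intro n hn
    have h1 := hZ n
    rw [hN n hn, hN (n + 1) (by omega)] at h1
    linarith
  refine ⟨N, dbar_injOn hβ (iterate_mem (h.subset (h.iterate hx N)) q)
    (h.subset (h.iterate hx N)) ?_⟩
  rw [dbar_shift, dbar_shift, shift_shift]
  funext n
  have h1 := hper (n + N) (by omega)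
  have h2 := hper (n + N + 1) (by omega)
  have h3 : n + N + 1 + q = n + N + q + 1 := by omega
  rw [h3] at h2
  simp only [W] at h1 h2
  rw [psum_succ, psum_succ] at h2
  simp only [shift]
  rw [show n + (q + N) = n + N + q by omega]
  linarith

/-- The maximum of a rotation set with a rational frequency, if it is periodic. -/
theorem dbar_max_of_periodic (h : IsRotationSet α β S) (hβ : 1 < β) {p : ℤ} {q : ℕ} (hq : 0 < q)
    (hcop : IsCoprime p (q : ℤ)) (hpq : α * q = p) {M : ℝ} (hM : IsGreatest S M)
    (hper : (Tbar β)^[q] M = M) : dbar β M = upperMech α 0 := by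
  have hWq : psum (dbar β M) q = p := by
    have h1 := h.le_mul_of_le hβ hM.1 (n := q) (k := psum (dbar β M) q) (by rw [hper, add_comm])
    have h2 := h.mul_le_of_le hβ hM.1 (n := q) (k := psum (dbar β M) q) (by rw [hper, add_comm])
    rw [hpq] at h1 h2
    exact le_antisymm (by exact_mod_cast h1) (by exact_mod_cast h2)
  have hmul : ∀ m : ℕ, (Tbar β)^[m * q] M = M ∧ psum (dbar β M) (m * q) = m * p := by
    intro m
    induction m with
    | zero => simp [psum_zero]
    | succ m ih =>
      rw [Nat.succ_mul, Function.iterate_add_apply, hper, psum_add, hper, hWq, ih.2]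
      exact ⟨ih.1, by push_cast; ring⟩
  refine eq_of_psum fun n => ?_
  rw [psum_upperMech]
  -- The general bounds leave the digit sum open only where `α n` is an integer. By coprimality `n`
  -- is then a multiple of `q`, and the period gives the sum.
  by_cases hn : ∃ k : ℤ, α * n = k
  · obtain ⟨k, hk⟩ := hn
    have hkq : p * n = k * q := by
      have : ((p * n : ℤ) : ℝ) = ((k * q : ℤ) : ℝ) := by
        push_cast; rw [← hpq, ← hk]; ring
      exact_mod_cast this
    have hdvd : (q : ℤ) ∣ n := hcop.symm.dvd_of_dvd_mul_left ⟨k, by rw [hkq, mul_comm]⟩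
    obtain ⟨m, hm⟩ := Int.natCast_dvd_natCast.1 hdvd
    rw [hk, Int.ceil_intCast, hm, mul_comm q m, (hmul m).2]
    have hq' : (q : ℤ) ≠ 0 := by exact_mod_cast hq.ne'
    refine mul_right_cancel₀ hq' ?_
    rw [← hkq, hm]; push_cast; ring
  · exact h.psum_max_eq hβ hM fun k hk => hn ⟨k, hk⟩

end IsRotationSet

/-! ### Uniqueness of the orbit closure, and the lexicographic criterion. -/

theorem IsXiSet.isCompact {α β : ℝ} {S : Set ℝ} (h : IsXiSet α β S) : IsCompact S := by
  obtain ⟨⟨x, _, rfl⟩, _, ⟨t, ht, _⟩, _⟩ := h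
  exact isCompact_Icc.of_isClosed_subset isClosed_closure ht

theorem IsXiSet.exists_isGreatest {α β : ℝ} {S : Set ℝ} (h : IsXiSet α β S) :
    ∃ M, IsGreatest S M := by
  refine h.isCompact.exists_isGreatest ?_
  obtain ⟨⟨x, _, rfl⟩, _⟩ := h
  exact ⟨_, mem_orbitClosure β x 0⟩

theorem orbitClosure_subset {β M : ℝ} {S : Set ℝ} (hS : IsClosed S)
    (hM : ∀ n, (Tbar β)^[n] M ∈ S) : orbitClosure β M ⊆ S :=
  closure_minimal (by rintro _ ⟨n, rfl⟩; exact hM n) hS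

theorem IsXiSet.exists_eq_orbitClosure {α β : ℝ} (hβ : 1 < β) {S : Set ℝ} (h : IsXiSet α β S) :
    ∃ M ∈ S, dbar β M = upperMech α 0 ∧ S = orbitClosure β M := by
  have hr := h.isRotationSet
  obtain ⟨M, hM⟩ := h.exists_isGreatest
  have hsub := orbitClosure_subset h.isCompact.isClosed (hr.iterate hM.1)
  refine ⟨M, hM.1, ?_⟩
  by_cases hα : Irrational α
  · exact ⟨hr.dbar_max_of_irrational hβ hα hM,
      Set.Subset.antisymm (fun y hy => hr.mem_orbitClosure_max hβ hα hM hy) hsub⟩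
  rw [Irrational, not_not] at hα
  obtain ⟨r, hr'⟩ := hα
  have hpq : α * r.den = r.num := by
    rw [← hr']; exact_mod_cast Rat.mul_den_eq_num r
  have hcop : IsCoprime r.num (r.den : ℤ) := Int.isCoprime_iff_gcd_eq_one.2 r.reduced
  have hq := r.den_pos
  generalize r.den = q at hpq hcop hq
  generalize r.num = p at hpq hcop
  obtain ⟨⟨x, _, hSx⟩, hTS, _⟩ := h
  have hx : x ∈ S := by rw [hSx]; exact mem_orbitClosure β x 0
  obtain ⟨N, hN⟩ := hr.eventually_periodic hβ hpq hx
  have hfin : (Set.range fun n : ℕ => (Tbar β)^[n] x).Finite := by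
    refine ((Finset.range (N + q)).finite_toSet.image fun n => (Tbar β)^[n] x).subset ?_
    rintro _ ⟨n, rfl⟩
    induction n using Nat.strong_induction_on with
    | _ n ih =>
      by_cases hn : n < N + q
      · exact ⟨n, by simpa using hn, rfl⟩
      · obtain ⟨m, rfl⟩ := Nat.exists_eq_add_of_le' (not_lt.1 hn)
        obtain ⟨k, hk, hk'⟩ := ih (m + N) (by omega)
        refine ⟨k, hk, hk'.trans ?_⟩
        simp only
        rw [Function.iterate_add_apply, Function.iterate_add_apply _ m (N + q), add_comm N q,
          Function.iterate_add_apply _ q N, hN]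
  have hSr : S = Set.range fun n : ℕ => (Tbar β)^[n] x := by
    rw [hSx, orbitClosure, hfin.isClosed.closure_eq]
  have hTN : ∀ m : ℕ, ∃ s ∈ S, (Tbar β)^[m] s = x := by
    have : ∀ m : ℕ, ∀ z ∈ S, ∃ s ∈ S, (Tbar β)^[m] s = z := by
      intro m
      induction m with
      | zero => intro z hz; exact ⟨z, hz, rfl⟩
      | succ m ih =>
        intro z hz
        obtain ⟨y, hy, rfl⟩ : z ∈ Tbar β '' S := by rw [hTS]; exact hz
        obtain ⟨s, hs, rfl⟩ := ih y hy
        exact ⟨s, hs, Function.iterate_succ_apply' _ _ _⟩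
    exact fun m => this m x hx
  -- Surjectivity on `S` gives `x` an `N`-fold preimage, itself an iterate of `x`. Thus `x` recurs
  -- in its own periodic part.
  have hxper : (Tbar β)^[q] x = x := by
    obtain ⟨s, hs, hsx⟩ := hTN N
    rw [hSr] at hs
    obtain ⟨i, rfl⟩ := hs
    simp only at hsx
    have : (Tbar β)^[i] ((Tbar β)^[N] x) = x := by
      rw [← Function.iterate_add_apply, add_comm, Function.iterate_add_apply, hsx]
    rw [← this, ← Function.iterate_add_apply, add_comm, Function.iterate_add_apply, hN]
  obtain ⟨i, hi⟩ : M ∈ Set.range fun n : ℕ => (Tbar β)^[n] x := by rw [← hSr]; exact hM.1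
  simp only at hi
  have hMper : (Tbar β)^[q] M = M := by
    rw [← hi, ← Function.iterate_add_apply, add_comm, Function.iterate_add_apply, hxper]
  refine ⟨hr.dbar_max_of_periodic hβ hq hcop hpq hM hMper, Set.Subset.antisymm ?_ hsub⟩
  intro z hz
  rw [hSr] at hz
  obtain ⟨k, rfl⟩ := hz
  have hmul : ∀ m : ℕ, (Tbar β)^[m * q] x = x := by
    intro m
    induction m with
    | zero => simp
    | succ m ih => rw [Nat.succ_mul, Function.iterate_add_apply, hxper, ih]
  -- As `M` is the `i`-th iterate of `x`, another `i * (q - 1)` steps complete `i` full periods.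
  have : (Tbar β)^[k + i * (q - 1)] M = (Tbar β)^[k] x := by
    obtain ⟨q, rfl⟩ := Nat.exists_eq_succ_of_ne_zero hq.ne'
    rw [← hi, ← Function.iterate_add_apply,
      show k + i * (q.succ - 1) + i = k + i * q.succ by simp [Nat.mul_succ, add_assoc],
      Function.iterate_add_apply, hmul]
  simp only [← this]
  exact mem_orbitClosure _ _ _

theorem IsXiSet.unique {α β : ℝ} (hβ : 1 < β) {S S' : Set ℝ} (h : IsXiSet α β S)
    (h' : IsXiSet α β S') : S = S' := by
  obtain ⟨M, hM, hd, rfl⟩ := h.exists_eq_orbitClosure hβ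
  obtain ⟨M', hM', hd', rfl⟩ := h'.exists_eq_orbitClosure hβ
  rw [dbar_injOn hβ (h.isRotationSet.subset hM) (h'.isRotationSet.subset hM') (hd.trans hd'.symm)]

theorem xiWellDefined_of_le {α β : ℝ} (hα : 0 < α) (hβ : 1 < β)
    (hle : toLex (upperMech α 0) ≤ toLex (dbar β 1)) : XiWellDefined α β := by
  obtain ⟨S, hS⟩ := exists_isXiSet hα hβ hle
  obtain ⟨M, hM⟩ := hS.exists_isGreatest
  refine ⟨⟨S, hS, fun S' hS' => hS'.unique hβ hS⟩, M, ⟨S, hS, hM⟩, ?_⟩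
  rintro ξ ⟨S', hS', hξ⟩
  rw [hS'.unique hβ hS] at hξ
  exact hξ.unique hM

theorem upperMech_le_of_isXiSet {α β : ℝ} (hβ : 1 < β) {S : Set ℝ} (hS : IsXiSet α β S) :
    toLex (upperMech α 0) ≤ toLex (dbar β 1) := by
  obtain ⟨x, hx⟩ := hS.exists_isGreatest
  have h := hS.isRotationSet.subset hx.1
  exact upperMech_le_dbar_one_of_hasFreq hβ ⟨h.1.le, h.2⟩ (hS.2.2.2 x hx.1)

/-! ### Finite blocks, and transfer between list order and infinite lexicographic order. -/

theorem length_block (s : ℕ → ℤ) (i n : ℕ) : (block s i n).length = n := by simp [block]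

theorem block_zero (s : ℕ → ℤ) (i : ℕ) : block s i 0 = [] := rfl

theorem block_add (s : ℕ → ℤ) (i m n : ℕ) :
    block s i (m + n) = block s i m ++ block s (i + m) n := by
  simp [block, List.range_add, add_assoc, Function.comp_def]

theorem block_one (s : ℕ → ℤ) (i : ℕ) : block s i 1 = [s i] := by simp [block]

theorem block_two (s : ℕ → ℤ) (i : ℕ) : block s i 2 = [s i, s (i + 1)] := by
  simp [block, List.range_succ]

theorem block_succ (s : ℕ → ℤ) (i n : ℕ) : block s i (n + 1) = s i :: block s (i + 1) n := by
  rw [add_comm n 1, block_add, block_one]; rfl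

theorem block_shift (s : ℕ → ℤ) (j i n : ℕ) : block (shift s j) i n = block s (i + j) n := by
  simp only [block, shift]
  refine List.map_congr_left fun k _ => ?_
  congr 1; omega

theorem block_eq_block {s t : ℕ → ℤ} {i j n : ℕ} :
    block s i n = block t j n ↔ ∀ k < n, s (i + k) = t (j + k) := by
  simp [block]

theorem block_eq_replicate {s : ℕ → ℤ} {i n : ℕ} {c : ℤ} :
    block s i n = List.replicate n c ↔ ∀ k < n, s (i + k) = c := by
  rw [List.eq_replicate_iff]
  simp [block]

theorem block_inj {s : ℕ → ℤ} {i m n : ℕ} {x y : List ℤ} (hx : x.length = m) :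
    block s i (m + n) = x ++ y ↔ block s i m = x ∧ block s (i + m) n = y := by
  rw [block_add]
  exact ⟨fun h => List.append_inj h (by rw [length_block, hx]), fun h => by rw [h.1, h.2]⟩

theorem cons_shift (w : ℕ → ℤ) : cons (w 0) (shift w 1) = w := by
  funext n; cases n <;> rfl

theorem shift_cons (c : ℤ) (s : ℕ → ℤ) : shift (cons c s) 1 = s := rfl

theorem lex_lt_head {s t : ℕ → ℤ} : toLex s < toLex t ↔
    s 0 < t 0 ∨ (s 0 = t 0 ∧ toLex (shift s 1) < toLex (shift t 1)) := by
  rw [lex_lt_iff]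
  constructor
  · rintro ⟨i, hi, h⟩
    cases i with
    | zero => exact Or.inl h
    | succ i =>
      exact Or.inr ⟨hi 0 (by omega), lex_lt_iff.2 ⟨i, fun j hj => hi (j + 1) (by omega), h⟩⟩
  · rintro (h | ⟨h0, h⟩)
    · exact ⟨0, fun j hj => by omega, h⟩
    · obtain ⟨i, hi, h⟩ := lex_lt_iff.1 h
      refine ⟨i + 1, fun j hj => ?_, h⟩
      cases j with
      | zero => exact h0
      | succ j => exact hi j (by omega)

theorem cons_le_cons_iff {c : ℤ} {s t : ℕ → ℤ} :
    toLex (cons c s) ≤ toLex (cons c t) ↔ toLex s ≤ toLex t := by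
  have h : toLex (cons c t) < toLex (cons c s) ↔ toLex t < toLex s := by
    rw [lex_lt_head]
    simp [cons, shift_cons]
  exact ⟨fun h' => not_lt.1 fun h'' => absurd (h.2 h'') (not_lt.2 h'),
    fun h' => not_lt.1 fun h'' => absurd (h.1 h'') (not_lt.2 h')⟩

theorem append_lt_append_left_iff {u x y : List ℤ} : u ++ x < u ++ y ↔ x < y := by
  induction u with
  | nil => rfl
  | cons c u ih => simp [ih]

theorem append_lt_append_of_lt {x y z w : List ℤ} (hl : x.length = y.length) (h : x < y) :
    x ++ z < y ++ w := by
  induction x generalizing y with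
  | nil => cases y <;> simp at hl h
  | cons c x ih =>
    cases y with
    | nil => simp at hl
    | cons d y =>
      rw [List.cons_lt_cons_iff] at h
      rw [List.cons_append, List.cons_append, List.cons_lt_cons_iff]
      rcases h with h | ⟨h1, h2⟩
      · exact Or.inl h
      · exact Or.inr ⟨h1, ih (by simpa using hl) h2⟩

theorem lt_of_append_lt_append {x y z w : List ℤ} (hl : x.length = y.length) (hne : x ≠ y)
    (h : x ++ z < y ++ w) : x < y := by
  rcases lt_trichotomy x y with h1 | h1 | h1
  · exact h1
  · exact absurd h1 hne
  · exact absurd (append_lt_append_of_lt (z := w) (w := z) hl.symm h1) (lt_asymm h)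

theorem lex_lt_of_block_lt {n : ℕ} {s t : ℕ → ℤ} (h : block s 0 n < block t 0 n) :
    toLex s < toLex t := by
  induction n generalizing s t with
  | zero => simp [block_zero] at h
  | succ n ih =>
    rw [block_succ, block_succ, List.cons_lt_cons_iff] at h
    rw [lex_lt_head]
    refine h.imp id fun h => ⟨h.1, ih ?_⟩
    rw [block_shift, block_shift]; exact h.2

theorem lex_lt_of_prefix {s t : ℕ → ℤ} {n m : ℕ} (h0 : block s 0 n = block t 0 n)
    (h : block s n m < block t n m) : toLex s < toLex t := by
  refine lex_lt_of_block_lt (n := n + m) ?_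
  rw [block_add, block_add, h0, zero_add]
  exact append_lt_append_left_iff.2 h

theorem psum_add_of_block_eq {w v : ℕ → ℤ} {i n : ℕ} (h : block w i n = block v 0 n) {k : ℕ}
    (hk : k ≤ n) : psum w (i + k) = psum w i + psum v k := by
  have h1 : psum (shift w i) k = psum v k := psum_congr fun j hj => by
    have := block_eq_block.1 h j (by omega)
    rwa [zero_add, add_comm] at this
  rw [psum_shift, add_comm k i] at h1
  linarith

theorem psum_eq_of_block_eq {w v : ℕ → ℤ} {n : ℕ} (h : block w 0 n = block v 0 n) {k : ℕ}
    (hk : k ≤ n) : psum w k = psum v k := by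
  simpa [psum_zero] using psum_add_of_block_eq h hk

theorem sum_block (w : ℕ → ℤ) (n : ℕ) : (block w 0 n).sum = psum w n := by
  induction n with
  | zero => simp [block_zero, psum_zero]
  | succ n ih => rw [block_add, List.sum_append, ih, psum_succ, block_one]; simp

theorem block_eq_of_psum {w v : ℕ → ℤ} {i n : ℕ}
    (h : ∀ k ≤ n, psum w (i + k) = psum w i + psum v k) : block w i n = block v 0 n := by
  rw [block_eq_block]
  intro k hk
  have h1 := h k hk.le
  have h2 := h (k + 1) hk
  rw [← add_assoc, psum_succ, psum_succ] at h2
  rw [zero_add]; linarith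

/-! ### Floors and ceilings at rational slopes and Farey mediants. -/

theorem floor_slope_iff {h k : ℤ} {l n : ℕ} (hl : 0 < l) :
    ⌊(h : ℝ) / l * n⌋ = k ↔ k * l ≤ h * n ∧ h * n < (k + 1) * l := by
  have hl' : (0 : ℝ) < l := by exact_mod_cast hl
  rw [Int.floor_eq_iff, div_mul_eq_mul_div, le_div_iff₀ hl', div_lt_iff₀ hl']
  norm_cast

theorem ceil_slope (h : ℤ) (l n : ℕ) : ⌈(h : ℝ) / l * n⌉ = -⌊((-h : ℤ) : ℝ) / l * n⌋ := by
  rw [← Int.ceil_neg]; congr 1; push_cast; ring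

theorem ceil_slope_iff {h k : ℤ} {l n : ℕ} (hl : 0 < l) :
    ⌈(h : ℝ) / l * n⌉ = k ↔ (k - 1) * l < h * n ∧ h * n ≤ k * l := by
  rw [ceil_slope, neg_eq_iff_eq_neg, floor_slope_iff hl]
  constructor <;> rintro ⟨h1, h2⟩ <;> constructor <;> linarith

theorem floor_slope_self (h : ℤ) {l : ℕ} (hl : 0 < l) : ⌊(h : ℝ) / l * l⌋ = h := by
  rw [floor_slope_iff hl]; constructor <;> nlinarith

theorem ceil_slope_self (h : ℤ) {l : ℕ} (hl : 0 < l) : ⌈(h : ℝ) / l * l⌉ = h := by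
  rw [ceil_slope, floor_slope_self _ hl, neg_neg]

/-- Put `z = h₁ n - k l₁` and `y = h₂ n - k l₂`. The determinant gives `l₁ y - l₂ z = n`, which
confines `y` to `0, …, l₂`; hence `z + y` is a valid remainder for the mediant with the same
quotient `k`. -/
theorem floor_mediant {h₁ h₂ : ℤ} {l₁ l₂ n : ℕ} (hl₁ : 0 < l₁)
    (det : l₁ * h₂ - h₁ * l₂ = 1) (hn : n < l₁ + l₂) :
    ⌊((h₁ + h₂ : ℤ) : ℝ) / (l₁ + l₂ : ℕ) * n⌋ = ⌊(h₁ : ℝ) / l₁ * n⌋ := by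
  obtain ⟨k, hk⟩ : ∃ k, ⌊(h₁ : ℝ) / l₁ * n⌋ = k := ⟨_, rfl⟩
  rw [hk, floor_slope_iff (by omega)]
  obtain ⟨k1, k2⟩ := (floor_slope_iff hl₁).1 hk
  push_cast
  have e : l₁ * (h₂ * n - k * l₂) - l₂ * (h₁ * n - k * l₁) = (n : ℤ) := by
    linear_combination n * det
  have hn' : (n : ℤ) < l₁ + l₂ := by exact_mod_cast hn
  have hl₁' : (0 : ℤ) < l₁ := by exact_mod_cast hl₁
  have hl₂' : (0 : ℤ) ≤ l₂ := by positivity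
  set z := h₁ * n - k * l₁ with hz
  set y := h₂ * n - k * l₂ with hy
  have hz0 : 0 ≤ z := by linarith
  have hz1 : z ≤ l₁ - 1 := by linarith
  have hy0 : 0 ≤ y := by
    by_contra hc
    have : y ≤ -1 := by omega
    nlinarith [Nat.cast_nonneg (α := ℤ) n]
  have hy1 : y ≤ l₂ := by
    by_contra hc
    have : (l₂ : ℤ) + 1 ≤ y := by omega
    nlinarith
  constructor <;> linarith

/-- The remainder for the mediant is now `1 + z + y`. The `1` is the determinant, and it compensates
for `z` possibly being `-1`. -/
theorem floor_mediant_add {h₁ h₂ : ℤ} {l₁ l₂ m : ℕ} (hl₁ : 0 < l₁) (hl₂ : 0 < l₂)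
    (det : l₁ * h₂ - h₁ * l₂ = 1) (hm : m ≤ l₂) :
    ⌊((h₁ + h₂ : ℤ) : ℝ) / (l₁ + l₂ : ℕ) * (l₁ + m : ℕ)⌋ = h₁ + ⌊(h₂ : ℝ) / l₂ * m⌋ := by
  obtain ⟨k, hk⟩ : ∃ k, ⌊(h₂ : ℝ) / l₂ * m⌋ = k := ⟨_, rfl⟩
  rw [hk, floor_slope_iff (by omega)]
  obtain ⟨k1, k2⟩ := (floor_slope_iff hl₂).1 hk
  push_cast
  have e : l₁ * (h₂ * m - k * l₂) - l₂ * (h₁ * m - k * l₁) = (m : ℤ) := by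
    linear_combination m * det
  have hm' : (m : ℤ) ≤ l₂ := by exact_mod_cast hm
  have hl₂' : (0 : ℤ) < l₂ := by exact_mod_cast hl₂
  have hl₁' : (0 : ℤ) < l₁ := by exact_mod_cast hl₁
  set z := h₁ * m - k * l₁ with hz
  set y := h₂ * m - k * l₂ with hy
  have hy0 : 0 ≤ y := by linarith
  have hy1 : y ≤ l₂ - 1 := by linarith
  have hz0 : -1 ≤ z := by
    by_contra hc
    have : z ≤ -2 := by omega
    nlinarith
  have hz1 : z ≤ l₁ - 1 := by
    by_contra hc
    have : (l₁ : ℤ) ≤ z := by omega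
    nlinarith [Nat.cast_nonneg (α := ℤ) m]
  constructor <;> linarith

/-! ### Central words and Christoffel words. -/

/-- `u` is the central word over `{a, a+1}` that belongs to the slope `h / l`. -/
def IsCentralOf (a : ℤ) (u : List ℤ) (h : ℤ) (l : ℕ) : Prop :=
  0 < l ∧ IsCoprime h (l : ℤ) ∧ a * l < h ∧ h < (a + 1) * l ∧
    a :: (u ++ [a + 1]) = block (lowerMech ((h : ℝ) / (l : ℝ)) 0) 0 l

theorem isCentral_iff {a : ℤ} {u : List ℤ} : IsCentral a u ↔ ∃ h l, IsCentralOf a u h l := Iff.rfl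

theorem upperMech_eq (α : ℝ) (n : ℕ) : upperMech α 0 n = ⌈α * (n + 1 : ℕ)⌉ - ⌈α * n⌉ := by
  rw [← psum_upperMech, ← psum_upperMech, psum_succ]; ring

theorem lowerMech_eq (α : ℝ) (n : ℕ) : lowerMech α 0 n = ⌊α * (n + 1 : ℕ)⌋ - ⌊α * n⌋ := by
  rw [← psum_lowerMech, ← psum_lowerMech, psum_succ]; ring

theorem upperMech_zero (α : ℝ) : upperMech α 0 0 = ⌈α⌉ := by simp [upperMech_eq]

theorem lowerMech_zero (α : ℝ) : lowerMech α 0 0 = ⌊α⌋ := by simp [lowerMech_eq]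

theorem ceil_slope_eq_floor_add_one {h : ℤ} {l n : ℕ} (hcop : IsCoprime h (l : ℤ)) (hn : 0 < n)
    (hnl : n < l) : ⌈(h : ℝ) / l * n⌉ = ⌊(h : ℝ) / l * n⌋ + 1 := by
  obtain ⟨k, hk⟩ : ∃ k, ⌊(h : ℝ) / l * n⌋ = k := ⟨_, rfl⟩
  have hl : 0 < l := by omega
  rw [hk, ceil_slope_iff hl]
  obtain ⟨h1, h2⟩ := (floor_slope_iff hl).1 hk
  refine ⟨lt_of_le_of_ne (by linarith) fun he => ?_, h2.le⟩
  have hd : (l : ℤ) ∣ n := hcop.symm.dvd_of_dvd_mul_left ⟨k, by linarith⟩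
  exact absurd (Nat.le_of_dvd hn (Int.natCast_dvd_natCast.1 hd)) (by omega)

theorem upperMech_slope_add (h : ℤ) {l : ℕ} (hl : 0 < l) (n : ℕ) :
    upperMech ((h : ℝ) / l) 0 (n + l) = upperMech ((h : ℝ) / l) 0 n := by
  have hl' : (l : ℝ) ≠ 0 := by positivity
  have key : ∀ m : ℕ, ⌈(h : ℝ) / l * (m + l : ℕ)⌉ = ⌈(h : ℝ) / l * m⌉ + h := by
    intro m
    rw [← Int.ceil_add_intCast]; congr 1; push_cast; field_simp
  rw [upperMech_eq, upperMech_eq, show n + l + 1 = n + 1 + l by omega, key, key]; ring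

theorem lowerMech_slope_add (h : ℤ) {l : ℕ} (hl : 0 < l) (n : ℕ) :
    lowerMech ((h : ℝ) / l) 0 (n + l) = lowerMech ((h : ℝ) / l) 0 n := by
  have hl' : (l : ℝ) ≠ 0 := by positivity
  have key : ∀ m : ℕ, ⌊(h : ℝ) / l * (m + l : ℕ)⌋ = ⌊(h : ℝ) / l * m⌋ + h := by
    intro m
    rw [← Int.floor_add_intCast]; congr 1; push_cast; field_simp
  rw [lowerMech_eq, lowerMech_eq, show n + l + 1 = n + 1 + l by omega, key, key]; ring

theorem block_ends (w : ℕ → ℤ) (m : ℕ) :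
    block w 0 (m + 2) = w 0 :: (block w 1 m ++ [w (m + 1)]) := by
  rw [show m + 2 = m + 1 + 1 by omega, block_succ, block_add, block_one, add_comm (0 + 1) m]

theorem block_ends_eq_iff {w : ℕ → ℤ} {u : List ℤ} {m : ℕ} (hu : u.length = m) {c d : ℤ} :
    c :: (u ++ [d]) = block w 0 (m + 2) ↔ w 0 = c ∧ block w 1 m = u ∧ w (m + 1) = d := by
  rw [block_ends, List.cons.injEq]
  constructor
  · rintro ⟨h1, h2⟩
    obtain ⟨h3, h4⟩ := List.append_inj h2 (by rw [length_block, hu])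
    exact ⟨h1.symm, h3.symm, by simpa using h4.symm⟩
  · rintro ⟨h1, h2, h3⟩
    exact ⟨h1.symm, by rw [h2, h3]⟩

namespace IsCentralOf

variable {a : ℤ} {u : List ℤ} {h : ℤ} {l : ℕ}

theorem length_eq (H : IsCentralOf a u h l) : l = u.length + 2 := by
  have := congrArg List.length H.2.2.2.2
  rw [length_block] at this
  simp at this; omega

theorem lt_slope (H : IsCentralOf a u h l) : (a : ℝ) < (h : ℝ) / l := by
  have hl : (0 : ℝ) < l := by exact_mod_cast H.1
  rw [lt_div_iff₀ hl]; exact_mod_cast H.2.2.1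

theorem slope_lt (H : IsCentralOf a u h l) : (h : ℝ) / l < a + 1 := by
  have hl : (0 : ℝ) < l := by exact_mod_cast H.1
  rw [div_lt_iff₀ hl]; exact_mod_cast H.2.2.2.1

theorem floor_eq (H : IsCentralOf a u h l) : ⌊(h : ℝ) / l⌋ = a :=
  Int.floor_eq_iff.2 ⟨H.lt_slope.le, H.slope_lt⟩

theorem ceil_eq (H : IsCentralOf a u h l) : ⌈(h : ℝ) / l⌉ = a + 1 := by
  rw [Int.ceil_eq_iff]; push_cast
  exact ⟨by linarith [H.lt_slope], H.slope_lt.le⟩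

theorem unique {v : List ℤ} (H : IsCentralOf a u h l) (H' : IsCentralOf a v h l) : u = v := by
  have := H.2.2.2.2.trans H'.2.2.2.2.symm
  rw [List.cons.injEq] at this
  exact List.append_cancel_right this.2

/-- Inside the period `h n / l` is never an integer, so ceiling and floor differ by one there. Lower
and upper words therefore share their middle part and only exchange the end letters. -/
theorem upper (H : IsCentralOf a u h l) :
    (a + 1) :: (u ++ [a]) = block (upperMech ((h : ℝ) / (l : ℝ)) 0) 0 l := by
  have hl := H.length_eq
  have H5 := H.2.2.2.2
  rw [show block (lowerMech ((h : ℝ) / (l : ℝ)) 0) 0 l =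
    block (lowerMech ((h : ℝ) / (l : ℝ)) 0) 0 (u.length + 2) by rw [← hl],
    block_ends_eq_iff rfl] at H5
  rw [show block (upperMech ((h : ℝ) / (l : ℝ)) 0) 0 l =
    block (upperMech ((h : ℝ) / (l : ℝ)) 0) 0 (u.length + 2) by rw [← hl],
    block_ends_eq_iff rfl]
  obtain ⟨_, h2, h3⟩ := H5
  refine ⟨by rw [upperMech_zero, H.ceil_eq], ?_, ?_⟩
  · refine Eq.trans ?_ h2
    rw [block_eq_block]
    intro k hk
    rw [upperMech_eq, lowerMech_eq, ceil_slope_eq_floor_add_one H.2.1 (by omega) (by omega),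
      ceil_slope_eq_floor_add_one H.2.1 (by omega) (by omega)]
    ring
  · rw [lowerMech_eq, show u.length + 1 + 1 = l by omega, floor_slope_self _ H.1] at h3
    rw [upperMech_eq, show u.length + 1 + 1 = l by omega, ceil_slope_self _ H.1,
      ceil_slope_eq_floor_add_one H.2.1 (by omega) (by omega)]
    linarith

theorem block_upper (H : IsCentralOf a u h l) :
    block (shift (upperMech ((h : ℝ) / l) 0) 1) 0 l = u ++ [a, a + 1] := by
  have h1 := H.upper
  have h2 : block (upperMech ((h : ℝ) / l) 0) 0 (l + 1) =
      (a + 1) :: (u ++ [a]) ++ [a + 1] := by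
    rw [block_add, ← h1, block_one, upperMech_slope_add _ H.1, upperMech_zero, H.ceil_eq]
  rw [block_succ, List.cons_append, List.cons.injEq] at h2
  rw [block_shift, h2.2]; simp

theorem block_lower (H : IsCentralOf a u h l) :
    block (shift (lowerMech ((h : ℝ) / l) 0) 1) 0 l = u ++ [a + 1, a] := by
  have h1 := H.2.2.2.2
  have h2 : block (lowerMech ((h : ℝ) / l) 0) 0 (l + 1) =
      a :: (u ++ [a + 1]) ++ [a] := by
    rw [block_add, ← h1, block_one, lowerMech_slope_add _ H.1, lowerMech_zero, H.floor_eq]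
  rw [block_succ, List.cons_append, List.cons.injEq] at h2
  rw [block_shift, h2.2]; simp

theorem block_upper' (H : IsCentralOf a u h l) :
    block (shift (upperMech ((h : ℝ) / l) 0) 1) (u.length + 2) (u.length + 2) =
      u ++ [a, a + 1] := by
  rw [← H.block_upper, H.length_eq.symm, block_eq_block]
  intro k _
  simp only [shift]
  rw [show l + k + 1 = 0 + k + 1 + l by omega, upperMech_slope_add _ H.1]

theorem block_lower' (H : IsCentralOf a u h l) :
    block (shift (lowerMech ((h : ℝ) / l) 0) 1) (u.length + 2) (u.length + 2) =
      u ++ [a + 1, a] := by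
  rw [← H.block_lower, H.length_eq.symm, block_eq_block]
  intro k _
  simp only [shift]
  rw [show l + k + 1 = 0 + k + 1 + l by omega, lowerMech_slope_add _ H.1]

theorem upper_prefix (H : IsCentralOf a u h l) :
    block (shift (upperMech ((h : ℝ) / l) 0) 1) 0 u.length = u ∧
    block (shift (upperMech ((h : ℝ) / l) 0) 1) u.length 2 = [a, a + 1] := by
  have h1 := H.block_upper
  rw [H.length_eq] at h1
  have h2 := (block_inj rfl).1 h1
  rw [zero_add, ← H.length_eq] at h2
  exact h2

theorem lower_prefix (H : IsCentralOf a u h l) :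
    block (shift (lowerMech ((h : ℝ) / l) 0) 1) 0 u.length = u ∧
    block (shift (lowerMech ((h : ℝ) / l) 0) 1) u.length 2 = [a + 1, a] := by
  have h1 := H.block_lower
  rw [H.length_eq] at h1
  have h2 := (block_inj rfl).1 h1
  rw [zero_add, ← H.length_eq] at h2
  exact h2

/-- Identifies the quantity in the mixed rules with the slope: the Christoffel word has letter sum
`h`, and all its letters are `a` or `a + 1`. -/
theorem slope_eq (H : IsCentralOf a u h l) :
    (h : ℝ) / l = a + ((u.count (a + 1) : ℝ) + 1) / ((u.length : ℝ) + 2) := by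
  have hl := H.length_eq
  have hsum : 2 * a + 1 + u.sum = h := by
    have h1 := congrArg List.sum H.2.2.2.2
    rw [sum_block, psum_lowerMech, floor_slope_self _ H.1] at h1
    simp at h1; linarith
  have hlet : ∀ x ∈ u, x = a ∨ x = a + 1 := by
    intro x hx
    rw [← H.lower_prefix.1, block, List.mem_map] at hx
    obtain ⟨n, _, rfl⟩ := hx
    simp only [shift]
    rw [lowerMech_eq]
    have h1 := H.lt_slope
    have h2 := H.slope_lt
    set φ := (h : ℝ) / l
    generalize 0 + n + 1 = m
    have h3 : ((⌊φ * m⌋ + a : ℤ) : ℝ) ≤ φ * (m + 1 : ℕ) := by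
      push_cast; linarith [Int.floor_le (φ * m)]
    have h4 : φ * (m + 1 : ℕ) < ((⌊φ * m⌋ + a + 2 : ℤ) : ℝ) := by
      push_cast; linarith [Int.lt_floor_add_one (φ * m)]
    have h5 := Int.le_floor.2 h3
    have h6 := Int.floor_lt.2 h4
    omega
  have hcount : ∀ v : List ℤ, (∀ x ∈ v, x = a ∨ x = a + 1) →
      v.sum = a * v.length + v.count (a + 1) := by
    intro v hv
    induction v with
    | nil => simp
    | cons c v ih =>
      have h1 := ih fun x hx => hv x (List.mem_cons_of_mem _ hx)
      rcases hv c List.mem_cons_self with rfl | rfl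
      · rw [List.sum_cons, List.length_cons, List.count_cons_of_ne (by omega), h1]
        push_cast; ring
      · rw [List.sum_cons, List.length_cons, List.count_cons_self, h1]
        push_cast; ring
  rw [hcount u hlet] at hsum
  have : (0 : ℝ) < (u.length : ℝ) + 2 := by positivity
  rw [← hsum, hl]
  push_cast
  field_simp
  ring

end IsCentralOf

theorem exists_isCentralOf {a h : ℤ} {l : ℕ} (hcop : IsCoprime h (l : ℤ)) (h1 : a * l < h)
    (h2 : h < (a + 1) * l) : ∃ u, IsCentralOf a u h l := by
  have hl : 2 ≤ l := by
    have : (1 : ℤ) < l := by linarith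
    omega
  obtain ⟨m, rfl⟩ := Nat.exists_eq_add_of_le' hl
  have hl0 : 0 < m + 2 := by omega
  refine ⟨block (lowerMech ((h : ℝ) / (m + 2 : ℕ)) 0) 1 m, hl0, hcop, h1, h2, ?_⟩
  rw [block_ends_eq_iff (length_block _ _ _)]
  refine ⟨?_, rfl, ?_⟩
  · rw [lowerMech_eq]
    have : ⌊(h : ℝ) / (m + 2 : ℕ) * (0 + 1 : ℕ)⌋ = a := by
      rw [floor_slope_iff hl0]; push_cast at h1 h2 ⊢; constructor <;> linarith
    rw [this]; simp
  · rw [lowerMech_eq, show m + 1 + 1 = m + 2 by omega, floor_slope_self _ hl0]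
    have : ⌊(h : ℝ) / (m + 2 : ℕ) * (m + 1 : ℕ)⌋ = h - (a + 1) := by
      rw [floor_slope_iff hl0]; push_cast at h1 h2 ⊢; constructor <;> linarith
    rw [this]; ring

theorem isCentralOf_replicate (a : ℤ) (k : ℕ) :
    IsCentralOf a (List.replicate k a) (a * (k + 2) + 1) (k + 2) := by
  have hl : 0 < k + 2 := by omega
  refine ⟨hl, ⟨1, -a, by push_cast; ring⟩, by push_cast; linarith, by push_cast; linarith, ?_⟩
  have hf : ∀ n < k + 2, ⌊((a * (k + 2) + 1 : ℤ) : ℝ) / (k + 2 : ℕ) * n⌋ = a * n := by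
    intro n hn
    rw [floor_slope_iff hl]
    have : (n : ℤ) < k + 2 := by exact_mod_cast hn
    push_cast; constructor <;> nlinarith
  rw [block_ends_eq_iff (by simp)]
  refine ⟨?_, ?_, ?_⟩
  · rw [lowerMech_eq, hf _ (by omega), hf _ (by omega)]; simp
  · rw [block_eq_replicate]
    intro j hj
    rw [lowerMech_eq, hf _ (by omega), hf _ (by omega)]; push_cast; ring
  · rw [lowerMech_eq, show k + 1 + 1 = k + 2 by omega, floor_slope_self _ hl, hf _ (by omega)]
    push_cast; ring

theorem isCentralOf_replicate_succ (a : ℤ) (k : ℕ) :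
    IsCentralOf a (List.replicate k (a + 1)) ((a + 1) * (k + 2) - 1) (k + 2) := by
  have hl : 0 < k + 2 := by omega
  refine ⟨hl, ⟨-1, a + 1, by push_cast; ring⟩, by push_cast; linarith, by push_cast; linarith, ?_⟩
  have hf : ∀ n < k + 2, ⌊(((a + 1) * (k + 2) - 1 : ℤ) : ℝ) / (k + 2 : ℕ) * (n + 1 : ℕ)⌋ =
      (a + 1) * (n + 1) - 1 := by
    intro n hn
    rw [floor_slope_iff hl]
    have : (n : ℤ) + 1 ≤ k + 2 := by exact_mod_cast hn
    push_cast; constructor <;> nlinarith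
  rw [block_ends_eq_iff (by simp)]
  refine ⟨?_, ?_, ?_⟩
  · rw [lowerMech_eq, hf _ (by omega)]; simp
  · rw [block_eq_replicate]
    intro j hj
    rw [lowerMech_eq, hf _ (by omega), add_comm 1 j, hf _ (by omega)]; push_cast; ring
  · rw [lowerMech_eq, hf _ (by omega), hf _ (by omega)]
    push_cast; ring

/-! ### Mediants and the two factorisations of a central word. -/

section Mediant

variable {a : ℤ} {p q : List ℤ} {h₁ h₂ : ℤ} {l₁ l₂ : ℕ}

theorem block_lower_mediant (hl₁ : 0 < l₁) (hl₂ : 0 < l₂) (det : l₁ * h₂ - h₁ * l₂ = 1) :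
    block (lowerMech (((h₁ + h₂ : ℤ) : ℝ) / (l₁ + l₂ : ℕ)) 0) 0 (l₁ + l₂) =
      block (lowerMech ((h₁ : ℝ) / l₁) 0) 0 l₁ ++ block (lowerMech ((h₂ : ℝ) / l₂) 0) 0 l₂ := by
  rw [block_add]
  congr 1
  · refine block_eq_of_psum fun k hk => ?_
    rw [zero_add, psum_zero, zero_add, psum_lowerMech, psum_lowerMech,
      floor_mediant hl₁ det (by omega)]
  · rw [zero_add]
    refine block_eq_of_psum fun k hk => ?_
    rw [psum_lowerMech, psum_lowerMech, psum_lowerMech, floor_mediant_add hl₁ hl₂ det hk,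
      floor_mediant hl₁ det (by omega), floor_slope_self _ hl₁]

theorem block_upper_mediant (hl₁ : 0 < l₁) (hl₂ : 0 < l₂) (det : l₁ * h₂ - h₁ * l₂ = 1) :
    block (upperMech (((h₁ + h₂ : ℤ) : ℝ) / (l₁ + l₂ : ℕ)) 0) 0 (l₁ + l₂) =
      block (upperMech ((h₂ : ℝ) / l₂) 0) 0 l₂ ++ block (upperMech ((h₁ : ℝ) / l₁) 0) 0 l₁ := by
  have det' : l₂ * (-h₁) - (-h₂) * l₁ = 1 := by linarith
  rw [add_comm l₁ l₂, add_comm h₁ h₂, block_add]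
  congr 1
  · refine block_eq_of_psum fun k hk => ?_
    rw [zero_add, psum_zero, zero_add, psum_upperMech, psum_upperMech, ceil_slope, ceil_slope,
      neg_add, floor_mediant hl₂ det' (by omega)]
  · rw [zero_add]
    refine block_eq_of_psum fun k hk => ?_
    rw [psum_upperMech, psum_upperMech, psum_upperMech, ceil_slope, ceil_slope, ceil_slope,
      neg_add, floor_mediant_add hl₂ hl₁ det' hk, floor_mediant hl₂ det' (by omega),
      floor_slope_self _ hl₂]
    ring

/-- The central word of a Farey mediant. -/
theorem IsCentralOf.mediant (Hq : IsCentralOf a q h₁ l₁) (Hp : IsCentralOf a p h₂ l₂)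
    (det : l₁ * h₂ - h₁ * l₂ = 1) :
    IsCentralOf a (q ++ [a + 1, a] ++ p) (h₁ + h₂) (l₁ + l₂) ∧
      p ++ [a, a + 1] ++ q = q ++ [a + 1, a] ++ p := by
  have H : IsCentralOf a (q ++ [a + 1, a] ++ p) (h₁ + h₂) (l₁ + l₂) := by
    refine ⟨by have := Hq.1; omega, ⟨-l₂, h₂, by push_cast; linarith⟩, ?_, ?_, ?_⟩
    · push_cast; linarith [Hq.2.2.1, Hp.2.2.1]
    · push_cast; linarith [Hq.2.2.2.1, Hp.2.2.2.1]
    · rw [block_lower_mediant Hq.1 Hp.1 det, ← Hq.2.2.2.2, ← Hp.2.2.2.2]; simp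
  refine ⟨H, ?_⟩
  -- The upper Christoffel word of the mediant factors in the opposite order from the lower one;
  -- comparing central parts gives the second factorisation.
  have h1 := H.upper
  rw [block_upper_mediant Hq.1 Hp.1 det, ← Hq.upper, ← Hp.upper] at h1
  have h2 : (q ++ [a + 1, a] ++ p) ++ [a] = (p ++ [a, a + 1] ++ q) ++ [a] := by
    simpa using h1
  exact (List.append_cancel_right h2).symm

theorem IsCentralOf.lower_prefix_mediant {w : List ℤ} (hl₁ : 0 < l₁)
    (H : IsCentralOf a w (h₁ + h₂) (l₁ + l₂)) (det : l₁ * h₂ - h₁ * l₂ = 1) :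
    block (shift (lowerMech ((h₁ : ℝ) / l₁) 0) 1) 0 w.length = w := by
  have hl := H.length_eq
  nth_rw 2 [← H.lower_prefix.1]
  rw [block_shift, block_shift, block_eq_block]
  intro k hk
  rw [lowerMech_eq, lowerMech_eq, floor_mediant hl₁ det (by omega),
    floor_mediant hl₁ det (by omega)]

theorem IsCentralOf.upper_prefix_mediant {w : List ℤ} (hl₂ : 0 < l₂)
    (H : IsCentralOf a w (h₁ + h₂) (l₁ + l₂)) (det : l₁ * h₂ - h₁ * l₂ = 1) :
    block (shift (upperMech ((h₂ : ℝ) / l₂) 0) 1) 0 w.length = w := by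
  have det' : l₂ * (-h₁) - (-h₂) * l₁ = 1 := by linarith
  have hl := H.length_eq
  nth_rw 2 [← H.upper_prefix.1]
  rw [block_shift, block_shift, block_eq_block]
  intro k hk
  rw [add_comm l₁, add_comm h₁, upperMech_eq, upperMech_eq, ceil_slope, ceil_slope, ceil_slope,
    ceil_slope, neg_add, floor_mediant hl₂ det' (by omega), floor_mediant hl₂ det' (by omega)]

/-- Every central word that is not a power of a letter is a mediant. -/
theorem IsCentralOf.decomposition {u : List ℤ} {h : ℤ} {l : ℕ} (H : IsCentralOf a u h l) :
    (∃ k, u = List.replicate k a) ∨ (∃ k, u = List.replicate k (a + 1)) ∨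
    ∃ p q, IsCentral a p ∧ IsCentral a q ∧ u = p ++ [a, a + 1] ++ q ∧
      u = q ++ [a + 1, a] ++ p := by
  have hl2 : l = u.length + 2 := H.length_eq
  by_cases hA : h = a * l + 1
  · rw [hA, hl2] at H
    exact Or.inl ⟨u.length, H.unique (by
      simpa using isCentralOf_replicate a u.length)⟩
  by_cases hB : h = (a + 1) * l - 1
  · rw [hB, hl2] at H
    exact Or.inr (Or.inl ⟨u.length, H.unique (by
      simpa using isCentralOf_replicate_succ a u.length)⟩)
  refine Or.inr (Or.inr ?_)
  obtain ⟨hl, hcop, h1, h2, H5⟩ := H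
  -- The inverse of `h` modulo `l` is the denominator `l₁` of the left Farey parent. The right
  -- parent has denominator `l - l₁`, written `l₂ + 1` below.
  obtain ⟨x, y, hxy⟩ := hcop
  have hlz : (0 : ℤ) < l := by omega
  have e1 := Int.emod_add_mul_ediv x l
  have e2 := Int.emod_nonneg x hlz.ne'
  have e3 := Int.emod_lt_of_pos x hlz
  obtain ⟨l₁, hl₁⟩ := Int.eq_ofNat_of_zero_le e2
  rw [hl₁] at e1 e3
  obtain ⟨h₁, d1⟩ : ∃ h₁ : ℤ, l₁ * h - h₁ * l = 1 :=
    ⟨-(y + x / (l : ℤ) * h), by linear_combination hxy + h * e1⟩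
  have hl₁l : l₁ < l := by exact_mod_cast e3
  obtain ⟨l₂, rfl⟩ := Nat.exists_eq_add_of_lt hl₁l
  have hl₁0 : 0 < l₁ := by
    rcases Nat.eq_zero_or_pos l₁ with rfl | h0
    · have : ((0 + l₂ + 1 : ℕ) : ℤ) ∣ 1 := ⟨-h₁, by push_cast at d1 ⊢; linarith⟩
      have := Int.le_of_dvd one_pos this
      omega
    · exact h0
  obtain ⟨h₂, rfl⟩ : ∃ h₂, h = h₁ + h₂ := ⟨h - h₁, by ring⟩
  push_cast at *
  -- Equality would force `l₁ = 1`, so that `u` is a power of `a`; `hA` excludes this.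
  -- Symmetrically, `hB` is needed for the upper bound on `h₂`.
  have a1 : a * l₁ < h₁ := by
    by_contra hc
    have hz : (1 : ℤ) ≤ l₁ := by exact_mod_cast hl₁0
    rcases lt_or_eq_of_le (not_lt.1 hc) with hc | hc
    · have : h₁ + 1 ≤ a * l₁ := hc
      nlinarith
    · rw [hc] at d1
      have h5 : l₁ * (a * l₁ + h₂ - a * (l₁ + l₂ + 1)) = (1 : ℤ) := by linarith
      have h6 : (l₁ : ℤ) ∣ 1 := ⟨_, h5.symm⟩
      have h7 : (l₁ : ℤ) = 1 := Int.eq_one_of_dvd_one (by positivity) h6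
      rw [h7] at h5
      apply hA; rw [hc, h7]; linarith
  have d2 : l₁ * h₂ - h₁ * (l₂ + 1) = 1 := by linarith
  have b1 : h₁ < (a + 1) * l₁ := by
    by_contra hc
    have hz : (1 : ℤ) ≤ l₁ := by exact_mod_cast hl₁0
    nlinarith
  have a2 : a * (l₂ + 1) < h₂ := by
    by_contra hc
    have hz : (1 : ℤ) ≤ l₁ := by exact_mod_cast hl₁0
    have hz2 : (0 : ℤ) ≤ l₂ := by positivity
    nlinarith
  have b2 : h₂ < (a + 1) * (l₂ + 1) := by
    by_contra hc
    have hz : (1 : ℤ) ≤ l₁ := by exact_mod_cast hl₁0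
    rcases lt_or_eq_of_le (not_lt.1 hc) with hc | hc
    · have : (a + 1) * (l₂ + 1) + 1 ≤ h₂ := hc
      nlinarith
    · rw [← hc] at d2
      have h5 : (l₂ + 1) * ((a + 1) * l₁ - h₁) = (1 : ℤ) := by linarith
      have h6 : (l₂ + 1 : ℤ) ∣ 1 := ⟨_, h5.symm⟩
      have h7 : (l₂ + 1 : ℤ) = 1 := Int.eq_one_of_dvd_one (by positivity) h6
      rw [h7] at h5 hc
      apply hB; rw [← hc]; linarith
  obtain ⟨q, Hq⟩ := exists_isCentralOf (a := a) (h := h₁) (l := l₁)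
    ⟨-(l₂ + 1), h₂, by linarith⟩ a1 b1
  obtain ⟨p, Hp⟩ := exists_isCentralOf (a := a) (h := h₂) (l := l₂ + 1)
    ⟨l₁, -h₁, by push_cast; linarith⟩ (by push_cast; exact a2) (by push_cast; exact b2)
  obtain ⟨Hm, hm⟩ := Hq.mediant Hp (by push_cast; exact d2)
  have hu : u = q ++ [a + 1, a] ++ p := by
    refine IsCentralOf.unique ?_ Hm
    exact ⟨by omega, Hm.2.1, Hm.2.2.1, Hm.2.2.2.1, by simpa [add_assoc] using H5⟩
  exact ⟨p, q, ⟨_, _, Hp⟩, ⟨_, _, Hq⟩, by rw [hu, hm], hu⟩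

/-- The slopes of the two factors of a central word are Farey neighbours. -/
theorem IsCentralOf.det_eq_one {u : List ℤ} {h : ℤ} {l : ℕ} (H : IsCentralOf a u h l)
    (Hq : IsCentralOf a q h₁ l₁) (Hp : IsCentralOf a p h₂ l₂)
    (hu : u = p ++ [a, a + 1] ++ q) (hu' : u = q ++ [a + 1, a] ++ p) :
    l = l₁ + l₂ ∧ h = h₁ + h₂ ∧ l₁ * h₂ - h₁ * l₂ = 1 := by
  have hl : l = l₁ + l₂ := by
    rw [H.length_eq, Hq.length_eq, Hp.length_eq, hu]; simp; omega
  subst hl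
  have hL : block (lowerMech ((h : ℝ) / (l₁ + l₂ : ℕ)) 0) 0 (l₁ + l₂) =
      block (lowerMech ((h₁ : ℝ) / l₁) 0) 0 l₁ ++ block (lowerMech ((h₂ : ℝ) / l₂) 0) 0 l₂ := by
    rw [← H.2.2.2.2, ← Hq.2.2.2.2, ← Hp.2.2.2.2, hu']; simp
  have hU : block (upperMech ((h : ℝ) / (l₁ + l₂ : ℕ)) 0) 0 (l₁ + l₂) =
      block (upperMech ((h₂ : ℝ) / l₂) 0) 0 l₂ ++ block (upperMech ((h₁ : ℝ) / l₁) 0) 0 l₁ := by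
    rw [← H.upper, ← Hq.upper, ← Hp.upper, hu]; simp
  rw [block_inj (length_block _ _ _), zero_add] at hL
  rw [add_comm l₁ l₂, block_inj (length_block _ _ _), zero_add, add_comm l₂ l₁] at hU
  have f0 : ⌊(h : ℝ) / (l₁ + l₂ : ℕ) * l₁⌋ = h₁ := by
    have := psum_eq_of_block_eq hL.1 le_rfl
    rwa [psum_lowerMech, psum_lowerMech, floor_slope_self _ Hq.1] at this
  have f1 : ∀ m ≤ l₂, ⌊(h : ℝ) / (l₁ + l₂ : ℕ) * (l₁ + m : ℕ)⌋ = h₁ + ⌊(h₂ : ℝ) / l₂ * m⌋ := by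
    intro m hm
    have := psum_add_of_block_eq hL.2 hm
    rwa [psum_lowerMech, psum_lowerMech, psum_lowerMech, f0] at this
  have c0 : ⌈(h : ℝ) / (l₁ + l₂ : ℕ) * l₂⌉ = h₂ := by
    have := psum_eq_of_block_eq hU.1 le_rfl
    rwa [psum_upperMech, psum_upperMech, ceil_slope_self _ Hp.1] at this
  have c1 : ∀ m ≤ l₁, ⌈(h : ℝ) / (l₁ + l₂ : ℕ) * (l₂ + m : ℕ)⌉ = h₂ + ⌈(h₁ : ℝ) / l₁ * m⌉ := by
    intro m hm
    have := psum_add_of_block_eq hU.2 hm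
    rwa [psum_upperMech, psum_upperMech, psum_upperMech, c0] at this
  have hh : h = h₁ + h₂ := by
    have := f1 l₂ le_rfl
    rwa [floor_slope_self _ Hp.1, floor_slope_self _ (by have := Hp.1; omega)] at this
  refine ⟨rfl, hh, ?_⟩
  -- the prefixes of `u` that are shared with the two factors
  have f2 : ∀ m < l₂, ⌊(h : ℝ) / (l₁ + l₂ : ℕ) * m⌋ = ⌊(h₂ : ℝ) / l₂ * m⌋ := by
    intro m hm
    rw [← psum_lowerMech, ← psum_lowerMech]
    refine psum_eq_of_block_eq (n := p.length + 1) ?_ (by have := Hp.length_eq; omega)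
    rw [block_succ, block_succ, lowerMech_zero, lowerMech_zero, H.floor_eq, Hp.floor_eq]
    have h1 := H.lower_prefix.1
    have h2 := Hp.lower_prefix.1
    rw [block_shift] at h1 h2
    have h3 : u.length = p.length + (q.length + 2) := by rw [hu]; simp
    rw [h3] at h1
    have h4 : p ++ [a, a + 1] ++ q = p ++ ([a, a + 1] ++ q) := by simp
    rw [hu, h4, block_inj rfl] at h1
    rw [h1.1, h2]
  have c2 : ∀ m < l₁, ⌈(h : ℝ) / (l₁ + l₂ : ℕ) * m⌉ = ⌈(h₁ : ℝ) / l₁ * m⌉ := by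
    intro m hm
    rw [← psum_upperMech, ← psum_upperMech]
    refine psum_eq_of_block_eq (n := q.length + 1) ?_ (by have := Hq.length_eq; omega)
    rw [block_succ, block_succ, upperMech_zero, upperMech_zero, H.ceil_eq, Hq.ceil_eq]
    have h1 := H.upper_prefix.1
    have h2 := Hq.upper_prefix.1
    rw [block_shift] at h1 h2
    have h3 : u.length = q.length + (p.length + 2) := by rw [hu']; simp
    rw [h3] at h1
    have h4 : q ++ [a + 1, a] ++ p = q ++ ([a + 1, a] ++ p) := by simp
    rw [hu', h4, block_inj rfl] at h1
    rw [h1.1, h2]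
  have hl0 := H.1
  have hz₁ : (0 : ℤ) < l₁ := by exact_mod_cast Hq.1
  have hz₂ : (0 : ℤ) < l₂ := by exact_mod_cast Hp.1
  have hr := (floor_slope_iff hl0).1 f0
  push_cast at hr
  set r := l₁ * h₂ - h₁ * l₂ with hr_def
  have hr0 : 0 ≤ r := by rw [hh] at hr; linarith
  have hrl : r < l₁ + l₂ := by rw [hh] at hr; linarith
  have hcop := H.2.1
  have hr1 : 1 ≤ r := by
    by_contra hc
    have hc0 : r = 0 := by omega
    have hd : ((l₁ + l₂ : ℕ) : ℤ) ∣ l₁ :=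
      hcop.symm.dvd_of_dvd_mul_left ⟨h₁, by rw [hh]; push_cast; linarith⟩
    have := Int.le_of_dvd hz₁ hd
    push_cast at this; linarith
  -- Let `m'` be the inverse of `h` modulo `L`. If `m' < l₁`, the remainder `1` at `m'` is too
  -- small: passing to `l₂ + m'` subtracts `r ≥ 1` and contradicts the ceilings. The floors at `L -
  -- m'` exclude `m' > l₁`. So `m' = l₁`, hence `r` is `1` modulo `L`, and `1 ≤ r < L`.
  obtain ⟨x, y, hxy⟩ := hcop
  set L : ℤ := ((l₁ + l₂ : ℕ) : ℤ) with hL_def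
  have hLe : L = l₁ + l₂ := by rw [hL_def]; push_cast; ring
  have e1 := Int.emod_add_mul_ediv x L
  have e2 := Int.emod_nonneg x (show L ≠ 0 by omega)
  have e3 := Int.emod_lt_of_pos x (show 0 < L by omega)
  obtain ⟨m', hm'⟩ := Int.eq_ofNat_of_zero_le e2
  rw [hm'] at e1 e3
  obtain ⟨K, hK⟩ : ∃ K, h * m' = K * L + 1 := ⟨-(y + h * (x / L)), by
    linear_combination hxy + h * e1⟩
  have hlt : m' < l₁ + l₂ := by
    have : (m' : ℤ) < ((l₁ + l₂ : ℕ) : ℤ) := e3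
    exact_mod_cast this
  have ge1 : l₁ ≤ m' := by
    by_contra hc
    have h1 : ⌈(h : ℝ) / (l₁ + l₂ : ℕ) * m'⌉ = K + 1 := by
      rw [ceil_slope_iff hl0, ← hL_def]; constructor <;> linarith
    have h2 := c1 m' (by omega)
    rw [← c2 m' (by omega), h1, ceil_slope_iff hl0, ← hL_def] at h2
    have h3 := h2.2
    have h4 := h2.1
    push_cast at h3 h4
    rw [hh] at h3 h4 hK
    rw [hLe] at h3 h4 hK
    linarith
  have ge2 : l₂ ≤ l₁ + l₂ - m' := by
    by_contra hc
    obtain ⟨m, hm⟩ : ∃ m, m + m' = l₁ + l₂ := ⟨l₁ + l₂ - m', by omega⟩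
    have hmz : (m : ℤ) = L - m' := by rw [hLe]; have : (m : ℤ) + m' = l₁ + l₂ := by exact_mod_cast hm
                                      linarith
    have h1 : ⌊(h : ℝ) / (l₁ + l₂ : ℕ) * m⌋ = h - K - 1 := by
      rw [floor_slope_iff hl0, ← hL_def, hmz]; constructor <;> nlinarith
    have h2 := f1 m (by omega)
    rw [← f2 m (by omega), h1, floor_slope_iff hl0, ← hL_def] at h2
    have h3 := h2.2
    have h4 := h2.1
    push_cast at h3 h4
    rw [hmz] at h3 h4
    rw [hh] at h3 h4 hK
    rw [hLe] at h3 h4 hK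
    linarith
  have hm1 : m' = l₁ := by omega
  subst hm1
  have hdvd : L ∣ r - 1 := ⟨K - h₁, by rw [hh] at hK; rw [hr_def, hLe] at *; linarith⟩
  have := Int.eq_zero_of_dvd_of_nonneg_of_lt (by omega) (by omega) hdvd
  omega

end Mediant

/-! ### Sharp slopes and the special rules. -/

/-- `φ` is the largest slope whose upper mechanical word is at most `d`. -/
def IsSharpSlope (d : ℕ → ℤ) (φ : ℝ) : Prop :=
  ∀ α : ℝ, 0 < α → (toLex (upperMech α 0) ≤ toLex d ↔ α ≤ φ)

theorem IsSharpSlope.unique {d : ℕ → ℤ} {φ ψ : ℝ} (hφ : IsSharpSlope d φ) (hψ : IsSharpSlope d ψ)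
    (h0 : 0 ≤ φ) (h0' : 0 ≤ ψ) : φ = ψ := by
  rcases lt_trichotomy φ ψ with h | h | h
  · exact absurd ((hφ ψ (by linarith)).1 ((hψ ψ (by linarith)).2 le_rfl)) (not_le.2 h)
  · exact h
  · exact absurd ((hψ φ (by linarith)).1 ((hφ φ (by linarith)).2 le_rfl)) (not_le.2 h)

theorem isSharpSlope_of {d : ℕ → ℤ} {φ : ℝ}
    (h1 : ∀ α ≤ φ, 0 < α → toLex (upperMech α 0) ≤ toLex d)
    (h2 : ∀ α, φ < α → toLex d < toLex (upperMech α 0)) : IsSharpSlope d φ := fun α hα =>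
  ⟨fun h => not_lt.1 fun h' => absurd (h2 α h') (not_lt.2 h), fun h => h1 α h hα⟩

theorem upperMech_intCast (m : ℤ) : upperMech m 0 = fun _ => m := eq_of_psum fun n => by
  rw [psum_const, psum_upperMech, ← Int.cast_natCast (R := ℝ), ← Int.cast_mul, Int.ceil_intCast,
    mul_comm]

theorem lowerMech_intCast (m : ℤ) : lowerMech m 0 = fun _ => m := eq_of_psum fun n => by
  rw [psum_const, psum_lowerMech, ← Int.cast_natCast (R := ℝ), ← Int.cast_mul, Int.floor_intCast,
    mul_comm]

theorem isSharpSlope_const (m : ℤ) : IsSharpSlope (fun _ => m) m := by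
  refine isSharpSlope_of (fun α hα _ => lex_le_of_psum fun n => ?_) fun α hα => ?_
  · rw [psum_upperMech, psum_const, Int.ceil_le]
    push_cast; rw [mul_comm]; gcongr
  · rw [← upperMech_intCast]; exact upperMech_strictMono hα

section Slopes

variable {a : ℤ} {s : ℕ → ℤ} {φ : ℝ}

theorem upperMech_le_cons (h1 : a < φ) (h2 : φ ≤ a + 1)
    (hU : toLex (shift (upperMech φ 0) 1) ≤ toLex s) {α : ℝ} (hα : α ≤ φ) :
    toLex (upperMech α 0) ≤ toLex (cons (a + 1) s) := by
  refine (upperMech_mono hα).trans ?_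
  have h0 : upperMech φ 0 0 = a + 1 := by
    rw [upperMech_zero, Int.ceil_eq_iff]; push_cast; exact ⟨by linarith, h2⟩
  rw [← cons_shift (upperMech φ 0), h0]
  exact cons_le_cons_iff.2 hU

/-- For `n ≥ 1` the word formed by `a + 1` and the tail of `lowerMech φ 0` has partial sums `⌊φ n⌋ +
1`. It is the limit of the upper mechanical words of slopes decreasing to `φ`, and lies below all of
them. -/
theorem cons_lt_upperMech (h1 : a ≤ φ) (h2 : φ < a + 1)
    (hV : toLex s ≤ toLex (shift (lowerMech φ 0) 1)) {α : ℝ} (hα : φ < α) :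
    toLex (cons (a + 1) s) < toLex (upperMech α 0) := by
  have h0 : lowerMech φ 0 0 = a := by
    rw [lowerMech_zero, Int.floor_eq_iff]; exact ⟨h1, h2⟩
  refine lt_of_le_of_lt (cons_le_cons_iff.2 hV) ?_
  have key : ∀ n : ℕ, psum (cons (a + 1) (shift (lowerMech φ 0) 1)) (n + 1) =
      ⌊φ * (n + 1 : ℕ)⌋ + 1 := by
    intro n
    rw [psum_cons_succ, psum_shift, psum_lowerMech]
    simp [psum, h0]
    ring
  refine lex_lt_of_psum (fun n => ?_) ?_
  · cases n with
    | zero => simp [psum_zero]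
    | succ n =>
      rw [key, psum_upperMech]
      exact floor_add_one_le_ceil hα n.succ_pos
  · obtain ⟨n, hn, h⟩ := exists_floor_add_two_le hα
    obtain ⟨n, rfl⟩ := Nat.exists_eq_succ_of_ne_zero hn.ne'
    exact ⟨n + 1, by rw [key, psum_upperMech]; exact h⟩

theorem isSharpSlope_of_between (h1 : a < φ) (h2 : φ < a + 1)
    (hU : toLex (shift (upperMech φ 0) 1) ≤ toLex s)
    (hV : toLex s ≤ toLex (shift (lowerMech φ 0) 1)) : IsSharpSlope (cons (a + 1) s) φ :=
  isSharpSlope_of (fun _ hα _ => upperMech_le_cons h1 h2.le hU hα)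
    fun _ hα => cons_lt_upperMech h1.le h2 hV hα

theorem shift_upperMech_le_shift_lowerMech (h1 : a < φ) (h2 : φ < a + 1) :
    toLex (shift (upperMech φ 0) 1) ≤ toLex (shift (lowerMech φ 0) 1) := by
  refine lex_le_of_psum fun n => ?_
  have hc : psum (upperMech φ 0) 1 = a + 1 := by
    rw [psum_upperMech, Int.ceil_eq_iff]; push_cast; constructor <;> linarith
  have hf : psum (lowerMech φ 0) 1 = a := by
    rw [psum_lowerMech, Int.floor_eq_iff]; push_cast; constructor <;> linarith
  rw [psum_shift, psum_shift, hc, hf, psum_upperMech, psum_lowerMech]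
  linarith [Int.ceil_le_floor_add_one (φ * (n + 1 : ℕ))]

/-- The mechanical rules describe the two endpoints of the interval of words of sharp slope `φ`; for
`φ = a` and `φ = a + 1` they reduce to the constant cases. -/
theorem MeagerFreq.isSharpSlope (h : MeagerFreq a s φ) :
    (a : ℝ) ≤ φ ∧ IsSharpSlope (cons (a + 1) s) φ := by
  have hlow : toLex s ≤ toLex (fun _ => a) → IsSharpSlope (cons (a + 1) s) a := by
    intro h
    refine isSharpSlope_of (fun α hα _ => ?_) fun α hα => ?_
    · refine le_of_lt (lex_lt_head.2 (Or.inl ?_))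
      rw [upperMech_zero]
      have := Int.ceil_le.2 hα
      simp only [cons]; linarith
    · refine cons_lt_upperMech le_rfl (by linarith) ?_ hα
      rw [lowerMech_intCast]; exact h
  have hhigh : toLex (fun _ => a + 1) ≤ toLex s → IsSharpSlope (cons (a + 1) s) (a + 1) := by
    intro h
    refine isSharpSlope_of (fun α hα _ => ?_) fun α hα => ?_
    · refine upperMech_le_cons (φ := a + 1) (by linarith) le_rfl ?_ hα
      have := upperMech_intCast (a + 1)
      push_cast at this
      rw [this]; exact h
    · refine lex_lt_head.2 (Or.inl ?_)
      rw [upperMech_zero]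
      exact Int.lt_ceil.2 (by simpa [cons] using hα)
  cases h with
  | low h => exact ⟨le_rfl, hlow h⟩
  | high h => exact ⟨by linarith, hhigh h⟩
  | mech _ hα h =>
    refine ⟨hα.1, ?_⟩
    rcases h with h | h
    · have hs : s = shift (lowerMech φ 0) 1 := by rw [← h]; rfl
      have h0 : ⌊φ⌋ = a := by rw [← lowerMech_zero, ← h]; rfl
      have h1 := (Int.floor_eq_iff.1 h0).2
      rcases hα.1.lt_or_eq with h2 | h2
      · refine isSharpSlope_of_between h2 h1 ?_ (by rw [← hs])
        rw [hs]; exact shift_upperMech_le_shift_lowerMech h2 h1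
      · subst h2
        refine hlow (le_of_eq ?_)
        rw [hs]
        rw [lowerMech_intCast]; rfl
    · have hs : s = shift (upperMech φ 0) 1 := by rw [← h]; rfl
      have h0 : ⌈φ⌉ = a + 1 := by rw [← upperMech_zero, ← h]; rfl
      have h1 := (Int.ceil_eq_iff.1 h0).1
      push_cast at h1
      rcases hα.2.lt_or_eq with h2 | h2
      · refine isSharpSlope_of_between (by linarith) h2 (by rw [← hs]) ?_
        rw [hs]; exact shift_upperMech_le_shift_lowerMech (by linarith) h2
      · subst h2
        refine hhigh (le_of_eq ?_)
        rw [hs]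
        have := upperMech_intCast (a + 1)
        push_cast at this
        rw [this]; rfl

end Slopes

/-! ### Plateaus: soundness of the generic rules. -/

/-- `s` lies between the two words that bound the words of sharp slope `h / l`. -/
def InPlateau (s : ℕ → ℤ) (h : ℤ) (l : ℕ) : Prop :=
  toLex (shift (upperMech ((h : ℝ) / l) 0) 1) < toLex s ∧
    toLex s < toLex (shift (lowerMech ((h : ℝ) / l) 0) 1)

theorem lt_swap (a : ℤ) : [a, a + 1] < [a + 1, a] := by
  rw [List.cons_lt_cons_iff]; exact Or.inl (by omega)

section Generic

variable {a : ℤ} {s : ℕ → ℤ} {u : List ℤ}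

theorem IsLongestCentralPrefix.not_prefix (hL : IsLongestCentralPrefix a s u) {w : List ℤ} {n : ℕ}
    (hw : IsCentral a w) (hlen : u.length < w.length) (hn : w.length = n) : block s 0 n ≠ w :=
  fun h => absurd (hL.2 w hw (by rw [hn]; exact h)) (by omega)

theorem block_prefix_mid {p m q : List ℤ} {c d : ℤ} (hm : m = [c, d])
    (h : block s 0 (p ++ m ++ q).length = p ++ m ++ q) :
    block s 0 p.length = p ∧ block s p.length 2 = [c, d] := by
  subst hm
  have h1 : (p ++ [c, d] ++ q).length = p.length + (2 + q.length) := by simp; omega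
  rw [h1, List.append_assoc, block_inj rfl, zero_add,
    block_inj (x := [c, d]) (m := 2) rfl] at h
  exact ⟨h.1, h.2.1⟩

/-- The endpoints are `(u a b)^ω` and `(u b a)^ω`. Both share `u` with `s`, so `xy` decides, or else
the next period `v`. -/
theorem inPlateau_self {h : ℤ} {l : ℕ} (H : IsCentralOf a u h l) (hu : block s 0 u.length = u)
    {xy v : List ℤ} (hxy : xy = block s u.length 2)
    (hv : v = block s (u.length + 2) (u.length + 2))
    (hc : (xy = [a, a + 1] ∧ u ++ [a, a + 1] < v) ∨ ([a, a + 1] < xy ∧ xy < [a + 1, a]) ∨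
      (xy = [a + 1, a] ∧ v < u ++ [a + 1, a])) : InPlateau s h l := by
  have hU := H.upper_prefix
  have hV := H.lower_prefix
  have hlU : [a, a + 1] < xy → toLex (shift (upperMech ((h : ℝ) / l) 0) 1) < toLex s := fun h =>
    lex_lt_of_prefix (hU.1.trans hu.symm) (by rw [hU.2, ← hxy]; exact h)
  have hlV : xy < [a + 1, a] → toLex s < toLex (shift (lowerMech ((h : ℝ) / l) 0) 1) := fun h =>
    lex_lt_of_prefix (hu.trans hV.1.symm) (by rw [hV.2, ← hxy]; exact h)
  rcases hc with ⟨h1, h2⟩ | ⟨h1, h2⟩ | ⟨h1, h2⟩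
  · refine ⟨lex_lt_of_prefix (n := u.length + 2) (m := u.length + 2) ?_ ?_,
      hlV (by rw [h1]; exact lt_swap a)⟩
    · rw [block_add, block_add, hU.1, hu, zero_add, hU.2, ← hxy, h1]
    · rw [H.block_upper', ← hv]; exact h2
  · exact ⟨hlU h1, hlV h2⟩
  · refine ⟨hlU (by rw [h1]; exact lt_swap a),
      lex_lt_of_prefix (n := u.length + 2) (m := u.length + 2) ?_ ?_⟩
    · rw [block_add, block_add, hV.1, hu, zero_add, hV.2, ← hxy, h1]
    · rw [H.block_lower', ← hv]; exact h2

/-- As `s` begins with `q b a`, it exceeds `(q a b)^ω`. The upper endpoint `(q b a)^ω` begins with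
`u a b q`, the central word of the mediant of `q` and `u`. Maximality of `u` forbids this prefix in
`s`, so the comparison with `v` is strict already on the length of `q`. -/
theorem inPlateau_left (hL : IsLongestCentralPrefix a s u) {p q xy v : List ℤ}
    {h₁ h₂ : ℤ} {l₁ l₂ : ℕ} (Hp : IsCentralOf a p h₂ l₂) (Hq : IsCentralOf a q h₁ l₁)
    (hu : u = p ++ [a, a + 1] ++ q) (hu' : u = q ++ [a + 1, a] ++ p)
    (hxy : xy = block s u.length 2) (hv : v = block s (u.length + 2) (u.length + 2))
    (hc : (xy = [a, a + 1] ∧ v < u ++ [a, a + 1]) ∨ xy < [a, a + 1]) : InPlateau s h₁ l₁ := by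
  obtain ⟨⟨h, l, H⟩, hpre⟩ := hL.1
  obtain ⟨rfl, rfl, det⟩ := IsCentralOf.det_eq_one H Hq Hp hu hu'
  have hqs : block s 0 q.length = q ∧ block s q.length 2 = [a + 1, a] :=
    block_prefix_mid (q := p) rfl (by rw [← hu']; exact hpre)
  refine ⟨lex_lt_of_prefix (m := 2) (Hq.upper_prefix.1.trans hqs.1.symm) ?_, ?_⟩
  · rw [Hq.upper_prefix.2, hqs.2]; exact lt_swap a
  have det' : l₁ * (h₁ + h₂) - h₁ * ((l₁ + l₂ : ℕ) : ℤ) = 1 := by push_cast; linarith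
  obtain ⟨Hm, hm⟩ := IsCentralOf.mediant Hq H det'
  have hpref := IsCentralOf.lower_prefix_mediant Hq.1 Hm det'
  rw [← hm] at hpref Hm
  have hlen : (u ++ [a, a + 1] ++ q).length = u.length + (2 + q.length) := by simp; omega
  have hpref' := hpref
  rw [hlen, List.append_assoc, block_inj rfl, zero_add,
    block_inj (m := 2) rfl] at hpref'
  obtain ⟨e1, e2, e3⟩ := hpref'
  rcases hc with ⟨h1, h2⟩ | h1
  · refine lex_lt_of_prefix (n := u.length + 2) (m := q.length) ?_ ?_
    · rw [block_add, block_add, e1, hpre, zero_add, e2, ← hxy, h1]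
    · rw [e3]
      have hlu : u.length + 2 = q.length + (p.length + 4) := by rw [hu']; simp; omega
      rw [show block s (u.length + 2) (u.length + 2) =
        block s (u.length + 2) (q.length + (p.length + 4)) by rw [← hlu], block_add] at hv
      have hq' : u ++ [a, a + 1] = q ++ ([a + 1, a] ++ p ++ [a, a + 1]) := by rw [hu']; simp
      rw [hv, hq'] at h2
      refine lt_of_append_lt_append (by rw [length_block]) (fun he => ?_) h2
      refine hL.not_prefix ⟨_, _, Hm⟩ (by omega) hlen ?_
      rw [List.append_assoc, block_inj rfl, zero_add, block_inj (m := 2) rfl]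
      exact ⟨hpre, by rw [← hxy, h1], he⟩
  · exact lex_lt_of_prefix (hpre.trans e1.symm) (by rw [e2, ← hxy]; exact h1)

/-- Mirror image: the lower endpoint `(p a b)^ω` begins with the central word `u b a p`, which
cannot be a prefix of `s`. -/
theorem inPlateau_right (hL : IsLongestCentralPrefix a s u) {p q xy v : List ℤ}
    {h₁ h₂ : ℤ} {l₁ l₂ : ℕ} (Hp : IsCentralOf a p h₂ l₂) (Hq : IsCentralOf a q h₁ l₁)
    (hu : u = p ++ [a, a + 1] ++ q) (hu' : u = q ++ [a + 1, a] ++ p)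
    (hxy : xy = block s u.length 2) (hv : v = block s (u.length + 2) (u.length + 2))
    (hc : (xy = [a + 1, a] ∧ u ++ [a + 1, a] < v) ∨ [a + 1, a] < xy) : InPlateau s h₂ l₂ := by
  obtain ⟨⟨h, l, H⟩, hpre⟩ := hL.1
  obtain ⟨rfl, rfl, det⟩ := IsCentralOf.det_eq_one H Hq Hp hu hu'
  have hps : block s 0 p.length = p ∧ block s p.length 2 = [a, a + 1] :=
    block_prefix_mid (q := q) rfl (by rw [← hu]; exact hpre)
  refine ⟨?_, lex_lt_of_prefix (m := 2) (hps.1.trans Hp.lower_prefix.1.symm) ?_⟩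
  swap
  · rw [Hp.lower_prefix.2, hps.2]; exact lt_swap a
  have det' : ((l₁ + l₂ : ℕ) : ℤ) * h₂ - (h₁ + h₂) * l₂ = 1 := by push_cast; linarith
  obtain ⟨Hm, -⟩ := IsCentralOf.mediant H Hp det'
  have hpref := IsCentralOf.upper_prefix_mediant Hp.1 Hm det'
  have hlen : (u ++ [a + 1, a] ++ p).length = u.length + (2 + p.length) := by simp; omega
  have hpref' := hpref
  rw [hlen, List.append_assoc, block_inj rfl, zero_add,
    block_inj (m := 2) rfl] at hpref'
  obtain ⟨e1, e2, e3⟩ := hpref'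
  rcases hc with ⟨h1, h2⟩ | h1
  · refine lex_lt_of_prefix (n := u.length + 2) (m := p.length) ?_ ?_
    · rw [block_add, block_add, e1, hpre, zero_add, e2, ← hxy, h1]
    · rw [e3]
      have hlu : u.length + 2 = p.length + (q.length + 4) := by rw [hu]; simp; omega
      rw [show block s (u.length + 2) (u.length + 2) =
        block s (u.length + 2) (p.length + (q.length + 4)) by rw [← hlu], block_add] at hv
      have hp' : u ++ [a + 1, a] = p ++ ([a, a + 1] ++ q ++ [a + 1, a]) := by rw [hu]; simp
      rw [hv, hp'] at h2
      refine lt_of_append_lt_append (by rw [length_block]) (fun he => ?_) h2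
      refine hL.not_prefix ⟨_, _, Hm⟩ (by omega) hlen ?_
      rw [List.append_assoc, block_inj rfl, zero_add, block_inj (m := 2) rfl]
      exact ⟨hpre, by rw [← hxy, h1], he.symm⟩
  · exact lex_lt_of_prefix (e1.trans hpre.symm) (by rw [e2, ← hxy]; exact h1)

/-- Excludes `v = b a^k` for `u = a^k`, the equality that the rules do not mention. -/
theorem isCentral_replicate_mid (a : ℤ) (j : ℕ) :
    IsCentral a (List.replicate (j + 1) a ++ (a + 1) :: List.replicate (j + 1) a) := by
  have h := ((isCentralOf_replicate a (j + 1)).mediant (isCentralOf_replicate a j)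
    (by push_cast; ring)).1
  have e : List.replicate (j + 1) a ++ [a + 1, a] ++ List.replicate j a =
      List.replicate (j + 1) a ++ (a + 1) :: List.replicate (j + 1) a := by
    simp [List.replicate_succ]
  rw [e] at h
  exact ⟨_, _, h⟩

theorem isCentral_replicate_succ_mid (a : ℤ) (j : ℕ) :
    IsCentral a (List.replicate (j + 1) (a + 1) ++ a :: List.replicate (j + 1) (a + 1)) := by
  have h := ((isCentralOf_replicate_succ a j).mediant (isCentralOf_replicate_succ a (j + 1))
    (by push_cast; ring)).1
  have e : List.replicate j (a + 1) ++ [a + 1, a] ++ List.replicate (j + 1) (a + 1) =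
      List.replicate (j + 1) (a + 1) ++ a :: List.replicate (j + 1) (a + 1) := by
    rw [List.replicate_succ' (n := j)]; simp
  rw [e] at h
  exact ⟨_, _, h⟩

theorem IsLongestCentralPrefix.ne_of_replicate {k : ℕ} {c : ℤ}
    (hL : IsLongestCentralPrefix a s (List.replicate k c)) (hc : c = a ∨ c = a + 1) :
    s k ≠ c := by
  intro h
  have hcen : IsCentral a (List.replicate (k + 1) c) := by
    rcases hc with rfl | rfl
    · exact ⟨_, _, isCentralOf_replicate _ _⟩
    · exact ⟨_, _, isCentralOf_replicate_succ _ _⟩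
  refine hL.not_prefix hcen (by simp) (List.length_replicate ..) ?_
  have h1 := hL.1.2
  rw [List.length_replicate] at h1
  rw [block_add, h1, zero_add, block_one, h, List.replicate_succ']

theorem upper_prefix_replicate (a : ℤ) (j : ℕ) :
    block (shift (upperMech (((a * (j + 2) + 1 : ℤ) : ℝ) / (j + 2 : ℕ)) 0) 1) 0 (j + 1) =
      List.replicate (j + 1) a ∧
    block (shift (upperMech (((a * (j + 2) + 1 : ℤ) : ℝ) / (j + 2 : ℕ)) 0) 1) (j + 1) (j + 2) =
      (a + 1) :: List.replicate (j + 1) a := by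
  have H := isCentralOf_replicate a j
  have h1 := H.block_upper
  have h2 := H.block_upper'
  rw [List.length_replicate] at h2
  have h3 : block (shift (upperMech (((a * (j + 2) + 1 : ℤ) : ℝ) / (j + 2 : ℕ)) 0) 1) 0
      ((j + 1) + ((j + 2) + 1)) = List.replicate (j + 1) a ++
        (((a + 1) :: List.replicate (j + 1) a) ++ [a + 1]) := by
    rw [show (j + 1) + ((j + 2) + 1) = (j + 2) + (j + 2) by omega, block_add, h1, zero_add, h2,
      List.replicate_succ' (n := j)]
    simp
  rw [block_inj (by simp), zero_add, block_inj (by simp)] at h3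
  exact ⟨h3.1, h3.2.1⟩

theorem lower_prefix_replicate_succ (a : ℤ) (j : ℕ) :
    block (shift (lowerMech ((((a + 1) * (j + 2) - 1 : ℤ) : ℝ) / (j + 2 : ℕ)) 0) 1) 0 (j + 1) =
      List.replicate (j + 1) (a + 1) ∧
    block (shift (lowerMech ((((a + 1) * (j + 2) - 1 : ℤ) : ℝ) / (j + 2 : ℕ)) 0) 1) (j + 1)
      (j + 2) = a :: List.replicate (j + 1) (a + 1) := by
  have H := isCentralOf_replicate_succ a j
  have h1 := H.block_lower
  have h2 := H.block_lower'
  rw [List.length_replicate] at h2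
  have h3 : block (shift (lowerMech ((((a + 1) * (j + 2) - 1 : ℤ) : ℝ) / (j + 2 : ℕ)) 0) 1) 0
      ((j + 1) + ((j + 2) + 1)) = List.replicate (j + 1) (a + 1) ++
        ((a :: List.replicate (j + 1) (a + 1)) ++ [a]) := by
    rw [show (j + 1) + ((j + 2) + 1) = (j + 2) + (j + 2) by omega, block_add, h1, zero_add, h2,
      List.replicate_succ' (n := j)]
    simp
  rw [block_inj (by simp), zero_add, block_inj (by simp)] at h3
  exact ⟨h3.1, h3.2.1⟩

theorem inPlateau_replicate {k : ℕ} (hL : IsLongestCentralPrefix a s (List.replicate k a))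
    (h1 : List.replicate (k + 1) a < block s k (k + 1))
    (h2 : block s k (k + 1) < (a + 1) :: List.replicate k a) :
    InPlateau s (a * (k + 2) + 1) (k + 2) := by
  have H := isCentralOf_replicate a k
  have hpre := hL.1.2
  have hU := H.upper_prefix
  have hV := H.lower_prefix
  rw [List.length_replicate] at hpre hU hV
  have hne := hL.ne_of_replicate (Or.inl rfl)
  refine ⟨lex_lt_of_prefix (hU.1.trans hpre.symm) (m := 2) ?_,
    lex_lt_of_prefix (hpre.trans hV.1.symm) (m := k + 1) ?_⟩
  · rw [block_succ, List.replicate_succ, List.cons_lt_cons_iff] at h1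
    rw [hU.2, block_two, List.cons_lt_cons_iff]
    exact Or.inl (h1.resolve_right fun h => hne h.1.symm)
  · have h3 := H.block_lower'
    rw [List.length_replicate] at h3
    have h4 : block (shift (lowerMech (((a * (k + 2) + 1 : ℤ) : ℝ) / (k + 2 : ℕ)) 0) 1) k
        (2 + (k + 2)) = [a + 1, a] ++ (List.replicate k a ++ [a + 1, a]) := by
      rw [block_inj (m := 2) rfl]; exact ⟨hV.2, h3⟩
    have h5 : block (shift (lowerMech (((a * (k + 2) + 1 : ℤ) : ℝ) / (k + 2 : ℕ)) 0) 1) k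
        ((k + 1) + 3) = ((a + 1) :: List.replicate k a) ++ [a, a + 1, a] := by
      rw [show (k + 1) + 3 = 2 + (k + 2) by omega, h4]
      have : a :: List.replicate k a = List.replicate k a ++ [a] := by
        rw [← List.replicate_succ, List.replicate_succ']
      calc _ = [a + 1] ++ (a :: List.replicate k a) ++ [a + 1, a] := by simp
        _ = _ := by rw [this]; simp
    rw [((block_inj (by simp)).1 h5).1]
    exact h2

/-- The plateau here belongs to the shorter power `a^j`, with endpoints `(a^(j+1) b)^ω` and `(a^j b
a)^ω`; the prefix `a^(j+1)` of `s` already lies below the second. -/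
theorem inPlateau_replicate_right {j : ℕ}
    (hpre : block s 0 (j + 1) = List.replicate (j + 1) a)
    (h1 : (a + 1) :: List.replicate (j + 1) a < block s (j + 1) (j + 2)) :
    InPlateau s (a * (j + 2) + 1) (j + 2) := by
  have hV := (isCentralOf_replicate a j).lower_prefix
  have hU := upper_prefix_replicate a j
  rw [List.length_replicate] at hV
  refine ⟨lex_lt_of_prefix (hU.1.trans hpre.symm) (by rw [hU.2]; exact h1), ?_⟩
  rw [List.replicate_succ', block_inj (by simp)] at hpre
  refine lex_lt_of_prefix (hpre.1.trans hV.1.symm) (m := 2) ?_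
  rw [block_one, zero_add, List.cons.injEq] at hpre
  rw [hV.2, block_two, hpre.2.1, List.cons_lt_cons_iff]
  exact Or.inl (by omega)

theorem inPlateau_replicate_succ {k : ℕ}
    (hL : IsLongestCentralPrefix a s (List.replicate k (a + 1)))
    (h1 : a :: List.replicate k (a + 1) < block s k (k + 1))
    (h2 : block s k (k + 1) < List.replicate (k + 1) (a + 1)) :
    InPlateau s ((a + 1) * (k + 2) - 1) (k + 2) := by
  have H := isCentralOf_replicate_succ a k
  have hpre := hL.1.2
  have hU := H.upper_prefix
  have hV := H.lower_prefix
  rw [List.length_replicate] at hpre hU hV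
  have hne := hL.ne_of_replicate (Or.inr rfl)
  refine ⟨lex_lt_of_prefix (hU.1.trans hpre.symm) (m := k + 1) ?_,
    lex_lt_of_prefix (hpre.trans hV.1.symm) (m := 2) ?_⟩
  · have h3 := H.block_upper'
    rw [List.length_replicate] at h3
    have h4 : block (shift (upperMech ((((a + 1) * (k + 2) - 1 : ℤ) : ℝ) / (k + 2 : ℕ)) 0) 1) k
        (2 + (k + 2)) = [a, a + 1] ++ (List.replicate k (a + 1) ++ [a, a + 1]) := by
      rw [block_inj (m := 2) rfl]; exact ⟨hU.2, h3⟩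
    have h5 : block (shift (upperMech ((((a + 1) * (k + 2) - 1 : ℤ) : ℝ) / (k + 2 : ℕ)) 0) 1) k
        ((k + 1) + 3) = (a :: List.replicate k (a + 1)) ++ [a + 1, a, a + 1] := by
      rw [show (k + 1) + 3 = 2 + (k + 2) by omega, h4]
      have : (a + 1) :: List.replicate k (a + 1) = List.replicate k (a + 1) ++ [a + 1] := by
        rw [← List.replicate_succ, List.replicate_succ']
      calc _ = [a] ++ ((a + 1) :: List.replicate k (a + 1)) ++ [a, a + 1] := by simp
        _ = _ := by rw [this]; simp
    rw [((block_inj (by simp)).1 h5).1]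
    exact h1
  · rw [block_succ, List.replicate_succ, List.cons_lt_cons_iff] at h2
    rw [hV.2, block_two, List.cons_lt_cons_iff]
    exact Or.inl (h2.resolve_right fun h => hne h.1)

theorem inPlateau_replicate_succ_left {j : ℕ}
    (hpre : block s 0 (j + 1) = List.replicate (j + 1) (a + 1))
    (h1 : block s (j + 1) (j + 2) < a :: List.replicate (j + 1) (a + 1)) :
    InPlateau s ((a + 1) * (j + 2) - 1) (j + 2) := by
  have hU := (isCentralOf_replicate_succ a j).upper_prefix
  have hV := lower_prefix_replicate_succ a j
  rw [List.length_replicate] at hU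
  refine ⟨?_, lex_lt_of_prefix (hpre.trans hV.1.symm) (by rw [hV.2]; exact h1)⟩
  rw [List.replicate_succ', block_inj (by simp)] at hpre
  refine lex_lt_of_prefix (hU.1.trans hpre.1.symm) (m := 2) ?_
  rw [block_one, zero_add, List.cons.injEq] at hpre
  rw [hU.2, block_two, hpre.2.1, List.cons_lt_cons_iff]
  exact Or.inl (by omega)

theorem lt_pair_of_le {x y : ℤ} (h : [x, y] ≤ [a, a]) : [x, y] < [a, a + 1] := by
  refine lt_of_le_of_lt h ?_
  simp [List.cons_lt_cons_iff]

theorem pair_lt_of_le {x y : ℤ} (h : [a + 1, a + 1] ≤ [x, y]) : [a + 1, a] < [x, y] := by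
  refine lt_of_lt_of_le ?_ h
  simp [List.cons_lt_cons_iff]

theorem GenericFreq.exists_inPlateau {φ : ℝ} (hL : IsLongestCentralPrefix a s u)
    (hg : GenericFreq a s u φ) :
    ∃ w h l, IsCentralOf a w h l ∧ φ = (h : ℝ) / l ∧ InPlateau s h l := by
  cases hg with
  | powA_low k hk hu h1 h2 =>
    subst hu
    refine ⟨_, _, _, isCentralOf_replicate a k, ?_, inPlateau_replicate hL h1 h2⟩
    push_cast; field_simp
  | powA_high k hk hu h1 =>
    subst hu
    obtain ⟨j, rfl⟩ := Nat.exists_eq_add_of_le' hk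
    have hpre := hL.1.2
    rw [List.length_replicate] at hpre
    refine ⟨_, _, _, isCentralOf_replicate a j, ?_, inPlateau_replicate_right hpre h1⟩
    push_cast; field_simp; ring
  | powB_high k hk hu h1 h2 =>
    subst hu
    refine ⟨_, _, _, isCentralOf_replicate_succ a k, ?_, inPlateau_replicate_succ hL h1 h2⟩
    push_cast; field_simp
  | powB_low k hk hu h1 =>
    subst hu
    obtain ⟨j, rfl⟩ := Nat.exists_eq_add_of_le' hk
    have hpre := hL.1.2
    rw [List.length_replicate] at hpre
    refine ⟨_, _, _, isCentralOf_replicate_succ a j, ?_, inPlateau_replicate_succ_left hpre h1⟩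
    push_cast; field_simp; ring
  | mixed_u p q xy v hp hq hu hu' hxy hv hc =>
    obtain ⟨hc', hpre⟩ := hL.1
    obtain ⟨h, l, H⟩ := isCentral_iff.1 hc'
    exact ⟨u, h, l, H, H.slope_eq.symm, inPlateau_self H hpre hxy hv hc⟩
  | mixed_q p q xy v hp hq hu hu' hxy hv hc =>
    obtain ⟨h₂, l₂, Hp⟩ := isCentral_iff.1 hp
    obtain ⟨h₁, l₁, Hq⟩ := isCentral_iff.1 hq
    refine ⟨q, h₁, l₁, Hq, Hq.slope_eq.symm, inPlateau_left hL Hp Hq hu hu' hxy hv ?_⟩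
    refine hc.imp id fun h => ?_
    rw [hxy, block_two] at h ⊢
    exact lt_pair_of_le h
  | mixed_p p q xy v hp hq hu hu' hxy hv hc =>
    obtain ⟨h₂, l₂, Hp⟩ := isCentral_iff.1 hp
    obtain ⟨h₁, l₁, Hq⟩ := isCentral_iff.1 hq
    refine ⟨p, h₂, l₂, Hp, Hp.slope_eq.symm, inPlateau_right hL Hp Hq hu hu' hxy hv ?_⟩
    refine hc.imp id fun h => ?_
    rw [hxy, block_two] at h ⊢
    exact pair_lt_of_le h

theorem GenericFreq.isSharpSlope {φ : ℝ} (hL : IsLongestCentralPrefix a s u)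
    (hg : GenericFreq a s u φ) : (a : ℝ) ≤ φ ∧ IsSharpSlope (cons (a + 1) s) φ := by
  obtain ⟨w, h, l, H, rfl, h1, h2⟩ := hg.exists_inPlateau hL
  exact ⟨H.lt_slope.le, isSharpSlope_of_between H.lt_slope H.slope_lt h1.le h2.le⟩

theorem WordFreq.isSharpSlope {φ : ℝ} (h : WordFreq a s φ) :
    (a : ℝ) ≤ φ ∧ IsSharpSlope (cons (a + 1) s) φ := by
  rcases h with h | ⟨_, u, hL, hg⟩
  · exact h.isSharpSlope
  · exact hg.isSharpSlope hL

end Generic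

/-! ### Completeness of the rules. -/

section Existence

variable {a : ℤ} {s : ℕ → ℤ} {u : List ℤ}

theorem le_const_of_prefix {k : ℕ} {c : ℤ} (hpre : block s 0 k = List.replicate k c)
    (h : s k < c) : toLex s ≤ toLex (fun _ => c) := by
  rw [block_eq_replicate] at hpre
  exact le_of_lt (lex_lt_iff.2 ⟨k, fun j hj => by simpa using hpre j hj, h⟩)

theorem const_le_of_prefix {k : ℕ} {c : ℤ} (hpre : block s 0 k = List.replicate k c)
    (h : c < s k) : toLex (fun _ => c) ≤ toLex s := by
  rw [block_eq_replicate] at hpre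
  exact le_of_lt (lex_lt_iff.2 ⟨k, fun j hj => by simpa using (hpre j hj).symm, h⟩)

/-- Each equality left out by the rules would make a longer central word a prefix of `s`. An empty
`u` leaves only a first letter outside `{a, a + 1}`, which is a special case. -/
theorem exists_genericFreq (hL : IsLongestCentralPrefix a s u) (hm : ∀ ψ, ¬ MeagerFreq a s ψ) :
    ∃ φ, GenericFreq a s u φ := by
  obtain ⟨hcu, hpre⟩ := hL.1
  obtain ⟨h, l, H⟩ := isCentral_iff.1 hcu
  rcases H.decomposition with ⟨k, rfl⟩ | ⟨k, rfl⟩ | ⟨p, q, hp, hq, hu, hu'⟩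
  · have hne := hL.ne_of_replicate (Or.inl rfl)
    rw [List.length_replicate] at hpre
    have hlow : ¬ s k < a := fun h => hm _ (.low (le_const_of_prefix hpre h))
    have hgt : a < s k := lt_of_le_of_ne (not_lt.1 hlow) hne.symm
    cases k with
    | zero =>
      have hne' : s 0 ≠ a + 1 :=
        IsLongestCentralPrefix.ne_of_replicate (k := 0) (a := a) hL (Or.inr rfl)
      exact absurd (MeagerFreq.high (const_le_of_prefix (k := 0) rfl (by omega))) (hm _)
    | succ j =>
      have h1 : List.replicate (j + 1 + 1) a < block s (j + 1) (j + 1 + 1) := by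
        rw [block_succ, List.replicate_succ, List.cons_lt_cons_iff]
        exact Or.inl hgt
      rcases lt_trichotomy (block s (j + 1) (j + 1 + 1)) ((a + 1) :: List.replicate (j + 1) a)
        with h2 | h2 | h2
      · exact ⟨_, .powA_low (j + 1) (by omega) rfl h1 h2⟩
      · refine absurd ?_ (hL.not_prefix (isCentral_replicate_mid a j)
          (n := (j + 1) + (j + 1 + 1)) (by simp) (by simp))
        rw [block_add, hpre, zero_add, h2]
      · exact ⟨_, .powA_high (j + 1) (by omega) rfl h2⟩
  · have hne := hL.ne_of_replicate (Or.inr rfl)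
    rw [List.length_replicate] at hpre
    have hhigh : ¬ a + 1 < s k := fun h => hm _ (.high (const_le_of_prefix hpre h))
    have hlt : s k < a + 1 := lt_of_le_of_ne (not_lt.1 hhigh) hne
    cases k with
    | zero =>
      have hne' : s 0 ≠ a :=
        IsLongestCentralPrefix.ne_of_replicate (k := 0) (a := a) hL (Or.inl rfl)
      exact absurd (MeagerFreq.low (le_const_of_prefix (k := 0) rfl (by omega))) (hm _)
    | succ j =>
      have h1 : block s (j + 1) (j + 1 + 1) < List.replicate (j + 1 + 1) (a + 1) := by
        rw [block_succ, List.replicate_succ, List.cons_lt_cons_iff]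
        exact Or.inl hlt
      rcases lt_trichotomy (block s (j + 1) (j + 1 + 1)) (a :: List.replicate (j + 1) (a + 1))
        with h2 | h2 | h2
      · exact ⟨_, .powB_low (j + 1) (by omega) rfl h2⟩
      · refine absurd ?_ (hL.not_prefix (isCentral_replicate_succ_mid a j)
          (n := (j + 1) + (j + 1 + 1)) (by simp) (by simp))
        rw [block_add, hpre, zero_add, h2]
      · exact ⟨_, .powB_high (j + 1) (by omega) rfl h2 h1⟩
  · obtain ⟨h₂, l₂, Hp⟩ := isCentral_iff.1 hp
    obtain ⟨h₁, l₁, Hq⟩ := isCentral_iff.1 hq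
    obtain ⟨rfl, rfl, det⟩ := IsCentralOf.det_eq_one H Hq Hp hu hu'
    obtain ⟨v, hv⟩ : ∃ v, v = block s (u.length + 2) (u.length + 2) := ⟨_, rfl⟩
    obtain ⟨xy, hxy⟩ : ∃ xy, xy = block s u.length 2 := ⟨_, rfl⟩
    rcases lt_trichotomy xy [a, a + 1] with h1 | h1 | h1
    · refine ⟨_, .mixed_q p q xy v hp hq hu hu' hxy hv (Or.inr ?_)⟩
      rw [hxy, block_two] at h1 ⊢
      generalize s u.length = x at h1 ⊢
      generalize s (u.length + 1) = y at h1 ⊢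
      rw [List.cons_lt_cons_iff, List.cons_lt_cons_iff] at h1
      rcases h1 with h1 | ⟨rfl, h1 | ⟨-, h1⟩⟩
      · exact le_of_lt (List.cons_lt_cons_iff.2 (Or.inl h1))
      · rcases (Int.lt_add_one_iff.1 h1).lt_or_eq with h1 | rfl
        · exact le_of_lt (by simp [List.cons_lt_cons_iff, h1])
        · exact le_rfl
      · simp at h1
    · rcases lt_trichotomy v (u ++ [a, a + 1]) with h2 | h2 | h2
      · exact ⟨_, .mixed_q p q xy v hp hq hu hu' hxy hv (Or.inl ⟨h1, h2⟩)⟩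
      · exfalso
        obtain ⟨Hm, hm'⟩ := IsCentralOf.mediant Hq H (by push_cast; linarith)
        rw [← hm'] at Hm
        have hlen : (u ++ [a, a + 1] ++ q).length = u.length + (2 + q.length) := by simp; omega
        refine hL.not_prefix ⟨_, _, Hm⟩ (by omega) hlen ?_
        rw [List.append_assoc, block_inj rfl, zero_add, block_inj (m := 2) rfl]
        refine ⟨hpre, by rw [← hxy, h1], ?_⟩
        have hlu : u.length + 2 = q.length + (p.length + 4) := by rw [hu']; simp; omega
        rw [show block s (u.length + 2) (u.length + 2) =
          block s (u.length + 2) (q.length + (p.length + 4)) by rw [← hlu], h2] at hv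
        have hq' : u ++ [a, a + 1] = q ++ ([a + 1, a] ++ p ++ [a, a + 1]) := by rw [hu']; simp
        rw [hq'] at hv
        exact ((block_inj rfl).1 hv.symm).1
      · exact ⟨_, .mixed_u p q xy v hp hq hu hu' hxy hv (Or.inl ⟨h1, h2⟩)⟩
    rcases lt_trichotomy xy [a + 1, a] with h3 | h3 | h3
    · exact ⟨_, .mixed_u p q xy v hp hq hu hu' hxy hv (Or.inr (Or.inl ⟨h1, h3⟩))⟩
    · rcases lt_trichotomy v (u ++ [a + 1, a]) with h2 | h2 | h2
      · exact ⟨_, .mixed_u p q xy v hp hq hu hu' hxy hv (Or.inr (Or.inr ⟨h3, h2⟩))⟩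
      · exfalso
        obtain ⟨Hm, -⟩ := IsCentralOf.mediant H Hp (by push_cast; linarith)
        have hlen : (u ++ [a + 1, a] ++ p).length = u.length + (2 + p.length) := by simp; omega
        refine hL.not_prefix ⟨_, _, Hm⟩ (by omega) hlen ?_
        rw [List.append_assoc, block_inj rfl, zero_add, block_inj (m := 2) rfl]
        refine ⟨hpre, by rw [← hxy, h3], ?_⟩
        have hlu : u.length + 2 = p.length + (q.length + 4) := by rw [hu]; simp; omega
        rw [show block s (u.length + 2) (u.length + 2) =
          block s (u.length + 2) (p.length + (q.length + 4)) by rw [← hlu], h2] at hv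
        have hp' : u ++ [a + 1, a] = p ++ ([a, a + 1] ++ q ++ [a + 1, a]) := by rw [hu]; simp
        rw [hp'] at hv
        exact ((block_inj rfl).1 hv.symm).1
      · exact ⟨_, .mixed_p p q xy v hp hq hu hu' hxy hv (Or.inl ⟨h3, h2⟩)⟩
    · refine ⟨_, .mixed_p p q xy v hp hq hu hu' hxy hv (Or.inr ?_)⟩
      rw [hxy, block_two] at h3 ⊢
      generalize s u.length = x at h3 ⊢
      generalize s (u.length + 1) = y at h3 ⊢
      rw [List.cons_lt_cons_iff, List.cons_lt_cons_iff] at h3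
      rcases h3 with h3 | ⟨rfl, h3 | ⟨-, h3⟩⟩
      · exact le_of_lt (List.cons_lt_cons_iff.2 (Or.inl h3))
      · rcases (Int.add_one_le_iff.2 h3).lt_or_eq with h3 | rfl
        · exact le_of_lt (by simp [List.cons_lt_cons_iff, h3])
        · exact le_rfl
      · simp at h3

/-- A word whose prefixes are prefixes of upper mechanical words is itself, up to its behaviour at
integer multiples of the slope, mechanical. -/
theorem exists_slope_of_prefixes {d : ℕ → ℤ} {c e : ℝ}
    (h : ∀ N : ℕ, ∃ φ ∈ Set.Icc c e, ∀ n ≤ N, psum d n = ⌈φ * n⌉) :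
    ∃ α ∈ Set.Icc c e, d = upperMech α 0 ∨ ∀ n : ℕ, 0 < n → psum d n = ⌊α * n⌋ + 1 := by
  choose φ hφ hd using h
  obtain ⟨α, hα, ψ, hψ, hlim⟩ := isCompact_Icc.tendsto_subseq hφ
  have hlim' : ∀ n : ℕ, Filter.Tendsto (fun k => φ (ψ k) * n) Filter.atTop (nhds (α * n)) :=
    fun n => hlim.mul_const _
  have hge : ∀ n : ℕ, ∀ᶠ k in Filter.atTop, n ≤ ψ k := fun n =>
    hψ.tendsto_atTop.eventually_ge_atTop n
  refine ⟨α, hα, ?_⟩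
  -- Slopes approaching `α` from below or equal to it give ceilings `⌈α n⌉` in the limit; slopes
  -- approaching strictly from above give `⌊α n⌋ + 1`.
  by_cases hf : ∃ᶠ k in Filter.atTop, φ (ψ k) ≤ α
  · left
    refine eq_of_psum fun n => ?_
    have h1 := (hlim' n).eventually (lt_mem_nhds
      (show (⌈α * n⌉ : ℝ) - 1 < α * n by linarith [Int.ceil_lt_add_one (α * n)]))
    obtain ⟨k, hk, h2, h3⟩ := (hf.and_eventually (h1.and (hge n))).exists
    rw [hd _ n h3, psum_upperMech, Int.ceil_eq_iff]
    refine ⟨h2, le_trans ?_ (Int.le_ceil (α * n))⟩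
    gcongr
  · right
    intro n hn
    rw [Filter.not_frequently] at hf
    have h1 := (hlim' n).eventually (gt_mem_nhds (Int.lt_floor_add_one (α * n)))
    obtain ⟨k, hk, h2, h3⟩ := (hf.and (h1.and (hge n))).exists
    have hn' : (0 : ℝ) < n := by exact_mod_cast hn
    rw [hd _ n h3, Int.ceil_eq_iff]
    push_cast
    refine ⟨?_, h2.le⟩
    rw [not_le] at hk
    nlinarith [Int.floor_le (α * n)]

/-- With unboundedly long central prefixes, `b s` would be a limit of upper mechanical words. Then
`b s` is upper mechanical or `a s` is lower mechanical, a special case in either event. -/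
theorem exists_isLongestCentralPrefix (hm : ∀ ψ, ¬ MeagerFreq a s ψ) :
    ∃ u, IsLongestCentralPrefix a s u := by
  classical
  by_cases hb : ∃ B, ∀ w, IsCentral a w → block s 0 w.length = w → w.length ≤ B
  · obtain ⟨B, hB⟩ := hb
    set P : ℕ → Prop := fun n => ∃ w, IsCentral a w ∧ block s 0 w.length = w ∧ w.length = n
    have h0 : P 0 := ⟨[], ⟨_, _, isCentralOf_replicate a 0⟩, rfl, rfl⟩
    obtain ⟨u, hu, hpre, hlen⟩ := Nat.findGreatest_spec (P := P) (Nat.zero_le B) h0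
    refine ⟨u, ⟨hu, hpre⟩, fun w hw hw' => ?_⟩
    rw [hlen]
    exact Nat.le_findGreatest (hB w hw hw') ⟨w, hw, hw', rfl⟩
  · exfalso
    push Not at hb
    have hpre : ∀ N : ℕ, ∃ φ ∈ Set.Icc (a : ℝ) (a + 1),
        ∀ n ≤ N, psum (cons (a + 1) s) n = ⌈φ * n⌉ := by
      intro N
      obtain ⟨w, hw, hw', hlen⟩ := hb N
      obtain ⟨h, l, H⟩ := isCentral_iff.1 hw
      refine ⟨(h : ℝ) / l, ⟨H.lt_slope.le, H.slope_lt.le⟩, fun n hn => ?_⟩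
      rw [← psum_upperMech]
      refine psum_congr fun k hk => ?_
      cases k with
      | zero => rw [upperMech_zero, H.ceil_eq]; rfl
      | succ k =>
        have h1 := block_eq_block.1 (hw'.trans H.upper_prefix.1.symm) k (by omega)
        rw [zero_add] at h1
        exact h1
    obtain ⟨α, hα, h | h⟩ := exists_slope_of_prefixes hpre
    · exact hm α (.mech α hα (Or.inr h))
    · refine hm α (.mech α hα (Or.inl (eq_of_psum fun n => ?_)))
      rw [psum_lowerMech]
      cases n with
      | zero => simp [psum_zero]
      | succ n =>
        have h1 := h (n + 1) n.succ_pos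
        rw [psum_cons_succ] at h1 ⊢
        linarith

theorem exists_wordFreq (a : ℤ) (s : ℕ → ℤ) : ∃ φ, WordFreq a s φ := by
  by_cases hm : ∃ ψ, MeagerFreq a s ψ
  · obtain ⟨ψ, h⟩ := hm
    exact ⟨ψ, Or.inl h⟩
  · rw [not_exists] at hm
    obtain ⟨u, hu⟩ := exists_isLongestCentralPrefix hm
    obtain ⟨φ, hφ⟩ := exists_genericFreq hu hm
    exact ⟨φ, Or.inr ⟨hm, u, hu, hφ⟩⟩

end Existence

/-! ### The number `Freq β`, and the theorem. -/

theorem dbar_one_intCast (m : ℤ) : dbar m 1 = fun _ => m - 1 := by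
  have h0 : dbar (m : ℝ) 1 0 = m - 1 := by
    rw [dbar_zero, mul_one, Int.ceil_intCast]
  have h1 : Tbar (m : ℝ) 1 = 1 := by
    rw [Tbar_eq, h0]; push_cast; ring
  funext n
  rw [dbar_iterate, Function.iterate_fixed h1, h0]

/-- The rules for `Freq β` determine exactly one number, and this is the largest slope of an upper
mechanical word that is at most the expansion of `1`. -/
theorem exists_isFreq {β : ℝ} (hβ : 1 < β) :
    ∃ φ, (∀ ψ, IsFreq β ψ ↔ ψ = φ) ∧ IsSharpSlope (dbar β 1) φ := by
  by_cases hint : ∃ m : ℤ, β = m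
  · refine ⟨β - 1, fun ψ => ⟨?_, fun h => Or.inl ⟨hint, h⟩⟩, ?_⟩
    · rintro (⟨_, h⟩ | ⟨h, _⟩)
      · exact h
      · exact absurd hint h
    · obtain ⟨m, rfl⟩ := hint
      rw [dbar_one_intCast]
      simpa using isSharpSlope_const (m - 1)
  · have h0 : dbar β 1 0 = ⌊β⌋ := by
      rw [dbar_zero, mul_one, sub_eq_iff_eq_add, Int.ceil_eq_iff]
      push_cast
      refine ⟨?_, (Int.lt_floor_add_one β).le⟩
      have : (⌊β⌋ : ℝ) < β := lt_of_le_of_ne (Int.floor_le β) fun h => hint ⟨⌊β⌋, h.symm⟩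
      linarith
    have hd : dbar β 1 = cons ⌊β⌋ (shift (dbar β 1) 1) := by rw [← h0, cons_shift]
    -- A sharp slope is tested on positive slopes only, so its uniqueness requires nonnegativity.
    have ha : (0 : ℝ) ≤ ((⌊β⌋ - 1 : ℤ) : ℝ) := by
      have : (1 : ℤ) ≤ ⌊β⌋ := Int.le_floor.2 (by push_cast; exact hβ.le)
      exact_mod_cast (by omega : (0 : ℤ) ≤ ⌊β⌋ - 1)
    have hsharp : ∀ ψ, WordFreq (⌊β⌋ - 1) (shift (dbar β 1) 1) ψ →
        0 ≤ ψ ∧ IsSharpSlope (dbar β 1) ψ := by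
      intro ψ h
      have h1 := h.isSharpSlope
      rw [sub_add_cancel, ← hd] at h1
      exact ⟨ha.trans h1.1, h1.2⟩
    obtain ⟨φ, hφ⟩ := exists_wordFreq (⌊β⌋ - 1) (shift (dbar β 1) 1)
    refine ⟨φ, fun ψ => ⟨?_, ?_⟩, (hsharp φ hφ).2⟩
    · rintro (⟨h, _⟩ | ⟨_, s, hs, h⟩)
      · exact absurd h hint
      · have hs' : s = shift (dbar β 1) 1 := by rw [hs, shift_cons]
        rw [hs'] at h
        exact (hsharp ψ h).2.unique (hsharp φ hφ).2 (hsharp ψ h).1 (hsharp φ hφ).1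
    · rintro rfl
      exact Or.inr ⟨hint, _, hd, hφ⟩

end BetaOrbit

open BetaOrbit
theorem theorem4 :
    -- (a) for fixed base, `Freq(β)` is a well-defined number, and it is the sharp bound
    (∀ β : ℝ, 1 < β → ∃ φ : ℝ, (∀ ψ : ℝ, IsFreq β ψ ↔ ψ = φ) ∧
      (∀ α : ℝ, 0 < α → α ≤ φ → XiWellDefined α β) ∧
      (∀ α : ℝ, 0 < α → φ < α → ¬ ∃ S : Set ℝ, IsXiSet α β S)) ∧
    -- (b) for fixed frequency, `Δ(α)` is a well-defined number, and it is the sharp bound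
    (∀ α : ℝ, 0 < α → ∃ δ : ℝ, (∀ η : ℝ, IsDelta α η ↔ η = δ) ∧
      (∀ β : ℝ, δ ≤ β → XiWellDefined α β) ∧
      (∀ β : ℝ, 1 < β → β < δ → ¬ ∃ S : Set ℝ, IsXiSet α β S)) ∧
    -- (c) the case of a mechanical expansion of `1`
    (∀ β α₀ : ℝ, 1 < β → IsMechanical (dbar β 1) α₀ →
      ∀ α : ℝ, 0 < α → α ≤ α₀ → XiWellDefined α β) := by
  refine ⟨fun β hβ => ?_, fun α hα => ?_, fun β α₀ hβ hmech α hα hle => ?_⟩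
  · obtain ⟨φ, hφ, hsharp⟩ := exists_isFreq hβ
    refine ⟨φ, hφ, fun α hα h => xiWellDefined_of_le hα hβ ((hsharp α hα).2 h), ?_⟩
    rintro α hα h ⟨S, hS⟩
    exact absurd ((hsharp α hα).1 (upperMech_le_of_isXiSet hβ hS)) (not_le.2 h)
  · obtain ⟨δ, hδ, hd⟩ := exists_dbar_one_eq hα
    refine ⟨δ, fun η => ⟨?_, ?_⟩, fun β h => ?_, ?_⟩
    · rintro (⟨h, _⟩ | ⟨_, hη, hdη⟩)
      · exact absurd h hα.ne'
      · rcases lt_trichotomy η δ with h | h | h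
        · exact absurd (dbar_one_strictMono hη h) (by rw [hd, hdη]; exact lt_irrefl _)
        · exact h
        · exact absurd (dbar_one_strictMono hδ h) (by rw [hd, hdη]; exact lt_irrefl _)
    · rintro rfl
      exact Or.inr ⟨hα, hδ, hd⟩
    · refine xiWellDefined_of_le hα (hδ.trans_le h) ?_
      rw [← hd]
      rcases h.lt_or_eq with h | rfl
      · exact (dbar_one_strictMono hδ h).le
      · exact le_rfl
    · rintro β hβ h ⟨S, hS⟩
      have h1 := upperMech_le_of_isXiSet hβ hS
      rw [← hd] at h1
      exact absurd (dbar_one_strictMono hβ h) (not_lt.2 h1)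
  · exact xiWellDefined_of_le hα hβ
      (upperMech_le_of_mean hle (mean_of_isMechanical hmech) (shift_dbar_one_le hβ))
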